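/- For $n \in \mathbb{N}$ let $[n]=\{1,\dots,n\}$. A $d$-dimensional permutation is a pair $\pi=(S,P)$ of a finite set $S=S(\pi)$ and an injection $P:S\to\mathbb{N}^d$ such that each of the $d$ coordinate functions is injective on $P(S)$; its length is $|\pi|=|S|$. For $p,p'\in S$ and $\alpha\in[d]$ write $p<^{\pi}_{\alpha}p'$ if the $\alpha$-th coordinate of $P(p)$ is smaller than that of $P(p')$. An embedding of $\sigma$ into $\pi$ is a function $\phi:S(\sigma)\to S(\pi)$ such that for all $p,p'\in S(\sigma)$ and all $\alpha\in[d]$: $p<^{\sigma}_{\alpha}p'$ if and only if $\phi(p)<^{\pi}_{\alpha}\phi(p')$. A $d$-dimensional permutation of length $n$ is reduced if $S=[n]$ and $P(S)\subseteq[n]^d$; as an input it is given as the array of its $n$ points. The problem $d$-Dimensional Permutation Pattern is: given two reduced $d$-dimensional permutations $\sigma$ and $\pi$, does there exist an embedding of $\sigma$ into $\pi$? Theorem. For every fixed $d\ge 3$, $d$-Dimensional Permutation Pattern, parameterized by $|\sigma|$, is $\mathsf{W[1]}$-hard under parameterized (fpt many-one) reductions. That is, for every parameterized problem $A\in\mathsf{W[1]}$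 there are computable functions $f,g:\mathbb{N}\to\mathbb{N}$, a constant $c$, and an algorithm which maps every instance $(x,k)$ of $A$, in at most $f(k)\cdot(|x|+1)^{c}$ steps, to an instance of $d$-Dimensional Permutation Pattern whose parameter is at most $g(k)$, such that $(x,k)$ is a yes-instance if and only if the new instance is a yes-instance. Here $\mathsf{W[1]}$ is the class of the parameterized problems that are fpt-reducible, for some constant $q$, to the problem of deciding, given a propositional formula in conjunctive normal form with at most $q$ literals per clause and the parameter $k$, whether it has a satisfying assignment with exactly $k$ variables true. -/

import Mathlib

/-! ### A random access machine with a step count -/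

/-- Structured programs of a random access machine. The machine has registers `0, 1, 2, …` and
memory arrays `0, 1, 2, …`; every register and every array cell holds a natural number. A program
mentions only finitely many registers and arrays. -/
inductive RamProg : Type
  /-- do nothing -/
  | skip : RamProg
  /-- register `x` := the constant `c` -/
  | const (x c : ℕ) : RamProg
  /-- register `x` := register `y` + register `z` -/
  | add (x y z : ℕ) : RamProg
  /-- register `x` := max (register `y` - register `z`, 0) -/
  | sub (x y z : ℕ) : RamProg
  /-- register `x` := the cell of array `a` whose index is in register `y` -/
  | load (x a y : ℕ) : RamProg
  /-- the cell of array `a` whose index is in register `x` := register `y` -/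
  | store (a x y : ℕ) : RamProg
  /-- first `p`, then `q` -/
  | seq (p q : RamProg) : RamProg
  /-- `p` if register `x` is nonzero, and `q` otherwise -/
  | cond (x : ℕ) (p q : RamProg) : RamProg
  /-- repeat `p` while register `x` is nonzero -/
  | loop (x : ℕ) (p : RamProg) : RamProg

/-- A configuration of the memory: the contents of the registers and of the arrays. -/
structure RamState : Type where
  reg : ℕ → ℕ
  arr : ℕ → ℕ → ℕ

namespace RamState

/-- Overwrite register `x` by `v`. -/
def setReg (s : RamState) (x v : ℕ) : RamState :=
  { s with reg := Function.update s.reg x v }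

/-- Overwrite cell `i` of array `a` by `v`. -/
def setArr (s : RamState) (a i v : ℕ) : RamState :=
  { s with arr := Function.update s.arr a (Function.update (s.arr a) i v) }

/-- The initial configuration on the input `(w, k)`: register `0` holds the length of the word `w`,
register `1` holds `k`, array `0` holds the letters of `w` as numbers `0` and `1`, and everything
else is `0`. -/
def init (w : List Bool) (k : ℕ) : RamState where
  reg := fun x => if x = 0 then w.length else if x = 1 then k else 0
  arr := fun a i => if a = 0 then (w.getD i false).toNat else 0

/-- The configuration `s` shows the output `(w, k)`: register `0` holds the length of `w`,
register `1` holds `k`, and the first cells of array `0` hold the letters of `w`. -/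
def Shows (s : RamState) (w : List Bool) (k : ℕ) : Prop :=
  s.reg 0 = w.length ∧ s.reg 1 = k ∧ ∀ i < w.length, s.arr 0 i = (w.getD i false).toNat

end RamState

/-- `RamProg.Runs p s t s'`: started in the configuration `s`, the program `p` halts after exactly
`t` steps in the configuration `s'`. Each elementary instruction and each test is one step. -/
inductive RamProg.Runs : RamProg → RamState → ℕ → RamState → Prop
  | skip (s : RamState) : Runs .skip s 1 s
  | const (s : RamState) (x c : ℕ) : Runs (.const x c) s 1 (s.setReg x c)
  | add (s : RamState) (x y z : ℕ) : Runs (.add x y z) s 1 (s.setReg x (s.reg y + s.reg z))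
  | sub (s : RamState) (x y z : ℕ) : Runs (.sub x y z) s 1 (s.setReg x (s.reg y - s.reg z))
  | load (s : RamState) (x a y : ℕ) : Runs (.load x a y) s 1 (s.setReg x (s.arr a (s.reg y)))
  | store (s : RamState) (a x y : ℕ) :
      Runs (.store a x y) s 1 (s.setArr a (s.reg x) (s.reg y))
  | seq {p q : RamProg} {s s' s'' : RamState} {t t' : ℕ} :
      Runs p s t s' → Runs q s' t' s'' → Runs (.seq p q) s (t + t') s''
  | cond_pos {x : ℕ} {p q : RamProg} {s s' : RamState} {t : ℕ} :
      s.reg x ≠ 0 → Runs p s t s' → Runs (.cond x p q) s (t + 1) s'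
  | cond_zero {x : ℕ} {p q : RamProg} {s s' : RamState} {t : ℕ} :
      s.reg x = 0 → Runs q s t s' → Runs (.cond x p q) s (t + 1) s'
  | loop_pos {x : ℕ} {p : RamProg} {s s' s'' : RamState} {t t' : ℕ} :
      s.reg x ≠ 0 → Runs p s t s' → Runs (.loop x p) s' t' s'' →
        Runs (.loop x p) s (t + t' + 1) s''
  | loop_zero {x : ℕ} {p : RamProg} {s : RamState} :
      s.reg x = 0 → Runs (.loop x p) s 1 s

/-! ### Parameterized problems and fpt-reductions -/

/-- A parameterized problem: a set of pairs of a binary word and a parameter. -/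
abbrev ParamProblem : Type := Set (List Bool × ℕ)

/-- Parameterized (fpt) many-one reducibility of `A` to `B`: there is a map `(x, k) ↦ R (x, k)` that
preserves and reflects membership, whose new parameter is at most `g k`, and which is computed in
at most `f k * (|x| + 1) ^ c` steps, with `f` and `g` computable. -/
def FptReducible (A B : ParamProblem) : Prop :=
  ∃ (R : List Bool × ℕ → List Bool × ℕ) (p : RamProg) (f g : ℕ → ℕ) (c : ℕ),
    Computable f ∧ Computable g ∧
    ∀ (x : List Bool) (k : ℕ),
      ((x, k) ∈ A ↔ R (x, k) ∈ B) ∧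
      (R (x, k)).2 ≤ g k ∧
      ∃ (t : ℕ) (s : RamState),
        t ≤ f k * (x.length + 1) ^ c ∧
        p.Runs (RamState.init x k) t s ∧
        s.Shows (R (x, k)).1 (R (x, k)).2

/-- A finite sequence of natural numbers as a binary word, each number `m` being written as `m` ones
followed by a zero. In the problems below the numbers are indices into the objects described, so
that this word has size polynomial in the size of the object. -/
def encodeNats (l : List ℕ) : List Bool :=
  l.flatMap fun m => List.replicate m true ++ [false]

/-! ### The class W[1] -/

/-- A literal: a variable, with `true` for the variable itself and `false` for its negation. -/
abbrev Lit : Type := ℕ × Bool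

/-- A formula in conjunctive normal form: a list of clauses, each a list of literals. -/
abbrev CnfFormula : Type := List (List Lit)

namespace CnfFormula

/-- The set of variables that occur in the formula. -/
def vars (F : CnfFormula) : Finset ℕ :=
  (F.flatten.map Prod.fst).toFinset

/-- The assignment that makes exactly the variables in `T` true satisfies the formula. -/
def SatBy (F : CnfFormula) (T : Finset ℕ) : Prop :=
  ∀ C ∈ F, ∃ l ∈ C, (l.1 ∈ T ↔ l.2 = true)

/-- The formula has a satisfying assignment of weight `k`, that is, with exactly `k` of its variables
true. -/
def WeightedSat (F : CnfFormula) (k : ℕ) : Prop :=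
  ∃ T : Finset ℕ, T ⊆ F.vars ∧ T.card = k ∧ F.SatBy T

/-- The formula as a word: each clause is its length followed by its literals. -/
def encode (F : CnfFormula) : List Bool :=
  encodeNats (F.flatMap fun C => C.length :: C.flatMap fun l => [l.1, l.2.toNat])

end CnfFormula

/-- Weighted `q`-CNF satisfiability: given a conjunction of clauses of at most `q` literals each, and
the parameter `k`, is there a satisfying assignment of weight `k`? -/
def WeightedCnfSat (q : ℕ) : ParamProblem :=
  {I | ∃ F : CnfFormula, (∀ C ∈ F, C.length ≤ q) ∧ I.1 = F.encode ∧ F.WeightedSat I.2}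

/-- The class W[1]: the parameterized problems that are fpt-reducible to weighted `q`-CNF
satisfiability for some fixed `q`. -/
def ClassW1 : Set ParamProblem :=
  {A | ∃ q : ℕ, 1 ≤ q ∧ FptReducible A (WeightedCnfSat q)}

/-- W[1]-hardness under fpt-reductions. -/
def W1Hard (B : ParamProblem) : Prop :=
  ∀ A ∈ ClassW1, FptReducible A B

/-! ### `d`-dimensional permutations -/

/-- A `d`-dimensional permutation: a finite set `S` of labels and a map `P` that is injective on `S`
and places the labels at points of `ℕ ^ d` in general position, i.e. each coordinate is injective on
the set of points. (The values of `P` outside `S` are irrelevant.) -/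
structure DimPerm (d : ℕ) : Type where
  S : Finset ℕ
  P : ℕ → Fin d → ℕ
  injOn : Set.InjOn P S
  general : ∀ a : Fin d, Set.InjOn (fun x : Fin d → ℕ => x a) (P '' S)

namespace DimPerm

variable {d : ℕ}

/-- The length of a `d`-dimensional permutation. -/
def length (π : DimPerm d) : ℕ := π.S.card

/-- `φ` is an embedding of `σ` into `π`. -/
def IsEmbedding (σ π : DimPerm d) (φ : σ.S → π.S) : Prop :=
  ∀ (p p' : σ.S) (a : Fin d), σ.P p a < σ.P p' a ↔ π.P (φ p) a < π.P (φ p') a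

/-- `π` is reduced if, with `n` its length, `S = {1, …, n}` and all points lie in `{1, …, n} ^ d`. -/
def IsReduced (π : DimPerm d) : Prop :=
  π.S = Finset.Icc 1 π.length ∧ ∀ s ∈ π.S, ∀ a, π.P s a ∈ Finset.Icc 1 π.length

/-- A reduced permutation as the sequence of its length `n` and the coordinates of its points
`P 1, …, P n`. -/
def toNats (π : DimPerm d) : List ℕ :=
  π.length :: (List.range π.length).flatMap fun i => List.ofFn (π.P (i + 1))

end DimPerm

/-- `d`-Dimensional Permutation Pattern, parameterized by the length of the pattern: given two
`d`-dimensional permutations `σ` and `π` (reduced, and represented by the arrays of their points),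
is there an embedding of `σ` into `π`? -/
def DimPermPattern (d : ℕ) : ParamProblem :=
  {I | ∃ σ π : DimPerm d, σ.IsReduced ∧ π.IsReduced ∧
    I = (encodeNats (σ.toNats ++ π.toNats), σ.length) ∧
    ∃ φ : σ.S → π.S, DimPerm.IsEmbedding σ π φ}

/-! Weighted `q`-CNF satisfiability is reduced directly to a binary constraint satisfaction problem
whose number of variables depends on `k` alone, and this problem is drawn as a pair of point sets
with three linear orders.

Formulas to constraints. With `Q = q + 2`, there are `k + 1` position variables, carrying `0` and
then the true variables in increasing order (variable `v` is written `v + 1`), and one tuple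
variable for each `Q`-tuple of positions. If a set `T` falsifies a clause, then all its negated
variables lie in `T`, so some tuple names them: negative literals are a local matter. Positive
literals are not, so the value of a tuple variable also encodes one branch of a bounded search tree.
Starting from the variables named by the tuple, it takes the first clause that is false so far, adds
the variable of one of its literals, and repeats this `k` times; it also records the position of
every variable listed. If `T` is a solution that contains the variables listed so far, a clause they
falsify has a positive literal in `T` that is not yet listed. Hence some branch stays inside `T` and
reaches a satisfying subset of `T` after at most `k` additions. Conversely, if every tuple extends
to such a subset of `T`, then `T` satisfies the formula: a falsified clause would be false under the
subset that contains its negated variables. All conditions link one tuple variable with one position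
variable, and the domain size is a function of `k` times `n ^ Q`. The two directions are
`exists_solvesCsp` (through `IsSearchTable.exists_row`) and `weightedSat_of_solvesCsp`.

Constraints to permutations. For each pair `(i, j)` with `i < K`, `j ≤ K` the text has a block of
points `(u, v)` allowed by the constraint between `i` and `j`, preceded by a separator; the pattern
is the same picture over a domain of size one. The third order goes block by block. Inside a block
the first order agrees with the third, but every separator is below every pair point in the first
order; so a pair point and the next separator cannot share a block, and counting blocks shows that
each block of the pattern goes to its own block. The first order compares the values `u` of the
blocks in a vertical strip, the second the values `v` in a horizontal strip. These yield only weak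
inequalities, one way; the diagonal blocks and the extra column `j = K`, in which `u = v`, close
them to cycles and force equality. This is `exists_isGridEmbedding` and
`IsGridEmbedding.exists_solvesCsp`. All coordinates after the second repeat the third order, which
covers every `d ≥ 3`.

Running time. The reduction is written as a list of tables, each given by an expression with bounded
sums. The expressions are compiled to the machine, and cutting every sum off at a computed cap `M`
makes the time polynomial in `M` without regard to what the memory contains. Correctness is proved
for a cap that exceeds all relevant quantities (`RamExpr.reductionTabs_spec`, `isLargeCap_capBase`).
Since the given reduction to satisfiability may announce a word much longer than its running time,
the word is first cut after a long run of zeros; such a run never occurs in the encoding of a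
satisfiable formula (`not_long_run`, `RamProg.scan_spec`). -/

/-! ### Hoare triples with a step bound -/

/-- Started in `s`, the program `p` halts within `T` steps in a state that satisfies `Q`. -/
def RamProg.Spec (p : RamProg) (s : RamState) (T : ℕ) (Q : RamState → Prop) : Prop :=
  ∃ t s', t ≤ T ∧ p.Runs s t s' ∧ Q s'

namespace RamProg.Spec

variable {p q : RamProg} {s : RamState} {T T' : ℕ} {Q Q' : RamState → Prop}

theorem mono (h : p.Spec s T Q) (hT : T ≤ T') (hQ : ∀ s', Q s' → Q' s') : p.Spec s T' Q' := by
  obtain ⟨t, s', ht, hr, hs⟩ := h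
  exact ⟨t, s', ht.trans hT, hr, hQ _ hs⟩

theorem seq (h : p.Spec s T Q) (h' : ∀ s', Q s' → q.Spec s' T' Q') :
    (RamProg.seq p q).Spec s (T + T') Q' := by
  obtain ⟨t, s', ht, hr, hs⟩ := h
  obtain ⟨t', s'', ht', hr', hs'⟩ := h' s' hs
  exact ⟨t + t', s'', by omega, hr.seq hr', hs'⟩

theorem const {x c : ℕ} (h : Q (s.setReg x c)) : (RamProg.const x c).Spec s 1 Q :=
  ⟨1, _, le_rfl, .const s x c, h⟩

theorem add {x y z : ℕ} (h : Q (s.setReg x (s.reg y + s.reg z))) :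
    (RamProg.add x y z).Spec s 1 Q :=
  ⟨1, _, le_rfl, .add s x y z, h⟩

theorem sub {x y z : ℕ} (h : Q (s.setReg x (s.reg y - s.reg z))) :
    (RamProg.sub x y z).Spec s 1 Q :=
  ⟨1, _, le_rfl, .sub s x y z, h⟩

theorem load {x a y : ℕ} (h : Q (s.setReg x (s.arr a (s.reg y)))) :
    (RamProg.load x a y).Spec s 1 Q :=
  ⟨1, _, le_rfl, .load s x a y, h⟩

theorem store {a x y : ℕ} (h : Q (s.setArr a (s.reg x) (s.reg y))) :
    (RamProg.store a x y).Spec s 1 Q :=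
  ⟨1, _, le_rfl, .store s a x y, h⟩

theorem cond {x : ℕ} (h : s.reg x ≠ 0 → p.Spec s T Q) (h' : s.reg x = 0 → q.Spec s T' Q) :
    (RamProg.cond x p q).Spec s (T + T' + 1) Q := by
  by_cases hx : s.reg x = 0
  · obtain ⟨t, s', ht, hr, hs⟩ := h' hx
    exact ⟨t + 1, s', by omega, .cond_zero hx hr, hs⟩
  · obtain ⟨t, s', ht, hr, hs⟩ := h hx
    exact ⟨t + 1, s', by omega, .cond_pos hx hr, hs⟩

/-- A loop whose counter register `x` decreases by one in each round. -/
theorem loop {x c : ℕ} (I : ℕ → RamState → Prop) (n : ℕ) (hx : s.reg x = n) (h0 : I 0 s)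
    (hstep : ∀ j < n, ∀ s, I j s → s.reg x = n - j →
      p.Spec s c fun s' => I (j + 1) s' ∧ s'.reg x = n - (j + 1)) :
    (RamProg.loop x p).Spec s (n * (c + 1) + 1) fun s' => I n s' ∧ s'.reg x = 0 := by
  have key : ∀ i j, i + j = n → ∀ s, I j s → s.reg x = i →
      (RamProg.loop x p).Spec s (i * (c + 1) + 1) fun s' => I n s' ∧ s'.reg x = 0 := by
    intro i
    induction i with
    | zero =>
      intro j hj s hI hs
      obtain rfl : j = n := by omega
      exact ⟨1, s, by omega, .loop_zero hs, hI, hs⟩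
    | succ i ih =>
      intro j hj s hI hs
      obtain ⟨t, s', ht, hr, hI', hs'⟩ := hstep j (by omega) s hI (by omega)
      obtain ⟨t', s'', ht', hr', hQ⟩ := ih (j + 1) (by omega) s' hI' (by omega)
      refine ⟨t + t' + 1, s'', ?_, .loop_pos (by omega) hr hr', hQ⟩
      rw [add_mul, one_mul]
      omega
  exact key n 0 (by omega) s h0 hx

end RamProg.Spec

/-! ### Expressions and their compilation -/

/-- Expressions over named variables and the arrays of the machine. -/
inductive RamExpr : Type
  | var (x : ℕ)
  | const (c : ℕ)
  | add (a b : RamExpr)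
  | sub (a b : RamExpr)
  | arr (i : ℕ) (e : RamExpr)
  | ite (c a b : RamExpr)
  /-- the sum of `b` over the values of `x` below the bound `e` (capped) -/
  | sum (x : ℕ) (e b : RamExpr)
  /-- `b` with `x` bound to the value of `e` -/
  | letE (x : ℕ) (e b : RamExpr)
  /-- `f`, in which the variables `0` and `1` have the values of `a` and `b` -/
  | call (f a b : RamExpr)

namespace RamExpr

/-- The value of an expression; all sums are cut off at the cap `M`. -/
def eval (M : ℕ) (A : ℕ → ℕ → ℕ) : RamExpr → (ℕ → ℕ) → ℕ
  | var x, ρ => ρ x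
  | const c, _ => c
  | add a b, ρ => eval M A a ρ + eval M A b ρ
  | sub a b, ρ => eval M A a ρ - eval M A b ρ
  | arr i e, ρ => A i (eval M A e ρ)
  | ite c a b, ρ => if eval M A c ρ ≠ 0 then eval M A a ρ else eval M A b ρ
  | sum x e b, ρ => ∑ i ∈ Finset.range (min M (eval M A e ρ)), eval M A b (Function.update ρ x i)
  | letE x e b, ρ => eval M A b (Function.update ρ x (eval M A e ρ))
  | call f a b, ρ =>
    eval M A f fun x => if x = 0 then eval M A a ρ else if x = 1 then eval M A b ρ else 0

/-- The program that leaves the value of the expression in register `n`, where `Γ` gives the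
registers of the variables; it uses the registers from `n` on. Register `2` holds the cap. -/
def compile : RamExpr → (ℕ → ℕ) → ℕ → RamProg
  | var x, Γ, n => .seq (.const n 0) (.add n n (Γ x))
  | const c, _, n => .const n c
  | add a b, Γ, n => .seq (a.compile Γ n) (.seq (b.compile Γ (n + 1)) (.add n n (n + 1)))
  | sub a b, Γ, n => .seq (a.compile Γ n) (.seq (b.compile Γ (n + 1)) (.sub n n (n + 1)))
  | arr i e, Γ, n => .seq (e.compile Γ n) (.load n i n)
  | ite c a b, Γ, n => .seq (c.compile Γ n) (.cond n (a.compile Γ n) (b.compile Γ n))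
  | sum x e b, Γ, n =>
    .seq (e.compile Γ (n + 1)) <| .seq (.sub (n + 2) 2 (n + 1)) <| .seq (.sub (n + 1) 2 (n + 2)) <|
    .seq (.const n 0) <| .seq (.const (n + 2) 0) <| .loop (n + 1) <|
      .seq (b.compile (Function.update Γ x (n + 2)) (n + 3)) <| .seq (.add n n (n + 3)) <|
      .seq (.const (n + 3) 1) <| .seq (.add (n + 2) (n + 2) (n + 3)) (.sub (n + 1) (n + 1) (n + 3))
  | letE x e b, Γ, n =>
    .seq (e.compile Γ n) <| .seq (b.compile (Function.update Γ x n) (n + 1)) <|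
    .seq (.const n 0) (.add n n (n + 1))
  | call f a b, Γ, n =>
    .seq (a.compile Γ n) <| .seq (b.compile Γ (n + 1)) <| .seq (.const (n + 2) 0) <|
    .seq (f.compile (fun x => if x = 0 then n else if x = 1 then n + 1 else n + 2) (n + 3)) <|
    .seq (.const n 0) (.add n n (n + 3))

/-- A bound for the running time of the compiled expression. -/
def cost (M : ℕ) : RamExpr → ℕ
  | var _ => 2
  | const _ => 1
  | add a b => cost M a + cost M b + 1
  | sub a b => cost M a + cost M b + 1
  | arr _ e => cost M e + 1
  | ite c a b => cost M c + (cost M a + cost M b + 1)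
  | sum _ e b => cost M e + 5 + M * (cost M b + 5)
  | letE _ e b => cost M e + cost M b + 2
  | call f a b => cost M a + cost M b + cost M f + 3

/-- Only a sum multiplies the cost of its body, by a factor of about `M`; all other constructors add
costs. So the degree is bounded by the nesting depth of sums in the fixed expression. -/
theorem cost_le (e : RamExpr) : ∃ C c, ∀ M, e.cost M ≤ C * (M + 1) ^ c := by
  have comb : ∀ {f g : ℕ → ℕ} (a : ℕ), (∃ C c, ∀ M, f M ≤ C * (M + 1) ^ c) →
      (∃ C c, ∀ M, g M ≤ C * (M + 1) ^ c) → ∃ C c, ∀ M, f M + g M + a ≤ C * (M + 1) ^ c := by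
    rintro f g a ⟨C, c, h⟩ ⟨C', c', h'⟩
    refine ⟨C + C' + a, c + c', fun M => ?_⟩
    have h1 : (M + 1) ^ c ≤ (M + 1) ^ (c + c') := Nat.pow_le_pow_right (by omega) (by omega)
    have h2 : (M + 1) ^ c' ≤ (M + 1) ^ (c + c') := Nat.pow_le_pow_right (by omega) (by omega)
    have h3 : 1 ≤ (M + 1) ^ (c + c') := Nat.one_le_pow _ _ (by omega)
    calc f M + g M + a ≤ C * (M + 1) ^ c + C' * (M + 1) ^ c' + a * 1 := by
          have := h M; have := h' M; omega
      _ ≤ C * (M + 1) ^ (c + c') + C' * (M + 1) ^ (c + c') + a * (M + 1) ^ (c + c') := by gcongr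
      _ = _ := by ring
  have zero : ∃ C c, ∀ M : ℕ, 0 ≤ C * (M + 1) ^ c := ⟨0, 0, by simp⟩
  induction e with
  | var x => exact ⟨2, 0, by simp [cost]⟩
  | const c => exact ⟨1, 0, by simp [cost]⟩
  | add a b iha ihb => exact comb 1 iha ihb
  | sub a b iha ihb => exact comb 1 iha ihb
  | arr i e ih => 
    obtain ⟨C, c, h⟩ := comb 1 zero ih
    exact ⟨C, c, fun M => by simpa [cost] using h M⟩
  | ite c a b ihc iha ihb => exact comb 0 ihc (comb 1 iha ihb)
  | sum x e b ihe ihb =>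
    obtain ⟨C, c, h⟩ := comb 5 zero ihb
    have : ∃ C c, ∀ M, M * (cost M b + 5) ≤ C * (M + 1) ^ c := by
      refine ⟨C, c + 1, fun M => ?_⟩
      have := h M
      calc M * (cost M b + 5) ≤ (M + 1) * (C * (M + 1) ^ c) := by
            gcongr
            · omega
            · omega
        _ = _ := by ring
    obtain ⟨C, c, h⟩ := comb 5 ihe this
    refine ⟨C, c, fun M => ?_⟩
    have := h M
    simp only [cost]
    omega
  | letE x e b ihe ihb => exact comb 2 ihe ihb
  | call f a b ihf iha ihb => exact comb 3 (comb 0 iha ihb) ihf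

/-- A stack discipline: code compiled at level `n` writes no array and no register below `n`, so
variables and intermediate results parked below survive the evaluation of subexpressions. -/
theorem compile_spec (e : RamExpr) (M : ℕ) : ∀ (Γ : ℕ → ℕ) (n : ℕ) (s : RamState),
    (∀ x, Γ x < n) → 2 < n → s.reg 2 = M →
    (e.compile Γ n).Spec s (e.cost M) fun s' => s'.arr = s.arr ∧ (∀ y < n, s'.reg y = s.reg y) ∧
      s'.reg n = e.eval M s.arr fun x => s.reg (Γ x) := by
  induction e with
  | var x =>
    intro Γ n s hΓ hn hM
    refine (RamProg.Spec.const (Q := fun s' => s' = s.setReg n 0) rfl).seq (T' := 1) ?_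
    rintro _ rfl
    refine RamProg.Spec.add ⟨rfl, fun y hy => ?_, ?_⟩
    · simp [RamState.setReg, hy.ne]
    · simp [RamState.setReg, (hΓ x).ne, eval]
  | const c =>
    intro Γ n s hΓ hn hM
    refine RamProg.Spec.const ⟨rfl, fun y hy => ?_, ?_⟩
    · simp [RamState.setReg, hy.ne]
    · simp [RamState.setReg, eval]
  | add a b iha ihb =>
    intro Γ n s hΓ hn hM
    refine ((iha Γ n s hΓ hn hM).seq (T' := cost M b + 1) ?_).mono
      (by simp only [cost]; omega) fun _ h => h
    rintro s1 ⟨h1, h1', h1''⟩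
    refine (ihb Γ (n + 1) s1 (fun x => (hΓ x).trans (by omega)) (by omega)
      (by rw [h1' _ hn, hM])).seq ?_
    rintro s2 ⟨h2, h2', h2''⟩
    refine RamProg.Spec.add ⟨by simp [RamState.setReg, h1, h2], fun y hy => ?_, ?_⟩
    · simp [RamState.setReg, hy.ne, h2' y (by omega), h1' y hy]
    · simp [RamState.setReg, eval, h2'', h2' n (by omega), h1'', h1, h1' _ (hΓ _)]
  | sub a b iha ihb =>
    intro Γ n s hΓ hn hM
    refine ((iha Γ n s hΓ hn hM).seq (T' := cost M b + 1) ?_).mono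
      (by simp only [cost]; omega) fun _ h => h
    rintro s1 ⟨h1, h1', h1''⟩
    refine (ihb Γ (n + 1) s1 (fun x => (hΓ x).trans (by omega)) (by omega)
      (by rw [h1' _ hn, hM])).seq ?_
    rintro s2 ⟨h2, h2', h2''⟩
    refine RamProg.Spec.sub ⟨by simp [RamState.setReg, h1, h2], fun y hy => ?_, ?_⟩
    · simp [RamState.setReg, hy.ne, h2' y (by omega), h1' y hy]
    · simp [RamState.setReg, eval, h2'', h2' n (by omega), h1'', h1, h1' _ (hΓ _)]
  | arr i e ih =>
    intro Γ n s hΓ hn hM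
    refine (ih Γ n s hΓ hn hM).seq ?_
    rintro s1 ⟨h1, h1', h1''⟩
    refine RamProg.Spec.load ⟨by simp [RamState.setReg, h1], fun y hy => ?_, ?_⟩
    · simp [RamState.setReg, hy.ne, h1' y hy]
    · simp [RamState.setReg, eval, h1, h1'']
  | ite c a b ihc iha ihb =>
    intro Γ n s hΓ hn hM
    refine (ihc Γ n s hΓ hn hM).seq ?_
    rintro s1 ⟨h1, h1', h1''⟩
    refine RamProg.Spec.cond (fun h => ?_) fun h => ?_
    · refine (iha Γ n s1 hΓ hn (by rw [h1' _ hn, hM])).mono le_rfl ?_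
      rintro s2 ⟨h2, h2', h2''⟩
      refine ⟨by rw [h2, h1], fun y hy => by rw [h2' y hy, h1' y hy], ?_⟩
      rw [h1''] at h
      simp [eval, h, h2'', h1, h1' _ (hΓ _)]
    · refine (ihb Γ n s1 hΓ hn (by rw [h1' _ hn, hM])).mono le_rfl ?_
      rintro s2 ⟨h2, h2', h2''⟩
      refine ⟨by rw [h2, h1], fun y hy => by rw [h2' y hy, h1' y hy], ?_⟩
      rw [h1''] at h
      simp [eval, h, h2'', h1, h1' _ (hΓ _)]
  | letE x e b ihe ihb =>
    intro Γ n s hΓ hn hM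
    refine ((ihe Γ n s hΓ hn hM).seq (T' := cost M b + 2) ?_).mono
      (by simp only [cost]; omega) fun _ h => h
    rintro s1 ⟨h1, h1', h1''⟩
    refine ((ihb (Function.update Γ x n) (n + 1) s1 ?_ (by omega)
      (by rw [h1' _ hn, hM])).seq (T' := 2) ?_)
    · intro y
      by_cases hy : y = x
      · simp [hy]
      · have := hΓ y
        rw [Function.update_of_ne hy]
        omega
    rintro s2 ⟨h2, h2', h2''⟩
    refine (RamProg.Spec.const (Q := fun s' => s' = s2.setReg n 0) rfl).seq (T' := 1) ?_
    rintro _ rfl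
    refine RamProg.Spec.add ⟨by simp [RamState.setReg, h1, h2], fun y hy => ?_, ?_⟩
    · simp [RamState.setReg, hy.ne, h2' y (by omega), h1' y hy]
    · simp only [RamState.setReg, eval, Function.update_self, ne_eq, Nat.succ_ne_self,
        not_false_eq_true, Function.update_of_ne, h2'', zero_add, h1]
      congr 1
      funext y
      by_cases hy : y = x
      · simp [hy, h1'']
      · simp [hy, h1' _ (hΓ _)]
  | call f a b ihf iha ihb =>
    intro Γ n s hΓ hn hM
    refine ((iha Γ n s hΓ hn hM).seq (T' := cost M b + (cost M f + 3)) ?_).mono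
      (by simp only [cost]; omega) fun _ h => h
    rintro s1 ⟨h1, h1', h1''⟩
    refine (ihb Γ (n + 1) s1 (fun x => (hΓ x).trans (by omega)) (by omega)
      (by rw [h1' _ hn, hM])).seq ?_
    rintro s2 ⟨h2, h2', h2''⟩
    -- Register `n + 2` supplies the value `0` of every variable of `f` other than its two
    -- arguments.
    refine ((RamProg.Spec.const (Q := fun s' => s' = s2.setReg (n + 2) 0) rfl).seq
      (T' := cost M f + 2) ?_).mono (by omega) fun _ h => h
    rintro _ rfl
    refine (ihf _ (n + 3) (s2.setReg (n + 2) 0) ?_ (by omega) ?_).seq (T' := 2) ?_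
    · intro y
      split_ifs <;> omega
    · rw [← hM, ← h1' 2 hn, ← h2' 2 (by omega)]
      exact Function.update_of_ne (by omega) _ _
    rintro s3 ⟨h3, h3', h3''⟩
    refine (RamProg.Spec.const (Q := fun s' => s' = s3.setReg n 0) rfl).seq (T' := 1) ?_
    rintro _ rfl
    refine RamProg.Spec.add ⟨by simp [RamState.setReg, h1, h2, h3], fun y hy => ?_, ?_⟩
    · have : y ≠ n + 2 := by omega
      simp [RamState.setReg, hy.ne, h3' y (by omega), h2' y (by omega), h1' y hy, this]
    · simp only [RamState.setReg, eval, Function.update_self, ne_eq,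
        show n + 3 ≠ n by omega,
        not_false_eq_true, Function.update_of_ne, h3'', zero_add, h1, h2]
      congr 1
      funext y
      split_ifs
      · simp [h2' n (by omega), h1'']
      · simp [h2'', h1, h1' _ (hΓ _)]
      · simp
  | sum x e b ihe ihb =>
    intro Γ n s hΓ hn hM
    set v := e.eval M s.arr fun x => s.reg (Γ x) with hv
    refine ((ihe Γ (n + 1) s (fun x => (hΓ x).trans (by omega)) (by omega) hM).seq
      (T' := 5 + M * (cost M b + 5)) ?_).mono (by simp only [cost]; omega) fun _ h => h
    rintro s1 ⟨h1, h1', h1''⟩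
    -- Two truncated subtractions produce the minimum, as `M - (M - v)`.
    refine ((RamProg.Spec.sub (Q := fun s' => s'.arr = s.arr ∧ (∀ y < n, s'.reg y = s.reg y) ∧
      s'.reg (n + 2) = M - v) ?_).seq (T' := 4 + M * (cost M b + 5)) ?_).mono
      (by omega) fun _ h => h
    · refine ⟨h1, fun y hy => ?_, ?_⟩
      · simp [RamState.setReg, show y ≠ n + 2 by omega, h1' y (by omega)]
      · simp [RamState.setReg, h1'', h1' 2 (by omega), hM, hv]
    rintro s2 ⟨h2, h2', h2''⟩
    refine ((RamProg.Spec.sub (Q := fun s' => s'.arr = s.arr ∧ (∀ y < n, s'.reg y = s.reg y) ∧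
      s'.reg (n + 1) = min M v) ?_).seq (T' := 3 + M * (cost M b + 5)) ?_).mono
      (by omega) fun _ h => h
    · refine ⟨h2, fun y hy => ?_, ?_⟩
      · simp [RamState.setReg, show y ≠ n + 1 by omega, h2' y (by omega)]
      · simp only [RamState.setReg, h2'', h2' 2 (by omega), hM, Function.update_self]
        omega
    rintro s3 ⟨h3, h3', h3''⟩
    refine ((RamProg.Spec.const (Q := fun s' => s'.arr = s.arr ∧ (∀ y < n, s'.reg y = s.reg y) ∧
      s'.reg (n + 1) = min M v ∧ s'.reg n = 0) ?_).seq (T' := 2 + M * (cost M b + 5)) ?_).mono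
      (by omega) fun _ h => h
    · refine ⟨h3, fun y hy => ?_, ?_, ?_⟩
      · simp [RamState.setReg, show y ≠ n by omega, h3' y (by omega)]
      · simp [RamState.setReg, h3'']
      · simp [RamState.setReg]
    rintro s4 ⟨h4, h4', h4'', h4'''⟩
    refine ((RamProg.Spec.const (Q := fun s' => s'.arr = s.arr ∧ (∀ y < n, s'.reg y = s.reg y) ∧
      s'.reg (n + 1) = min M v ∧ s'.reg n = 0 ∧ s'.reg (n + 2) = 0) ?_).seq
      (T' := 1 + M * (cost M b + 5)) ?_).mono (by omega) fun _ h => h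
    · refine ⟨h4, fun y hy => ?_, ?_, ?_, ?_⟩
      · simp [RamState.setReg, show y ≠ n + 2 by omega, h4' y (by omega)]
      · simp [RamState.setReg, h4'']
      · simp [RamState.setReg, h4''']
      · simp [RamState.setReg]
    rintro s5 ⟨h5, h5', h5'', h5''', h5''''⟩
    set F : ℕ → ℕ := fun i => b.eval M s.arr (Function.update (fun x => s.reg (Γ x)) x i) with hF
    refine (RamProg.Spec.loop (c := cost M b + 4) (fun j s' => s'.arr = s.arr ∧
      (∀ y < n, s'.reg y = s.reg y) ∧ s'.reg n = ∑ i ∈ Finset.range j, F i ∧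
      s'.reg (n + 2) = j) (min M v) h5'' ⟨h5, h5', by simpa using h5''', h5''''⟩ ?_).mono ?_ ?_
    · rintro j hj s6 ⟨h6, h6', h6'', h6'''⟩ hc
      refine ((ihb (Function.update Γ x (n + 2)) (n + 3) s6 ?_ (by omega)
        (by rw [h6' _ hn, hM])).seq (T' := 4) ?_)
      · intro y
        by_cases hy : y = x
        · simp [hy]
        · have := hΓ y
          rw [Function.update_of_ne hy]
          omega
      rintro s7 ⟨h7, h7', h7''⟩
      have e7 : s7.reg (n + 3) = F j := by
        rw [h7'', hF, h6]
        dsimp only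
        congr 1
        funext y
        by_cases hy : y = x
        · simp [hy, h6''']
        · simp [hy, h6' _ (hΓ _)]
      refine ((RamProg.Spec.add (Q := fun s' => s' = s7.setReg n _) rfl).seq (T' := 3) ?_)
      rintro _ rfl
      refine ((RamProg.Spec.const (Q := fun s' => s' = (s7.setReg n _).setReg (n + 3) _) rfl).seq
        (T' := 2) ?_)
      rintro _ rfl
      refine ((RamProg.Spec.add (Q := fun s' =>
        s' = ((s7.setReg n _).setReg (n + 3) _).setReg (n + 2) _) rfl).seq (T' := 1) ?_)
      rintro _ rfl
      refine RamProg.Spec.sub ⟨⟨?_, ?_, ?_, ?_⟩, ?_⟩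
      · simp [RamState.setReg, h7, h6]
      · intro y hy
        simp [RamState.setReg, show y ≠ n by omega, show y ≠ n + 1 by omega,
          show y ≠ n + 2 by omega, show y ≠ n + 3 by omega, h7' y (by omega), h6' y hy]
      · simp [RamState.setReg, Finset.sum_range_succ, h7' n (by omega), h6'', e7]
      · simp [RamState.setReg, h7' (n + 2) (by omega), h6''']
      · simp [RamState.setReg, h7' (n + 1) (by omega), hc]
        omega
    · have : min M v * (cost M b + 4 + 1) ≤ M * (cost M b + 5) := by
        gcongr
        exact min_le_left _ _
      omega
    · rintro s8 ⟨⟨h8, h8', h8'', -⟩, -⟩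
      exact ⟨h8, h8', h8''⟩

end RamExpr

/-! ### Tabulation programs -/

namespace RamExpr

/-- A bound for the arrays that an expression reads. -/
def arrBound : RamExpr → ℕ
  | var _ => 0
  | const _ => 0
  | add a b => max a.arrBound b.arrBound
  | sub a b => max a.arrBound b.arrBound
  | arr i e => max i e.arrBound
  | ite c a b => max c.arrBound (max a.arrBound b.arrBound)
  | sum _ e b => max e.arrBound b.arrBound
  | letE _ e b => max e.arrBound b.arrBound
  | call f a b => max f.arrBound (max a.arrBound b.arrBound)

theorem eval_congr {M i : ℕ} {A A' : ℕ → ℕ → ℕ} (h : ∀ a ≤ i, A a = A' a) (e : RamExpr) :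
    e.arrBound ≤ i → ∀ ρ, e.eval M A ρ = e.eval M A' ρ := by
  induction e with
  | var x => intro _ ρ; rfl
  | const c => intro _ ρ; rfl
  | add a b iha ihb | sub a b iha ihb =>
    intro hi ρ
    simp only [arrBound, max_le_iff] at hi
    simp only [eval, iha hi.1, ihb hi.2]
  | arr j e ih =>
    intro hi ρ
    simp only [arrBound, max_le_iff] at hi
    simp only [eval, ih hi.2, h j hi.1]
  | ite c a b ihc iha ihb =>
    intro hi ρ
    simp only [arrBound, max_le_iff] at hi
    simp only [eval, ihc hi.1, iha hi.2.1, ihb hi.2.2]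
  | sum x e b ihe ihb | letE x e b ihe ihb =>
    intro hi ρ
    simp only [arrBound, max_le_iff] at hi
    simp only [eval, ihe hi.1, ihb hi.2]
  | call f a b ihf iha ihb =>
    intro hi ρ
    simp only [arrBound, max_le_iff] at hi
    simp only [eval, ihf hi.1, iha hi.2.1, ihb hi.2.2]

/-- The values of the global variables: `0` is the index of the current cell, `2` the parameter,
`3` the cap, and `1` (like all others) the length of the input. -/
def globals (n k M x : ℕ) : ℕ → ℕ :=
  fun y => if y = 0 then x else if y = 2 then k else if y = 3 then M else n

/-- Fill the cells of the array `i` below the cap with the values of `e`. -/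
def tab (i : ℕ) (e : RamExpr) : RamProg :=
  .seq (.const 3 0) <| .seq (.const 4 0) <| .seq (.add 4 4 2) <| .loop 4 <|
    .seq (e.compile (fun y => if y = 0 then 3 else if y = 2 then 1 else if y = 3 then 2 else 0) 6) <|
    .seq (.store i 3 6) <| .seq (.const 5 1) <| .seq (.add 3 3 5) (.sub 4 4 5)

/-- When cell `x` is computed, the cells before it are final and the remaining ones still hold their
old contents. The mixed array in the statement records this, and allows a table to be defined by
recursion on its own earlier cells. -/
theorem tab_spec (i : ℕ) (e : RamExpr) (n k M : ℕ) (s : RamState) (hn : s.reg 0 = n)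
    (hk : s.reg 1 = k) (hM : s.reg 2 = M) :
    (tab i e).Spec s (M * (e.cost M + 5) + 4) fun s' =>
      s'.reg 0 = n ∧ s'.reg 1 = k ∧ s'.reg 2 = M ∧ (∀ a ≠ i, s'.arr a = s.arr a) ∧
      ∀ x < M, s'.arr i x = e.eval M (Function.update s.arr i
        fun y => if y < x then s'.arr i y else s.arr i y) (globals n k M x) := by
  refine (RamProg.Spec.const (Q := fun s' => s' = s.setReg 3 0) rfl).seq
    (T' := M * (e.cost M + 5) + 3) ?_ |>.mono (by omega) fun _ h => h
  rintro _ rfl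
  refine (RamProg.Spec.const (Q := fun s' => s' = (s.setReg 3 0).setReg 4 0) rfl).seq
    (T' := M * (e.cost M + 5) + 2) ?_ |>.mono (by omega) fun _ h => h
  rintro _ rfl
  refine (RamProg.Spec.add (Q := fun s' => s' = ((s.setReg 3 0).setReg 4 0).setReg 4 _) rfl).seq
    (T' := M * (e.cost M + 5) + 1) ?_ |>.mono (by omega) fun _ h => h
  rintro _ rfl
  refine (RamProg.Spec.loop (c := e.cost M + 4) (fun j s' => s'.reg 0 = n ∧ s'.reg 1 = k ∧
    s'.reg 2 = M ∧ s'.reg 3 = j ∧ (∀ a ≠ i, s'.arr a = s.arr a) ∧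
    (∀ y, j ≤ y → s'.arr i y = s.arr i y) ∧
      ∀ x < j, s'.arr i x = e.eval M (Function.update s.arr i
        fun y => if y < x then s'.arr i y else s.arr i y) (globals n k M x)) M ?_ ?_ ?_).mono
          le_rfl ?_
  · simp [RamState.setReg, hM]
  · simp [RamState.setReg, hM, hn, hk]
  · rintro j hj s1 ⟨h0, h1, h2, h3, ha, hi, hx⟩ h4
    refine (e.compile_spec M _ 6 s1 (fun x => ?_) (by omega) h2).seq (T' := 4) ?_
    · split_ifs <;> omega
    rintro s2 ⟨ga, gr, gv⟩
    refine (RamProg.Spec.store (Q := fun s' => s' = s2.setArr i _ _) rfl).seq (T' := 3) ?_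
    rintro _ rfl
    refine (RamProg.Spec.const (Q := fun s' => s' = (s2.setArr i _ _).setReg 5 1) rfl).seq
      (T' := 2) ?_
    rintro _ rfl
    refine (RamProg.Spec.add (Q := fun s' => s' = ((s2.setArr i _ _).setReg 5 1).setReg 3 _)
      rfl).seq (T' := 1) ?_
    rintro _ rfl
    have hA : s1.arr = Function.update s.arr i
        fun y => if y < j then s1.arr i y else s.arr i y := by
      funext a
      by_cases h : a = i
      · subst h
        funext y
        by_cases hy : y < j
        · simp [hy]
        · simp [hy, hi y (not_lt.1 hy)]
      · simp [h, ha a h]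
    have hv : s2.reg 6 = e.eval M (Function.update s.arr i
        fun y => if y < j then s1.arr i y else s.arr i y) (globals n k M j) := by
      rw [gv, ← hA]
      congr 1
      funext y
      simp only [globals]
      split_ifs <;> assumption
    refine RamProg.Spec.sub ⟨⟨?_, ?_, ?_, ?_, ?_, ?_, ?_⟩, ?_⟩
    · simp [RamState.setReg, RamState.setArr, gr, h0]
    · simp [RamState.setReg, RamState.setArr, gr, h1]
    · simp [RamState.setReg, RamState.setArr, gr, h2]
    · simp [RamState.setReg, RamState.setArr, gr, h3]
    · intro a h
      simp [RamState.setReg, RamState.setArr, ga, h, ha a h]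
    · intro y hy
      simp [RamState.setReg, RamState.setArr, ga, gr, h3, show y ≠ j by omega, hi y (by omega)]
    · intro x hxj
      simp only [RamState.setReg, RamState.setArr, ga, gr 3 (by omega), h3, Function.update_self]
      have hcut : ∀ z ≤ j, (fun y => if y < z then Function.update (s1.arr i) j (s2.reg 6) y
          else s.arr i y) = fun y => if y < z then s1.arr i y else s.arr i y := by
        intro z hz
        funext y
        by_cases hy : y < z
        · simp [hy, show y ≠ j by omega]
        · simp [hy]
      rw [hcut x (by omega)]
      rcases eq_or_ne x j with rfl | hne
      · rw [Function.update_self, hv]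
      · rw [Function.update_of_ne hne, hx x (by omega)]
    · simp [RamState.setReg, RamState.setArr, gr, h4]
      omega
  · rintro s' ⟨⟨h0, h1, h2, -, ha, -, hx⟩, -⟩
    exact ⟨h0, h1, h2, ha, hx⟩

/-- Fill the arrays `i`, `i + 1`, … one after the other. -/
def tabs : ℕ → List RamExpr → RamProg
  | _, [] => .skip
  | i, e :: es => .seq (tab i e) (tabs (i + 1) es)

/-- A bound for the running time of `tabs`. -/
def tabsCost (M : ℕ) (es : List RamExpr) : ℕ :=
  (es.map fun e => M * (e.cost M + 5) + 4).sum + 1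

/-- A table reads no array later than its own, and the later tables write only later arrays. So the
values it has seen can be read off the final memory, apart from the part of its own array that was
not yet filled. -/
theorem tabs_spec (n k M : ℕ) (es : List RamExpr) : ∀ (i : ℕ) (s : RamState),
    (∀ j (h : j < es.length), es[j].arrBound ≤ i + j) →
    s.reg 0 = n → s.reg 1 = k → s.reg 2 = M →
    (tabs i es).Spec s (tabsCost M es) fun s' =>
      s'.reg 0 = n ∧ s'.reg 1 = k ∧ s'.reg 2 = M ∧ (∀ a < i, s'.arr a = s.arr a) ∧
      (∀ a, i + es.length ≤ a → s'.arr a = s.arr a) ∧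
      ∀ j (h : j < es.length), ∀ x < M, s'.arr (i + j) x = es[j].eval M (Function.update s'.arr
        (i + j) fun y => if y < x then s'.arr (i + j) y else s.arr (i + j) y)
          (globals n k M x) := by
  induction es with
  | nil =>
    intro i s _ h0 h1 h2
    exact ⟨1, s, by simp [tabsCost], .skip s, h0, h1, h2, by simp, by simp, by simp⟩
  | cons e es ih =>
    intro i s hes h0 h1 h2
    refine ((tab_spec i e n k M s h0 h1 h2).seq (T' := tabsCost M es) ?_).mono
      (by simp [tabsCost]; omega) fun _ h => h
    rintro s1 ⟨g0, g1, g2, ga, gx⟩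
    refine (ih (i + 1) s1 (fun j h => ?_) g0 g1 g2).mono le_rfl ?_
    · have := hes (j + 1) (by simpa using h)
      simp only [List.getElem_cons_succ] at this
      omega
    rintro s2 ⟨k0, k1, k2, ka, ka', kx⟩
    refine ⟨k0, k1, k2, fun a h => by rw [ka a (by omega), ga a (by omega)],
      fun a h => ?_, fun j h x hx => ?_⟩
    · simp only [List.length_cons] at h
      rw [ka' a (by omega), ga a (by omega)]
    · rcases j with _ | j
      · have hb := hes 0 (by simp)
        simp only [List.getElem_cons_zero, add_zero] at hb ⊢
        rw [ka i (by omega), gx x hx]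
        refine eval_congr (i := i) (fun a h => ?_) e hb _
        rcases eq_or_ne a i with rfl | hne
        · simp
        · rw [Function.update_of_ne hne, Function.update_of_ne hne, ka a (by omega), ga a hne]
      · have := kx j (by simpa using h) x hx
        simp only [List.getElem_cons_succ]
        rw [show i + (j + 1) = i + 1 + j by omega, this, ga (i + 1 + j) (by omega)]

theorem tabsCost_le (es : List RamExpr) : ∃ C c, ∀ M, tabsCost M es ≤ C * (M + 1) ^ c := by
  induction es with
  | nil => exact ⟨1, 0, by simp [tabsCost]⟩
  | cons e es ih =>
    obtain ⟨C, c, h⟩ := ih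
    obtain ⟨C', c', h'⟩ := e.cost_le
    refine ⟨C + C' + 9, c + c' + 1, fun M => ?_⟩
    have h1 : (M + 1) ^ c ≤ (M + 1) ^ (c + c' + 1) := Nat.pow_le_pow_right (by omega) (by omega)
    have h2 : (M + 1) ^ (c' + 1) ≤ (M + 1) ^ (c + c' + 1) :=
      Nat.pow_le_pow_right (by omega) (by omega)
    have h3 : (M + 1) ^ 1 ≤ (M + 1) ^ (c + c' + 1) := Nat.pow_le_pow_right (by omega) (by omega)
    calc tabsCost M (e :: es) = M * (e.cost M + 5) + 4 + tabsCost M es := by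
          simp [tabsCost]; ring
      _ ≤ (M + 1) * (C' * (M + 1) ^ c' + 5) + 4 * (M + 1) + C * (M + 1) ^ c := by
          gcongr
          · omega
          · exact h' M
          · omega
          · exact h M
      _ = C' * (M + 1) ^ (c' + 1) + 9 * (M + 1) ^ 1 + C * (M + 1) ^ c := by ring
      _ ≤ C' * (M + 1) ^ (c + c' + 1) + 9 * (M + 1) ^ (c + c' + 1)
          + C * (M + 1) ^ (c + c' + 1) := by gcongr
      _ = _ := by ring

/-- Fill the arrays `1`, `2`, …; then copy the array `o` to the array `0`, and the first cells of
the arrays `a` and `b` to the registers `0` and `1`. -/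
def tabulate (es : List RamExpr) (o a b : ℕ) : RamProg :=
  .seq (tabs 1 es) <| .seq (tab 0 (arr o (var 0))) <| .seq (.const 3 0) <|
    .seq (.load 0 a 3) (.load 1 b 3)

/-- The memory `A` is the one just before array `0` is overwritten with the output, so it still
contains the input. Nothing is assumed about the initial contents of the other arrays, since the
program runs after another one; cells below the cap are written before they matter. -/
theorem tabulate_spec (es : List RamExpr) (o a b : ℕ) (ha : 0 < a) (hb : 0 < b) (ho : 0 < o)
    (hes : ∀ j (h : j < es.length), es[j].arrBound ≤ 1 + j) :
    ∃ C c, ∀ (n k M : ℕ) (s : RamState), s.reg 0 = n → s.reg 1 = k → s.reg 2 = M →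
      (tabulate es o a b).Spec s (C * (M + 1) ^ c) fun s' =>
        ∃ A : ℕ → ℕ → ℕ, A 0 = s.arr 0 ∧ s'.reg 0 = A a 0 ∧ s'.reg 1 = A b 0 ∧
        (∀ x < M, s'.arr 0 x = A o x) ∧
        ∀ j (h : j < es.length), ∀ x < M, A (1 + j) x = es[j].eval M (Function.update A
          (1 + j) fun y => if y < x then A (1 + j) y else s.arr (1 + j) y)
            (globals n k M x) := by
  obtain ⟨C, c, h⟩ := tabsCost_le (arr o (var 0) :: es)
  refine ⟨C + 3, c, fun n k M s h0 h1 h2 => ?_⟩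
  refine ((tabs_spec n k M es 1 s hes h0 h1 h2).seq
    (T' := M * ((arr o (var 0)).cost M + 5) + 4 + 3) ?_).mono ?_ fun _ h => h
  · rintro s1 ⟨g0, g1, g2, ga, -, gx⟩
    refine (tab_spec 0 (arr o (var 0)) n k M s1 g0 g1 g2).seq (T' := 3) ?_
    rintro s2 ⟨k0, k1, k2, ka, kx⟩
    refine (RamProg.Spec.const (Q := fun s' => s' = s2.setReg 3 0) rfl).seq (T' := 2) ?_
    rintro _ rfl
    refine (RamProg.Spec.load (Q := fun s' => s' = (s2.setReg 3 0).setReg 0 _) rfl).seq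
      (T' := 1) ?_
    rintro _ rfl
    refine RamProg.Spec.load ⟨s1.arr, ga 0 (by omega), ?_, ?_, ?_, gx⟩
    · simp [RamState.setReg, ka a ha.ne']
    · simp [RamState.setReg, ka b hb.ne']
    · intro x hx
      have := kx x hx
      simpa [RamState.setReg, eval, globals, ho.ne'] using this
  · have h3 : 1 ≤ (M + 1) ^ c := Nat.one_le_pow _ _ (by omega)
    have := h M
    rw [add_mul]
    simp only [tabsCost, List.map_cons, List.sum_cons] at this ⊢
    omega

end RamExpr

/-! ### Number of written cells -/

namespace RamProg

/-- A run of `t` steps makes at most `t` further cells of an array nonzero. -/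
theorem Runs.exists_support {p : RamProg} {s s' : RamState} {t : ℕ} (h : p.Runs s t s') (a : ℕ) :
    ∀ U : Finset ℕ, (∀ i ∉ U, s.arr a i = 0) →
      ∃ V : Finset ℕ, V.card ≤ U.card + t ∧ ∀ i ∉ V, s'.arr a i = 0 := by
  induction h with
  | skip | const | add | sub | load => exact fun U hU => ⟨U, by omega, hU⟩
  | store s b x y =>
    intro U hU
    refine ⟨insert (s.reg x) U, Finset.card_insert_le _ _, fun i hi => ?_⟩
    simp only [Finset.mem_insert, not_or] at hi
    by_cases hb : a = b
    · subst hb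
      simp [RamState.setArr, hi.1, hU i hi.2]
    · simp [RamState.setArr, hb, hU i hi.2]
  | seq _ _ ih ih' =>
    intro U hU
    obtain ⟨V, hV, hV'⟩ := ih U hU
    obtain ⟨W, hW, hW'⟩ := ih' V hV'
    exact ⟨W, by omega, hW'⟩
  | cond_pos _ _ ih | cond_zero _ _ ih =>
    intro U hU
    obtain ⟨V, hV, hV'⟩ := ih U hU
    exact ⟨V, by omega, hV'⟩
  | loop_pos _ _ _ ih ih' =>
    intro U hU
    obtain ⟨V, hV, hV'⟩ := ih U hU
    obtain ⟨W, hW, hW'⟩ := ih' V hV'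
    exact ⟨W, by omega, hW'⟩
  | loop_zero _ => exact fun U hU => ⟨U, by omega, hU⟩

/-- For loops that may stop early: the number of rounds is not known in advance, but the invariant
of round `j` gives `j < n` whenever the loop continues. -/
theorem Spec.loop_while {p : RamProg} {s : RamState} {x c : ℕ} (I : ℕ → RamState → Prop) (n : ℕ)
    (h0 : I 0 s)
    (hstep : ∀ j s, I j s → s.reg x ≠ 0 → j < n ∧ p.Spec s c (I (j + 1))) :
    (RamProg.loop x p).Spec s (n * (c + 1) + 1) fun s' => ∃ j, I j s' ∧ s'.reg x = 0 := by
  have key : ∀ i j, n ≤ i + j → ∀ s, I j s →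
      (RamProg.loop x p).Spec s (i * (c + 1) + 1) fun s' => ∃ j, I j s' ∧ s'.reg x = 0 := by
    intro i
    induction i with
    | zero =>
      intro j hj s hI
      by_cases hs : s.reg x = 0
      · exact ⟨1, s, by omega, .loop_zero hs, j, hI, hs⟩
      · have := (hstep j s hI hs).1
        omega
    | succ i ih =>
      intro j hj s hI
      by_cases hs : s.reg x = 0
      · exact ⟨1, s, by omega, .loop_zero hs, j, hI, hs⟩
      obtain ⟨-, t, s', ht, hr, hI'⟩ := hstep j s hI hs
      obtain ⟨t', s'', ht', hr', hQ⟩ := ih (j + 1) (by omega) s' hI'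
      refine ⟨t + t' + 1, s'', ?_, .loop_pos hs hr hr', hQ⟩
      rw [add_mul, one_mul]
      omega
  exact key n 0 (by omega) s h0

/-! ### Cutting a word after a long run of zeros -/

/-- Decrease register `0` to the end of the first run of `Z` zeros of the array `0`, if there is one
before. -/
def scan (Z : ℕ) : RamProg :=
  .seq (.const 7 1) <| .seq (.const 3 0) <| .seq (.const 4 Z) <| .seq (.const 5 0) <|
  .seq (.add 5 5 0) <| .seq
    (.loop 5 <| .seq (.load 6 0 3) <| .seq (.cond 6 (.const 4 Z) (.sub 4 4 7)) <|
      .seq (.add 3 3 7) (.cond 4 (.sub 5 0 3) (.const 5 0))) <|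
  .seq (.const 0 0) (.add 0 0 3)

/-- Each nonzero cell restarts the count of zeros and so costs at most `Z` cells. Hence a full run,
or the end of the word, is met within `(U.card + 1) * Z` cells, however large the announced length
`n` is. -/
theorem scan_spec (Z : ℕ) (hZ : 0 < Z) (n k : ℕ) (s : RamState) (U : Finset ℕ)
    (hU : ∀ i ∉ U, s.arr 0 i = 0) (hn : s.reg 0 = n) (hk : s.reg 1 = k) :
    (scan Z).Spec s ((U.card + 1) * Z * 9 + 8) fun s' => s'.arr = s.arr ∧ s'.reg 1 = k ∧
      s'.reg 0 ≤ n ∧ s'.reg 0 ≤ (U.card + 1) * Z ∧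
      (s'.reg 0 = n ∨ Z ≤ s'.reg 0 ∧ ∀ i < Z, s.arr 0 (s'.reg 0 - 1 - i) = 0) := by
  refine (Spec.const (Q := fun s' => s' = s.setReg 7 1) rfl).seq
    (T' := (U.card + 1) * Z * 9 + 7) ?_ |>.mono (by omega) fun _ h => h
  rintro _ rfl
  refine (Spec.const (Q := fun s' => s' = (s.setReg 7 1).setReg 3 0) rfl).seq
    (T' := (U.card + 1) * Z * 9 + 6) ?_ |>.mono (by omega) fun _ h => h
  rintro _ rfl
  refine (Spec.const (Q := fun s' => s' = ((s.setReg 7 1).setReg 3 0).setReg 4 Z) rfl).seq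
    (T' := (U.card + 1) * Z * 9 + 5) ?_ |>.mono (by omega) fun _ h => h
  rintro _ rfl
  refine (Spec.const (Q := fun s' => s' = (((s.setReg 7 1).setReg 3 0).setReg 4 Z).setReg 5 0)
    rfl).seq (T' := (U.card + 1) * Z * 9 + 4) ?_ |>.mono (by omega) fun _ h => h
  rintro _ rfl
  refine (Spec.add (Q := fun s' => s' =
    ((((s.setReg 7 1).setReg 3 0).setReg 4 Z).setReg 5 0).setReg 5 _)
    rfl).seq (T' := (U.card + 1) * Z * 9 + 3) ?_ |>.mono (by omega) fun _ h => h
  rintro _ rfl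
  -- Register `3` is the position, register `4` the number of zeros still missing from a full run,
  -- and register `5` the loop test, which vanishes when the run is complete or the word is
  -- exhausted. The bound on `j + s'.reg 4` is the potential that limits the number of rounds.
  set I : ℕ → RamState → Prop := fun j s' => s'.arr = s.arr ∧ s'.reg 0 = n ∧ s'.reg 1 = k ∧
    s'.reg 3 = j ∧ s'.reg 7 = 1 ∧ j ≤ n ∧ s'.reg 4 ≤ Z ∧ Z ≤ s'.reg 4 + j ∧
    (∀ i < Z - s'.reg 4, s.arr 0 (j - 1 - i) = 0) ∧
    j + s'.reg 4 ≤ ((U.filter (· < j)).card + 1) * Z ∧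
    s'.reg 5 = if s'.reg 4 = 0 then 0 else n - j with hI
  refine ((Spec.loop_while (x := 5) (c := 8) I ((U.card + 1) * Z) ?_ ?_).mono le_rfl
    (fun _ h => h)).seq (T' := 2) ?_
  · simp [hI, RamState.setReg, hn, hk, hZ.ne']
  · rintro j s1 ⟨ha, h0, h1, h3, h7, hjn, h4, h4', hz, hc, h5⟩ hx
    have h40 : s1.reg 4 ≠ 0 := fun h => hx (by rw [h5, if_pos h])
    rw [if_neg h40] at h5
    have hcard : (U.filter (· < j)).card ≤ U.card := Finset.card_filter_le _ _
    have hcard' : ((U.filter (· < j)).card + 1) * Z ≤ (U.card + 1) * Z := by gcongr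
    refine ⟨by omega, ?_⟩
    refine (Spec.load (Q := fun s' => s' = s1.setReg 6 (s.arr 0 j)) ?_).seq
      (T' := 7) ?_
    · rw [ha, h3]
    rintro _ rfl
    refine (Spec.cond (T := 1) (T' := 1) (Q := fun s' => s' = (s1.setReg 6 (s.arr 0 j)).setReg 4
      (if s.arr 0 j = 0 then s1.reg 4 - 1 else Z)) (fun h => ?_) (fun h => ?_)).seq (T' := 4) ?_
    · refine Spec.const ?_
      simp only [RamState.setReg, Function.update_self] at h
      simp [h]
    · refine Spec.sub ?_
      simp only [RamState.setReg, Function.update_self] at h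
      simp [RamState.setReg, h, h7]
    rintro _ rfl
    set r := if s.arr 0 j = 0 then s1.reg 4 - 1 else Z with hr
    refine (Spec.add (Q := fun s' => s' = ((s1.setReg 6 (s.arr 0 j)).setReg 4 r).setReg 3 (j + 1))
      ?_).seq (T' := 3) ?_
    · simp [RamState.setReg, h3, h7]
    rintro _ rfl
    refine (Spec.cond (T := 1) (T' := 1) (Q := fun s' => s' = (((s1.setReg 6 (s.arr 0 j)).setReg
      4 r).setReg 3 (j + 1)).setReg 5 (if r = 0 then 0 else n - (j + 1)))
      (fun h => ?_) (fun h => ?_)).mono le_rfl ?_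
    · refine Spec.sub ?_
      simp [RamState.setReg] at h
      simp [RamState.setReg, h, h0]
    · refine Spec.const ?_
      simp [RamState.setReg] at h
      simp [h]
    rintro _ rfl
    have hmono : (U.filter (· < j)).card ≤ (U.filter (· < j + 1)).card :=
      Finset.card_le_card fun i => by
        simp only [Finset.mem_filter]
        exact fun h => ⟨h.1, by omega⟩
    -- A nonzero cell is a new member of `U`, which pays for resetting register `4` to `Z`.
    have hsucc : s.arr 0 j ≠ 0 → (U.filter (· < j)).card + 1 ≤ (U.filter (· < j + 1)).card := by
      intro h
      have hj : j ∈ U := by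
        by_contra h'
        exact h (hU j h')
      rw [← Finset.card_insert_of_notMem (a := j) (by simp)]
      refine Finset.card_le_card fun i => ?_
      simp only [Finset.mem_filter, Finset.mem_insert]
      rintro (rfl | ⟨h, h'⟩)
      · exact ⟨hj, by omega⟩
      · exact ⟨h, by omega⟩
    simp only [hI, RamState.setReg]
    refine ⟨ha, by simpa using h0, by simpa using h1, by simp, by simpa using h7, by omega, ?_, ?_,
      ?_, ?_, by simp⟩
    · simp [hr]
      split_ifs <;> omega
    · simp [hr]
      split_ifs <;> omega
    · simp only [ne_eq, Nat.reduceEqDiff, not_false_eq_true,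
        Function.update_of_ne, Function.update_self]
      intro i hi
      rcases i with _ | i
      · by_contra h
        have h' : s.arr 0 j ≠ 0 := by simpa using h
        simp only [hr, if_neg h'] at hi
        omega
      · by_cases h' : s.arr 0 j = 0
        · simp only [hr, if_pos h'] at hi
          have := hz i (by omega)
          rwa [show j + 1 - 1 - (i + 1) = j - 1 - i by omega]
        · simp only [hr, if_neg h'] at hi
          omega
    · simp only [ne_eq, Nat.reduceEqDiff, not_false_eq_true,
        Function.update_of_ne, Function.update_self]
      by_cases h' : s.arr 0 j = 0
      · have : ((U.filter (· < j)).card + 1) * Z ≤ ((U.filter (· < j + 1)).card + 1) * Z := by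
          gcongr
        simp only [hr, if_pos h']
        omega
      · have : ((U.filter (· < j)).card + 1 + 1) * Z ≤ ((U.filter (· < j + 1)).card + 1) * Z := by
          gcongr
          exact hsucc h'
        rw [add_mul, one_mul] at this
        simp only [hr, if_neg h']
        omega
  · rintro s2 ⟨j, ⟨ha, h0, h1, h3, h7, hjn, h4, h4', hz, hc, h5⟩, hx⟩
    refine (Spec.const (Q := fun s' => s' = s2.setReg 0 0) rfl).seq (T' := 1) ?_
    rintro _ rfl
    have hcard : (U.filter (· < j)).card ≤ U.card := Finset.card_filter_le _ _
    have hcard' : ((U.filter (· < j)).card + 1) * Z ≤ (U.card + 1) * Z := by gcongr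
    refine Spec.add ⟨ha, by simpa [RamState.setReg] using h1, ?_⟩
    simp only [RamState.setReg, Function.update_self, zero_add, ne_eq, OfNat.ofNat_ne_zero,
      not_false_eq_true, Function.update_of_ne, h3]
    refine ⟨hjn, by omega, ?_⟩
    by_cases h : s2.reg 4 = 0
    · exact Or.inr ⟨by omega, fun i hi => hz i (by omega)⟩
    · rw [if_neg h] at h5
      exact Or.inl (by omega)

/-! ### Multiplication, and computation of the cap -/

/-- Register `x` := register `y` * register `z`; the registers `8` and `9` are overwritten. -/
def mulProg (x y z : ℕ) : RamProg :=
  .seq (.const x 0) <| .seq (.const 8 0) <| .seq (.add 8 8 y) <| .seq (.const 9 1) <|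
    .loop 8 (.seq (.add x x z) (.sub 8 8 9))

theorem mulProg_spec {x y z : ℕ} (hx : x < 8) (hy : y < 8) (hz : z < 8) (hxy : y ≠ x)
    (hxz : z ≠ x) (s : RamState) :
    (mulProg x y z).Spec s (s.reg y * 3 + 5) fun s' => s'.arr = s.arr ∧
      s'.reg x = s.reg y * s.reg z ∧ ∀ r < 8, r ≠ x → s'.reg r = s.reg r := by
  refine (Spec.const (Q := fun s' => s' = s.setReg x 0) rfl).seq
    (T' := s.reg y * 3 + 4) ?_ |>.mono (by omega) fun _ h => h
  rintro _ rfl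
  refine (Spec.const (Q := fun s' => s' = (s.setReg x 0).setReg 8 0) rfl).seq
    (T' := s.reg y * 3 + 3) ?_ |>.mono (by omega) fun _ h => h
  rintro _ rfl
  refine (Spec.add (Q := fun s' => s' = ((s.setReg x 0).setReg 8 0).setReg 8 (s.reg y)) ?_).seq
    (T' := s.reg y * 3 + 2) ?_ |>.mono (by omega) fun _ h => h
  · simp [RamState.setReg, hxy, hy.ne]
  rintro _ rfl
  refine (Spec.const (Q := fun s' => s' = (((s.setReg x 0).setReg 8 0).setReg 8 (s.reg y)).setReg
    9 1) rfl).seq (T' := s.reg y * 3 + 1) ?_ |>.mono (by omega) fun _ h => h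
  rintro _ rfl
  refine (Spec.loop (c := 2) (fun j s' => s'.arr = s.arr ∧ s'.reg x = j * s.reg z ∧
    s'.reg 9 = 1 ∧ ∀ r < 8, r ≠ x → s'.reg r = s.reg r) (s.reg y) ?_ ?_ ?_).mono le_rfl ?_
  · simp [RamState.setReg]
  · refine ⟨rfl, ?_, ?_, fun r hr hrx => ?_⟩
    · simp [RamState.setReg, hx.ne, show x ≠ 9 by omega]
    · simp [RamState.setReg]
    · simp [RamState.setReg, hr.ne, show r ≠ 9 by omega, hrx]
  · rintro j hj s1 ⟨ha, h1, h9, hr⟩ h8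
    refine (Spec.add (Q := fun s' => s' = s1.setReg x ((j + 1) * s.reg z)) ?_).seq (T' := 1) ?_
    · rw [h1, hr z hz hxz]
      ring_nf
    rintro _ rfl
    refine Spec.sub ⟨⟨ha, ?_, ?_, fun r hr8 hrx => ?_⟩, ?_⟩
    · simp [RamState.setReg, hx.ne]
    · simp [RamState.setReg, show 9 ≠ x by omega, h9]
    · simp [RamState.setReg, hr8.ne, hrx, hr r hr8 hrx]
    · simp [RamState.setReg, show 9 ≠ x by omega, show 8 ≠ x by omega, h9, h8]
      omega
  · rintro s' ⟨⟨ha, h1, -, hr⟩, -⟩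
    exact ⟨ha, h1, hr⟩

/-- Multiply register `2` by register `5` repeatedly. -/
def powProg : ℕ → RamProg
  | 0 => .const 2 1
  | c + 1 => .seq (powProg c) <| .seq (mulProg 3 5 2) <| .seq (.const 2 0) (.add 2 2 3)

theorem powProg_spec (c : ℕ) (s : RamState) :
    (powProg c).Spec s (c * (s.reg 5 * 3 + 7) + 1) fun s' => s'.arr = s.arr ∧
      s'.reg 2 = s.reg 5 ^ c ∧ s'.reg 0 = s.reg 0 ∧ s'.reg 1 = s.reg 1 ∧ s'.reg 5 = s.reg 5 := by
  induction c with
  | zero =>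
    refine (Spec.const ?_).mono (by omega) fun _ h => h
    simp [RamState.setReg]
  | succ c ih =>
    refine (ih.seq (T' := s.reg 5 * 3 + 7) ?_).mono (by rw [add_mul]; omega) fun _ h => h
    rintro s1 ⟨ha, h2, h0, h1, h5⟩
    refine ((mulProg_spec (x := 3) (y := 5) (z := 2) (by omega) (by omega) (by omega) (by omega)
      (by omega) s1).seq (T' := 2) ?_).mono (by omega) fun _ h => h
    rintro s2 ⟨ga, g3, gr⟩
    refine (Spec.const (Q := fun s' => s' = s2.setReg 2 0) rfl).seq (T' := 1) ?_
    rintro _ rfl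
    refine Spec.add ?_
    simp [RamState.setReg, ga, g3, gr, ha, h0, h1, h2, h5, pow_succ, mul_comm]

/-- Compute the cap `((n + k + a) * (b * (k + 1)) ^ k) ^ c` into register `2`, where `n` and `k` are
the contents of the registers `0` and `1`. -/
def capProg (a b c : ℕ) : RamProg :=
  .seq (.const 6 b) <| .seq (.const 5 1) <| .seq (.add 5 5 1) <| .seq (mulProg 4 6 5) <|
  .seq (.const 7 a) <| .seq (.add 5 0 1) <| .seq (.add 5 5 7) <|
  .seq (.const 7 0) <| .seq (.add 7 7 1) <|
  .seq (.loop 7 <| .seq (mulProg 3 4 5) <| .seq (.const 5 0) <| .seq (.add 5 5 3) <|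
    .seq (.const 3 1) (.sub 7 7 3)) (powProg c)

/-- The base of the cap. -/
def capBase (a b n k : ℕ) : ℕ := (n + k + a) * (b * (k + 1)) ^ k

/-- In each multiplication the loop counter is the small factor: `b`, then `b * (k + 1)`, and the
base of the cap in the final power. So the time is linear in the base of the cap, not in the cap
itself. -/
theorem capProg_spec (a b c n k : ℕ) (s : RamState) (hn : s.reg 0 = n) (hk : s.reg 1 = k) :
    (capProg a b c).Spec s (b * 3 + k * (b * (k + 1) * 3 + 10) + c * (capBase a b n k * 3 + 7) + 15)
      fun s' => s'.arr = s.arr ∧ s'.reg 0 = n ∧ s'.reg 1 = k ∧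
        s'.reg 2 = capBase a b n k ^ c := by
  set T := k * (b * (k + 1) * 3 + 10) + c * (capBase a b n k * 3 + 7) with hT
  refine (Spec.const (Q := fun s' => s' = s.setReg 6 b) rfl).seq
    (T' := b * 3 + T + 14) ?_ |>.mono (by omega) fun _ h => h
  rintro _ rfl
  refine (Spec.const (Q := fun s' => s' = (s.setReg 6 b).setReg 5 1) rfl).seq
    (T' := b * 3 + T + 13) ?_ |>.mono (by omega) fun _ h => h
  rintro _ rfl
  refine (Spec.add (Q := fun s' => s' = ((s.setReg 6 b).setReg 5 1).setReg 5 (k + 1)) ?_).seq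
    (T' := b * 3 + T + 12) ?_ |>.mono (by omega) fun _ h => h
  · simp [RamState.setReg, hk, add_comm]
  rintro _ rfl
  refine (mulProg_spec (x := 4) (y := 6) (z := 5) (by omega) (by omega) (by omega) (by omega)
      (by omega) _).seq (T' := T + 7) ?_ |>.mono ?_ fun _ h => h
  rotate_left
  · simp [RamState.setReg]; omega
  rintro s1 ⟨ha, h4, hr⟩
  have h4 : s1.reg 4 = b * (k + 1) := by simp [h4, RamState.setReg]
  have h0 : s1.reg 0 = n := by simp [hr, RamState.setReg, hn]
  have h1 : s1.reg 1 = k := by simp [hr, RamState.setReg, hk]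
  have ha : s1.arr = s.arr := ha
  refine (Spec.const (Q := fun s' => s' = s1.setReg 7 a) rfl).seq
    (T' := T + 6) ?_ |>.mono (by omega) fun _ h => h
  rintro _ rfl
  refine (Spec.add (Q := fun s' => s' = (s1.setReg 7 a).setReg 5 (n + k)) ?_).seq
    (T' := T + 5) ?_ |>.mono (by omega) fun _ h => h
  · simp [RamState.setReg, h0, h1]
  rintro _ rfl
  refine (Spec.add (Q := fun s' => s' = ((s1.setReg 7 a).setReg 5 (n + k)).setReg 5
    (n + k + a)) ?_).seq (T' := T + 4) ?_ |>.mono (by omega) fun _ h => h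
  · simp [RamState.setReg]
  rintro _ rfl
  refine (Spec.const (Q := fun s' => s' = (((s1.setReg 7 a).setReg 5 (n + k)).setReg 5
    (n + k + a)).setReg 7 0) rfl).seq (T' := T + 3) ?_ |>.mono (by omega) fun _ h => h
  rintro _ rfl
  refine (Spec.add (Q := fun s' => s'.arr = s.arr ∧ s'.reg 0 = n ∧ s'.reg 1 = k ∧
    s'.reg 4 = b * (k + 1) ∧ s'.reg 5 = n + k + a ∧ s'.reg 7 = k) ?_).seq
    (T' := T + 2) ?_ |>.mono (by omega) fun _ h => h
  · simp [RamState.setReg, h0, h1, h4, ha]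
  rintro s2 ⟨ga, g0, g1, g4, g5, g7⟩
  refine (Spec.loop (c := b * (k + 1) * 3 + 9) (fun j s' => s'.arr = s.arr ∧ s'.reg 0 = n ∧
    s'.reg 1 = k ∧ s'.reg 4 = b * (k + 1) ∧ s'.reg 5 = (n + k + a) * (b * (k + 1)) ^ j) k g7
      ⟨ga, g0, g1, g4, by simpa using g5⟩ ?_).seq (T' := c * (capBase a b n k * 3 + 7) + 1) ?_
      |>.mono (by rw [show b * (k + 1) * 3 + 9 + 1 = b * (k + 1) * 3 + 10 by ring]; omega) fun _ h => h
  · rintro j hj s3 ⟨ka, k0, k1, k4, k5⟩ k7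
    refine (mulProg_spec (x := 3) (y := 4) (z := 5) (by omega) (by omega) (by omega) (by omega)
      (by omega) _).seq (T' := 4) ?_ |>.mono (by rw [k4]) fun _ h => h
    rintro s4 ⟨la, l3, lr⟩
    refine (Spec.const (Q := fun s' => s' = s4.setReg 5 0) rfl).seq (T' := 3) ?_
    rintro _ rfl
    refine (Spec.add (Q := fun s' => s' = (s4.setReg 5 0).setReg 5 _) rfl).seq (T' := 2) ?_
    rintro _ rfl
    refine (Spec.const (Q := fun s' => s' = ((s4.setReg 5 0).setReg 5 _).setReg 3 1) rfl).seq
      (T' := 1) ?_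
    rintro _ rfl
    refine Spec.sub ?_
    simp only [RamState.setReg, la, ka, pow_succ]
    simp [l3, lr, k0, k1, k4, k5, k7]
    refine ⟨by ring, by omega⟩
  · rintro s3 ⟨⟨ka, k0, k1, k4, k5⟩, -⟩
    have k5 : s3.reg 5 = capBase a b n k := k5
    refine (powProg_spec c s3).mono (by rw [k5]) ?_
    rintro s4 ⟨la, l2, l0, l1, -⟩
    exact ⟨by rw [la, ka], by rw [l0, k0], by rw [l1, k1], by rw [l2, k5]⟩

end RamProg

/-! ### Mixed radix digits -/

/-- The place value of the digit `l` in the mixed radix system with bases `β`. -/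
def placeValue (β : ℕ → ℕ) (l : ℕ) : ℕ := ∏ i ∈ Finset.range l, β i

/-- The digit `l` of `u` in the mixed radix system with bases `β`. -/
def mixedDigit (β : ℕ → ℕ) (u l : ℕ) : ℕ := u / placeValue β l % β l

theorem placeValue_succ (β : ℕ → ℕ) (l : ℕ) : placeValue β (l + 1) = placeValue β l * β l :=
  Finset.prod_range_succ _ _

theorem placeValue_pos {β : ℕ → ℕ} {l : ℕ} (hβ : ∀ i < l, 0 < β i) : 0 < placeValue β l :=
  Finset.prod_pos fun i hi => hβ i (Finset.mem_range.1 hi)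

theorem placeValue_dvd (β : ℕ → ℕ) {l l' : ℕ} (h : l ≤ l') : placeValue β l ∣ placeValue β l' :=
  Finset.prod_dvd_prod_of_subset _ _ _ (Finset.range_subset_range.2 h)

/-- The digit `w` is added at the place `placeValue β w`, which is a multiple of `placeValue β (l +
1)` for each `l < w`, so the lower digits do not change. -/
theorem exists_mixedDigit {β d : ℕ → ℕ} (w : ℕ) (hd : ∀ l < w, d l < β l) :
    ∃ u < placeValue β w, ∀ l < w, mixedDigit β u l = d l := by
  induction w with
  | zero => exact ⟨0, by simp [placeValue], by simp⟩
  | succ w ih =>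
    obtain ⟨u, hu, hl⟩ := ih fun l hl => hd l (by omega)
    have hdw := hd w (by omega)
    have hpos : 0 < placeValue β w := by omega
    refine ⟨u + placeValue β w * d w, ?_, fun l hlw => ?_⟩
    · rw [placeValue_succ]
      calc u + placeValue β w * d w < placeValue β w * (d w + 1) := by rw [mul_add]; omega
        _ ≤ _ := Nat.mul_le_mul le_rfl hdw
    · rcases Nat.lt_succ_iff_lt_or_eq.1 hlw with h | rfl
      · obtain ⟨c, hc⟩ := placeValue_dvd β (show l + 1 ≤ w from h)
        have hpl : 0 < placeValue β l := Nat.pos_of_dvd_of_pos (placeValue_dvd β h.le) hpos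
        rw [← hl l h, mixedDigit, mixedDigit, hc, placeValue_succ,
          show placeValue β l * β l * c * d w = placeValue β l * (β l * (c * d w)) by ring,
          Nat.add_mul_div_left _ _ hpl, Nat.add_mul_mod_self_left]
      · rw [mixedDigit, Nat.add_mul_div_left _ _ hpos, Nat.div_eq_of_lt hu, zero_add,
          Nat.mod_eq_of_lt hdw]

/-! ### From weighted satisfiability to a binary constraint satisfaction problem -/

/-- A clause holds under the assignment `p`. -/
def ClauseSat (C : List Lit) (p : ℕ → Prop) : Prop := ∃ l ∈ C, (p l.1 ↔ l.2 = true)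

/-- The variables whose shifted numbers are among the first `l` members of the sequence `s`. -/
def Listed (s : ℕ → ℕ) (l v : ℕ) : Prop := ∃ i < l, s i = v + 1

/-- The bases of the digits of a domain element: positions, values, choices of literals. -/
def cspBase (Q k n l : ℕ) : ℕ := if l < Q + k then k + 1 else if l < Q + k + Q then n else Q

/-- Each row of `s` starts with `Q` values given by digits of the row index, and is continued by
literals, chosen by digits of the row index, of the first clause that is falsified so far. -/
structure IsSearchTable (F : CnfFormula) (Q k n : ℕ) (s : ℕ → ℕ → ℕ) : Prop where
  start : ∀ u < placeValue (cspBase Q k n) (2 * (Q + k)), ∀ l < Q,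
    s u l = mixedDigit (cspBase Q k n) u (Q + k + l)
  stay : ∀ u < placeValue (cspBase Q k n) (2 * (Q + k)), ∀ l < Q + k, Q ≤ l →
    (∀ C ∈ F, ClauseSat C (Listed (s u) l)) → s u l = 0
  step : ∀ u < placeValue (cspBase Q k n) (2 * (Q + k)), ∀ l < Q + k, Q ≤ l →
    ∀ i (hi : i < F.length), (∀ j (hj : j < i), ClauseSat F[j] (Listed (s u) l)) →
      ¬ ClauseSat F[i] (Listed (s u) l) →
        ∀ b (hb : b < F[i].length), mixedDigit (cspBase Q k n) u (Q + k + l) = b →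
          s u l = F[i][b].1 + 1

/-- The constraint between the tuple variable `p` and the position variable `i`. -/
def cspCore (F : CnfFormula) (Q k n : ℕ) (s : ℕ → ℕ → ℕ) (p i u v : ℕ) : Prop :=
  (∀ l < Q, mixedDigit (cspBase Q k n) u l = mixedDigit (cspBase Q k n) p l) ∧
  (∀ C ∈ F, ClauseSat C (Listed (s u) (Q + k))) ∧
  (∀ l < Q, ∀ l' < Q, mixedDigit (cspBase Q k n) u l < mixedDigit (cspBase Q k n) u l' →
    s u l < s u l') ∧
  (∀ l < Q + k, mixedDigit (cspBase Q k n) u l = i → s u l = v) ∧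
  (v = 0 ↔ i = 0) ∧ (v = 0 ∨ v - 1 ∈ F.vars)

/-- The binary constraints: only those between tuple variables and position variables matter. -/
def cspRel (F : CnfFormula) (Q k n : ℕ) (s : ℕ → ℕ → ℕ) (p p' u v : ℕ) : Prop :=
  p < placeValue (cspBase Q k n) Q → placeValue (cspBase Q k n) Q ≤ p' →
    cspCore F Q k n s p (p' - placeValue (cspBase Q k n) Q) u v

/-- The number of variables of the constraint satisfaction problem. -/
def cspVars (Q k n : ℕ) : ℕ := placeValue (cspBase Q k n) Q + (k + 1)

/-- The size of the domain. -/
def cspDom (Q k n : ℕ) : ℕ := placeValue (cspBase Q k n) (2 * (Q + k))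

/-- `val` solves the binary constraint satisfaction problem `R` with `K` variables and domain
size `D`. -/
def SolvesCsp (K D : ℕ) (R : ℕ → ℕ → ℕ → ℕ → Prop) (val : ℕ → ℕ) : Prop :=
  (∀ i < K, val i < D) ∧ ∀ i < K, ∀ j < K, i ≠ j → R i j (val i) (val j)

section

variable {F : CnfFormula} {Q k n : ℕ} {s : ℕ → ℕ → ℕ}

theorem cspBase_pos (hQ : 0 < Q) (hn : 0 < n) (l : ℕ) : 0 < cspBase Q k n l := by
  unfold cspBase
  split_ifs <;> omega

/-- The true variables are read off the position variables. If they falsified a clause, choose the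
tuple that names its negated variables. The set listed by the corresponding row satisfies the clause
and makes its negative literals false, hence lists one of its positive variables; but everything
listed is the value of some position, so this variable is true. -/
theorem weightedSat_of_solvesCsp (hQ : 2 ≤ Q) (hF : ∀ C ∈ F, C.length ≤ Q) {val : ℕ → ℕ}
    (h : SolvesCsp (cspVars Q k n) (cspDom Q k n) (cspRel F Q k n s) val) : F.WeightedSat k := by
  set β := cspBase Q k n with hβ
  set K₁ := placeValue β Q with hK₁
  have hvars : cspVars Q k n = K₁ + (k + 1) := rfl
  have hpl : placeValue (cspBase Q k n) Q = K₁ := rfl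
  set x : ℕ → ℕ := fun i => val (K₁ + i) with hx
  have key : ∀ i < k + 1, ∀ p < K₁, cspCore F Q k n s p i (val p) (x i) := by
    intro i hi p hp
    have := h.2 p (by omega) (K₁ + i) (by omega) (by omega) hp (by omega)
    rwa [hpl, Nat.add_sub_cancel_left] at this
  -- Every tuple `t` of positions is the digit sequence of some tuple variable `p`, and the
  -- constraints with the position variables tie the first `Q` entries of the row `val p` to the
  -- values at these positions.
  have tup : ∀ t : ℕ → ℕ, (∀ l < Q, t l < k + 1) → ∃ p < K₁,
      (∀ l < Q, mixedDigit β (val p) l = t l) ∧ ∀ l < Q, s (val p) l = x (t l) := by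
    intro t ht
    obtain ⟨p, hp, hd⟩ := exists_mixedDigit (β := β) (d := t) Q fun l hl => by
      simpa [hβ, cspBase, show l < Q + k by omega] using ht l hl
    have hd' : ∀ l < Q, mixedDigit β (val p) l = t l := fun l hl => by
      rw [(key 0 (by omega) p hp).1 l hl, ← hd l hl]
    exact ⟨p, hp, hd', fun l hl => (key (t l) (ht l hl) p hp).2.2.2.1 l (by omega) (hd' l hl)⟩
  -- A tuple containing both `i` and `j` compares their values; this is why `Q` has to be at least
  -- `2`.
  have hmono : ∀ i j, i < j → j < k + 1 → x i < x j := by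
    intro i j hij hj
    obtain ⟨p, hp, hd, hs⟩ := tup (fun l => if l = 0 then i else j) fun l _ => by
      split_ifs <;> omega
    have := (key 0 (by omega) p hp).2.2.1 0 (by omega) 1 (by omega)
      (by rw [← hβ, hd 0 (by omega), hd 1 (by omega)]; simpa using hij)
    rw [hs 0 (by omega), hs 1 (by omega)] at this
    simpa using this
  obtain ⟨p₀, hp₀, -, -⟩ := tup (fun _ => 0) fun l _ => by omega
  have hx0 : x 0 = 0 := ((key 0 (by omega) p₀ hp₀).2.2.2.2.1).2 rfl
  have hxpos : ∀ i < k + 1, 0 < i → 0 < x i := fun i hi h0 => by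
    have := hmono 0 i h0 hi
    omega
  set T : Finset ℕ := (Finset.range k).image fun i => x (i + 1) - 1 with hT
  have hmem : ∀ v, v ∈ T ↔ ∃ i < k + 1, x i = v + 1 := by
    intro v
    simp only [hT, Finset.mem_image, Finset.mem_range]
    constructor
    · rintro ⟨i, hi, rfl⟩
      have := hxpos (i + 1) (by omega) (by omega)
      exact ⟨i + 1, by omega, by omega⟩
    · rintro ⟨i, hi, h⟩
      rcases i with _ | i
      · omega
      · exact ⟨i, by omega, by omega⟩
  refine ⟨T, fun v hv => ?_, ?_, fun C hC => ?_⟩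
  · obtain ⟨i, hi, h⟩ := (hmem v).1 hv
    rcases (key i hi p₀ hp₀).2.2.2.2.2 with h' | h'
    · omega
    · rwa [h, Nat.add_sub_cancel] at h'
  · rw [hT, Finset.card_image_of_injOn, Finset.card_range]
    intro i hi j hj hij
    simp only [Finset.coe_range, Set.mem_Iio] at hi hj hij
    have h1 := hxpos (i + 1) (by omega) (by omega)
    have h2 := hxpos (j + 1) (by omega) (by omega)
    rcases lt_trichotomy i j with h | h | h
    · have := hmono (i + 1) (j + 1) (by omega) (by omega)
      omega
    · exact h
    · have := hmono (j + 1) (i + 1) (by omega) (by omega)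
      omega
  · by_contra hcon
    push Not at hcon
    -- Entries that correspond to no negative literal get the position `0`, whose value `0` stands
    -- for no variable.
    have hneg : ∀ l : ℕ, ∃ i < k + 1, ∀ hl : l < C.length, C[l].2 = false → x i = C[l].1 + 1 := by
      intro l
      by_cases hl : l < C.length ∧ ∀ hl : l < C.length, C[l].2 = false
      · have hl2 := hl.2 hl.1
        have hv : C[l].1 ∈ T := by
          rcases hcon _ (List.getElem_mem hl.1) with h | h
          · exact h.1
          · exact absurd h.2 (by simp [hl2])
        obtain ⟨i, hi, h⟩ := (hmem _).1 hv
        exact ⟨i, hi, fun _ _ => h⟩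
      · refine ⟨0, by omega, fun h h' => absurd ⟨h, fun _ => h'⟩ hl⟩
    choose t ht ht' using hneg
    obtain ⟨p, hp, hd, hs⟩ := tup t fun l _ => ht l
    obtain ⟨⟨v, b⟩, hl, hlit⟩ := (key 0 (by omega) p hp).2.1 C hC
    cases b with
    | false =>
      obtain ⟨l, hlC, hCl⟩ := List.getElem_of_mem hl
      have hlQ : l < Q := hlC.trans_le (hF C hC)
      have := ht' l hlC (by rw [hCl])
      rw [← hs l hlQ, hCl] at this
      simp only [Bool.false_eq_true, iff_false] at hlit
      exact hlit ⟨l, by omega, this⟩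
    | true =>
      simp only [iff_true] at hlit
      obtain ⟨l, hl', hsl⟩ := hlit
      have hdk : mixedDigit β (val p) l < k + 1 := by
        have : cspBase Q k n l = k + 1 := by simp [cspBase, hl']
        rw [mixedDigit, hβ, this]
        exact Nat.mod_lt _ (by omega)
      have := (key _ hdk p hp).2.2.2.1 l hl' rfl
      have hv : v ∈ T := (hmem v).2 ⟨_, hdk, by rw [← this, hsl]⟩
      rcases hcon _ hl with h | h
      · exact absurd h.2 (by simp)
      · exact absurd hv h.1

/-- Every `Q`-tuple from a satisfying set is the start of a row that lists a satisfying subset. -/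
theorem IsSearchTable.exists_row (hs : IsSearchTable F Q k n s) (hQ : 0 < Q)
    (hF : ∀ C ∈ F, C.length ≤ Q) {T : Finset ℕ} (hT : F.SatBy T) (hcard : T.card = k)
    {x : ℕ → ℕ} (hx : ∀ i < k + 1, x i < n) (hxT : ∀ v ∈ T, ∃ i < k + 1, x i = v + 1)
    (hxT' : ∀ i < k + 1, ∀ v, x i = v + 1 → v ∈ T) (hx0 : x 0 = 0)
    (t : ℕ → ℕ) (ht : ∀ l < Q, t l < k + 1) :
    ∃ u < placeValue (cspBase Q k n) (2 * (Q + k)),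
      (∀ l < Q, mixedDigit (cspBase Q k n) u l = t l) ∧
      (∀ l < Q + k, s u l = x (mixedDigit (cspBase Q k n) u l)) ∧
      ∀ C ∈ F, ClauseSat C (Listed (s u) (Q + k)) := by
  classical
  have hn : 0 < n := (Nat.zero_le _).trans_lt (hx 0 (by omega))
  -- one step of the search
  have hstep : ∀ (p : ℕ → Prop), (∀ v, p v → v ∈ T) → ∃ i < k + 1, ∃ b, (b < Q ∨ b = 0) ∧
      ((∀ C ∈ F, ClauseSat C p) → x i = 0) ∧
      ∀ j (hj : j < F.length), (∀ j' (hj' : j' < j), ClauseSat F[j'] p) → ¬ ClauseSat F[j] p →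
        ∃ hb : b < F[j].length, x i = F[j][b].1 + 1 ∧ ¬ p F[j][b].1 := by
    intro p hp
    by_cases hall : ∃ j, ∃ hj : j < F.length, ¬ ClauseSat F[j] p
    · obtain ⟨hj, hjc⟩ := Nat.find_spec hall
      set j := Nat.find hall with hjdef
      have hmin : ∀ j' (hj' : j' < j), ClauseSat F[j'] p := fun j' hj' => by
        have := Nat.find_min hall hj'
        push Not at this
        exact this (by omega)
      obtain ⟨⟨v, e⟩, hl, hlit⟩ := hT F[j] (List.getElem_mem hj)
      -- A negative literal true under `T` is true under every subset of `T`, so it would satisfy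
      -- the clause already. The literal is thus positive, and its variable lies in `T` but is not
      -- yet listed.
      have he : e = true := by
        by_contra he
        simp only [Bool.not_eq_true] at he
        subst he
        refine hjc ⟨_, hl, ?_⟩
        simp only [Bool.false_eq_true, iff_false] at hlit ⊢
        exact fun h => hlit (hp v h)
      subst he
      simp only [iff_true] at hlit
      have hpv : ¬ p v := fun h => hjc ⟨_, hl, by simpa using h⟩
      obtain ⟨b, hb, hbv⟩ := List.getElem_of_mem hl
      obtain ⟨i, hi, hxi⟩ := hxT v hlit
      refine ⟨i, hi, b, Or.inl (hb.trans_le (hF _ (List.getElem_mem hj))), fun h => ?_, ?_⟩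
      · exact absurd (h _ (List.getElem_mem hj)) hjc
      · intro j₂ hj₂ hmin₂ hc₂
        obtain rfl : j₂ = j := by
          rcases lt_trichotomy j₂ j with h | h | h
          · exact absurd (hmin j₂ h) hc₂
          · exact h
          · exact absurd (hmin₂ j h) hjc
        exact ⟨hb, by rw [hbv, hxi], by rwa [hbv]⟩
    · push Not at hall
      exact ⟨0, by omega, 0, Or.inr rfl, fun _ => hx0, fun j hj _ hc => absurd (hall j hj) hc⟩
  -- the sequence of positions and of literal choices, built along the row
  have hrow : ∀ m ≤ k, ∃ g b : ℕ → ℕ, (∀ l < Q, g l = t l) ∧ (∀ l < Q + k, g l < k + 1) ∧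
      (∀ l, b l < Q ∨ b l = 0) ∧ ∀ l < Q + m, Q ≤ l →
        ((∀ C ∈ F, ClauseSat C (Listed (x ∘ g) l)) → x (g l) = 0) ∧
        ∀ j (hj : j < F.length), (∀ j' (hj' : j' < j), ClauseSat F[j'] (Listed (x ∘ g) l)) →
          ¬ ClauseSat F[j] (Listed (x ∘ g) l) →
          ∃ hb : b l < F[j].length, x (g l) = F[j][b l].1 + 1 ∧ ¬ Listed (x ∘ g) l F[j][b l].1 := by
    intro m
    induction m with
    | zero =>
      exact fun _ => ⟨fun l => if l < Q then t l else 0, fun _ => 0, fun l hl => by simp [hl],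
        fun l _ => by dsimp only; split_ifs with h; exacts [ht l h, by omega],
        fun _ => Or.inr rfl, fun l hl hl' => by omega⟩
    | succ m ih =>
      intro hm
      obtain ⟨g, b, hg, hg', hb, hgb⟩ := ih (by omega)
      obtain ⟨i, hi, c, hc, h1, h2⟩ := hstep (Listed (x ∘ g) (Q + m)) fun v hv => by
        obtain ⟨l, hl, hv⟩ := hv
        exact hxT' (g l) (hg' l (by omega)) v hv
      have hL : ∀ l ≤ Q + m, Listed (x ∘ Function.update g (Q + m) i) l = Listed (x ∘ g) l := by
        intro l hl
        funext v
        refine propext (exists_congr fun l' => and_congr_right fun hl' => ?_)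
        simp [show l' ≠ Q + m by omega]
      refine ⟨Function.update g (Q + m) i, Function.update b (Q + m) c, fun l hl => ?_,
        fun l hl => ?_, fun l => ?_, fun l hl hl' => ?_⟩
      · rw [Function.update_of_ne (by omega), hg l hl]
      · rcases eq_or_ne l (Q + m) with rfl | h
        · simpa using hi
        · simpa [h] using hg' l hl
      · rcases eq_or_ne l (Q + m) with rfl | h
        · simpa using hc
        · simpa [h] using hb l
      · rw [hL l (by omega)]
        rcases eq_or_ne l (Q + m) with rfl | h
        · simpa using ⟨h1, h2⟩
        · simpa [h] using hgb l (by omega) hl'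
  obtain ⟨g, b, hg, hg', hb, hgb⟩ := hrow k le_rfl
  -- The row index packs the three kinds of data: the positions of all `Q + k` entries, the values
  -- of the first `Q` entries, and the literal chosen in each of the `k` search steps.
  obtain ⟨u, hu, hd⟩ := exists_mixedDigit (β := cspBase Q k n)
    (d := fun l => if l < Q + k then g l else if l < Q + k + Q then x (t (l - (Q + k)))
      else b (l - (Q + k))) (2 * (Q + k)) fun l hl => by
    dsimp only [cspBase]
    split_ifs with h1 h2
    · exact hg' l h1
    · exact hx _ (ht _ (by omega))
    · rcases hb (l - (Q + k)) with h | h <;> omega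
  have hdg : ∀ l < Q + k, mixedDigit (cspBase Q k n) u l = g l := fun l hl => by
    rw [hd l (by omega)]
    simp [hl]
  have hsx : ∀ l < Q + k, s u l = x (g l) := by
    intro l
    induction l using Nat.strong_induction_on with
    | _ l ih =>
      intro hl
      by_cases hlQ : l < Q
      · rw [hs.start u hu l hlQ, hd _ (by omega), hg l hlQ]
        simp [hlQ]
      · have hL : Listed (s u) l = Listed (x ∘ g) l := by
          funext v
          refine propext (exists_congr fun l' => and_congr_right fun hl' => ?_)
          rw [ih l' hl' (by omega)]
          rfl
        obtain ⟨h1, h2⟩ := hgb l hl (by omega)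
        by_cases hall : ∃ j, ∃ hj : j < F.length, ¬ ClauseSat F[j] (Listed (x ∘ g) l)
        · obtain ⟨hj, hjc⟩ := Nat.find_spec hall
          have hmin : ∀ j' (hj' : j' < Nat.find hall),
              ClauseSat F[j'] (Listed (x ∘ g) l) := fun j' hj' => by
            have := Nat.find_min hall hj'
            push Not at this
            exact this (by omega)
          obtain ⟨hbl, hxg, -⟩ := h2 _ hj hmin hjc
          rw [hxg]
          refine hs.step u hu l hl (by omega) _ hj (by rw [hL]; exact hmin)
            (by rw [hL]; exact hjc) _ hbl ?_
          rw [hd _ (by omega)]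
          simp [show ¬ l < Q from hlQ]
        · push Not at hall
          have hsat : ∀ C ∈ F, ClauseSat C (Listed (x ∘ g) l) := fun C hC => by
            obtain ⟨j, hj, rfl⟩ := List.getElem_of_mem hC
            exact hall j hj
          rw [h1 hsat]
          exact hs.stay u hu l hl (by omega) (by rwa [hL])
  have hL : Listed (s u) (Q + k) = Listed (x ∘ g) (Q + k) := by
    funext v
    refine propext (exists_congr fun l' => and_congr_right fun hl' => ?_)
    rw [hsx l' hl']
    rfl
  refine ⟨u, hu, fun l hl => by rw [hdg l (by omega), hg l hl],
    fun l hl => by rw [hdg l hl, hsx l hl], ?_⟩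
  rw [hL]
  -- each unsuccessful step lists a new variable
  have hgrow : ∀ m ≤ k, (∀ C ∈ F, ClauseSat C (Listed (x ∘ g) (Q + m))) ∨
      m ≤ (T.filter (Listed (x ∘ g) (Q + m))).card := by
    intro m
    induction m with
    | zero => exact fun _ => Or.inr (Nat.zero_le _)
    | succ m ih =>
      intro hm
      obtain ⟨h1, h2⟩ := hgb (Q + m) (by omega) (by omega)
      rcases ih (by omega) with h | h
      · left
        have : Listed (x ∘ g) (Q + (m + 1)) = Listed (x ∘ g) (Q + m) := by
          funext v
          refine propext ⟨?_, ?_⟩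
          · rintro ⟨l, hl, hv⟩
            rcases eq_or_ne l (Q + m) with rfl | hne
            · simp [h1 h] at hv
            · exact ⟨l, by omega, hv⟩
          · rintro ⟨l, hl, hv⟩
            exact ⟨l, by omega, hv⟩
        rwa [this]
      by_cases hall : ∃ j, ∃ hj : j < F.length, ¬ ClauseSat F[j] (Listed (x ∘ g) (Q + m))
      · right
        obtain ⟨hj, hjc⟩ := Nat.find_spec hall
        have hmin : ∀ j' (hj' : j' < Nat.find hall),
            ClauseSat F[j'] (Listed (x ∘ g) (Q + m)) := fun j' hj' => by
          have := Nat.find_min hall hj'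
          push Not at this
          exact this (by omega)
        obtain ⟨hbl, hxg, hnew⟩ := h2 _ hj hmin hjc
        set v := F[Nat.find hall][b (Q + m)].1
        refine (Nat.succ_le_succ h).trans ?_
        rw [Nat.succ_eq_add_one, ← Finset.card_insert_of_notMem (a := v)
          (fun h => hnew (Finset.mem_filter.1 h).2)]
        refine Finset.card_le_card fun w hw => ?_
        rw [Finset.mem_filter]
        rcases Finset.mem_insert.1 hw with rfl | hw
        · exact ⟨hxT' _ (hg' (Q + m) (by omega)) _ hxg, Q + m, by omega, hxg⟩
        · obtain ⟨hw, l, hl, hl'⟩ := Finset.mem_filter.1 hw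
          exact ⟨hw, l, by omega, hl'⟩
      · push Not at hall
        left
        intro C hC
        obtain ⟨j, hj, rfl⟩ := List.getElem_of_mem hC
        have hsat : ∀ C ∈ F, ClauseSat C (Listed (x ∘ g) (Q + m)) := fun C hC => by
          obtain ⟨j, hj, rfl⟩ := List.getElem_of_mem hC
          exact hall j hj
        have : Listed (x ∘ g) (Q + (m + 1)) = Listed (x ∘ g) (Q + m) := by
          funext v
          refine propext ⟨?_, ?_⟩
          · rintro ⟨l, hl, hv⟩
            rcases eq_or_ne l (Q + m) with rfl | hne
            · simp [h1 hsat] at hv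
            · exact ⟨l, by omega, hv⟩
          · rintro ⟨l, hl, hv⟩
            exact ⟨l, by omega, hv⟩
        rw [this]
        exact hall j hj
  rcases hgrow k le_rfl with h | h
  · exact h
  · have heq : T.filter (Listed (x ∘ g) (Q + k)) = T :=
      Finset.eq_of_subset_of_card_le (Finset.filter_subset _ _) (by omega)
    have hiff : ∀ v, Listed (x ∘ g) (Q + k) v ↔ v ∈ T := fun v => by
      constructor
      · rintro ⟨l, hl, hv⟩
        exact hxT' _ (hg' l hl) v hv
      · intro hv
        rw [← heq] at hv
        exact (Finset.mem_filter.1 hv).2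
    intro C hC
    obtain ⟨l, hl, hlit⟩ := hT C hC
    exact ⟨l, hl, by rw [hiff]; exact hlit⟩

/-- Each position variable gets the element of the solution with that rank, and each tuple variable
a search branch that stays inside the solution. The constraints hold because all entries of such a
row are values of the positions it records. -/
theorem exists_solvesCsp (hQ : 2 ≤ Q) (hF : ∀ C ∈ F, C.length ≤ Q)
    (hn : ∀ v ∈ F.vars, v + 1 < n) (hn0 : 0 < n) (hs : IsSearchTable F Q k n s)
    (h : F.WeightedSat k) :
    ∃ val, SolvesCsp (cspVars Q k n) (cspDom Q k n) (cspRel F Q k n s) val := by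
  obtain ⟨T, hTv, hcard, hsat⟩ := h
  set x : ℕ → ℕ := fun i => if h : i - 1 < k ∧ i ≠ 0 then T.orderEmbOfFin hcard ⟨i - 1, h.1⟩ + 1
    else 0 with hx
  have hx0 : x 0 = 0 := by simp [hx]
  have hxs : ∀ i (hi : i < k), x (i + 1) = T.orderEmbOfFin hcard ⟨i, hi⟩ + 1 := fun i hi => by
    simp [hx, hi]
  have hmono : ∀ i j, i < j → j < k + 1 → x i < x j := by
    intro i j hij hj
    obtain ⟨j, rfl⟩ : ∃ j', j = j' + 1 := ⟨j - 1, by omega⟩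
    rw [hxs j (by omega)]
    rcases i with _ | i
    · omega
    · rw [hxs i (by omega)]
      have : T.orderEmbOfFin hcard ⟨i, by omega⟩ < T.orderEmbOfFin hcard ⟨j, by omega⟩ :=
        (T.orderEmbOfFin hcard).strictMono (by simpa using hij)
      omega
  have hxT : ∀ v ∈ T, ∃ i < k + 1, x i = v + 1 := by
    intro v hv
    rw [← Finset.mem_coe, ← Finset.range_orderEmbOfFin T hcard] at hv
    obtain ⟨i, rfl⟩ := hv
    exact ⟨i + 1, by omega, hxs i i.2⟩
  have hxT' : ∀ i < k + 1, ∀ v, x i = v + 1 → v ∈ T := by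
    intro i hi v hv
    rcases i with _ | i
    · omega
    · rw [hxs i (by omega)] at hv
      rw [← Nat.succ_injective hv]
      exact Finset.orderEmbOfFin_mem _ _ _
  have hxn : ∀ i < k + 1, x i < n := by
    intro i hi
    by_cases h : x i = 0
    · omega
    · have := hn _ (hTv (hxT' i hi (x i - 1) (by omega)))
      omega
  set β := cspBase Q k n with hβ
  set K₁ := placeValue β Q with hK₁
  have hvars : cspVars Q k n = K₁ + (k + 1) := rfl
  have hpl : placeValue (cspBase Q k n) Q = K₁ := rfl
  have hdig : ∀ p, ∀ l < Q, mixedDigit β p l < k + 1 := fun p l hl => by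
    have : β l = k + 1 := by simp [hβ, cspBase, show l < Q + k by omega]
    rw [mixedDigit, this]
    exact Nat.mod_lt _ (by omega)
  choose u hu hd hrow hsatu using fun p : ℕ => hs.exists_row (by omega) hF hsat hcard hxn hxT hxT' hx0
    (fun l => mixedDigit β p l) (hdig p)
  refine ⟨fun i => if i < K₁ then u i else x (i - K₁), fun i hi => ?_,
    fun i hi j hj hij hi' hj' => ?_⟩
  · dsimp only
    split_ifs with h
    · exact hu i
    · have h1 := hxn (i - K₁) (by omega)
      refine h1.trans_le ?_
      -- The digit at place `Q + k` has base `n`, so `n` divides the domain size; the values of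
      -- position variables, which are below `n`, therefore lie in the domain.
      have hdvd : placeValue β (Q + k + 1) ∣ cspDom Q k n := placeValue_dvd β (by omega)
      have hb : β (Q + k) = n := by simp [hβ, cspBase, show 0 < Q by omega]
      rw [placeValue_succ, hb] at hdvd
      exact Nat.le_of_dvd (placeValue_pos fun l _ => cspBase_pos (by omega) hn0 l)
        ((Dvd.intro_left _ rfl).trans hdvd)
  · rw [hpl] at hi' hj' ⊢
    dsimp only
    rw [if_pos hi', if_neg (show ¬ j < K₁ by omega)]
    have hjk : j - K₁ < k + 1 := by omega
    have hz : x (j - K₁) = 0 ↔ j - K₁ = 0 := by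
      constructor
      · intro h
        by_contra h'
        have := hmono 0 (j - K₁) (by omega) hjk
        omega
      · intro h
        rw [h, hx0]
    refine ⟨hd i, hsatu i, fun l hl l' hl' hlt => ?_, fun l hl hl' => ?_, hz, ?_⟩
    · rw [hrow i l (by omega), hrow i l' (by omega)]
      refine hmono _ _ hlt ?_
      have := hdig i l' hl'
      rw [← hd i l' hl'] at this
      exact this
    · rw [hrow i l hl, hl']
    · by_cases h : x (j - K₁) = 0
      · exact Or.inl h
      · exact Or.inr (hTv (hxT' _ hjk _ (by omega)))

end

/-! ### From binary constraints to point sets with three orders -/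

/-- With `v < D`, the numbers `a * D + v` are ordered lexicographically by `(a, v)`. This and the
next two lemmas are used to compare nested keys digit by digit. -/
theorem mul_add_lt_mul_add {a a' v v' D : ℕ} (h : a < a') (hv : v < D) :
    a * D + v < a' * D + v' := by
  calc a * D + v < (a + 1) * D := by rw [add_mul]; omega
    _ ≤ a' * D := Nat.mul_le_mul_right _ h
    _ ≤ _ := Nat.le_add_right _ _

theorem lt_or_eq_of_mul_add_lt {a a' v v' D : ℕ} (hv' : v' < D)
    (h : a * D + v < a' * D + v') : a < a' ∨ a = a' ∧ v < v' := by
  rcases lt_trichotomy a a' with h' | rfl | h'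
  · exact Or.inl h'
  · exact Or.inr ⟨rfl, by omega⟩
  · have := mul_add_lt_mul_add (v' := v) h' hv'
    omega

theorem eq_and_eq_of_mul_add_eq {a a' v v' D : ℕ} (hv : v < D) (hv' : v' < D)
    (h : a * D + v = a' * D + v') : a = a' ∧ v = v' := by
  rcases lt_trichotomy a a' with h' | rfl | h'
  · have := mul_add_lt_mul_add (v' := v') h' hv
    omega
  · exact ⟨rfl, by omega⟩
  · have := mul_add_lt_mul_add (v' := v) h' hv'
    omega

section Grid

variable (K D : ℕ)

/-- The block of a candidate; the blocks are indexed by the pairs `(i, j)`, `i < K`, `j ≤ K`. -/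
def gridBlock (c : ℕ) : ℕ := c / (D * D + 1)

/-- The offset of a candidate in its block: `0` is the separator, the others are pairs. -/
def gridOff (c : ℕ) : ℕ := c % (D * D + 1)

/-- The rank of block `(i, j)` in its vertical strip. -/
def gridSubX (i j : ℕ) : ℕ := if j = K then K + 1 else if i = j then 0 else j + 1

/-- The rank of block `(i, j)` in its horizontal strip. -/
def gridSubY (i j : ℕ) : ℕ := if j = K then 0 else if i = j then K + 1 else i + 1

/-- The horizontal strip of block `(i, j)`. -/
def gridCol (i j : ℕ) : ℕ := if j = K then i else j

/-- The key of a candidate in the first order. -/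
def gridX (c : ℕ) : ℕ :=
  if gridOff D c = 0 then gridBlock D c else
    K * (K + 1) + ((gridBlock D c / (K + 1) * D + (gridOff D c - 1) / D) * (K + 2)
      + gridSubX K (gridBlock D c / (K + 1)) (gridBlock D c % (K + 1))) * D + (gridOff D c - 1) % D

/-- The key of a candidate in the second order. -/
def gridY (c : ℕ) : ℕ :=
  if gridOff D c = 0 then gridBlock D c else
    K * (K + 1) + ((gridCol K (gridBlock D c / (K + 1)) (gridBlock D c % (K + 1)) * D
      + (gridOff D c - 1) % D) * (K + 2)
      + gridSubY K (gridBlock D c / (K + 1)) (gridBlock D c % (K + 1))) * D + (gridOff D c - 1) / D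

/-- The candidates that are used: all separators, and the pairs allowed by the constraints. -/
def GridPresent (R : ℕ → ℕ → ℕ → ℕ → Prop) (c : ℕ) : Prop :=
  gridOff D c = 0 ∨
    if gridBlock D c % (K + 1) = K ∨ gridBlock D c / (K + 1) = gridBlock D c % (K + 1) then
      (gridOff D c - 1) / D = (gridOff D c - 1) % D
    else R (gridBlock D c / (K + 1)) (gridBlock D c % (K + 1)) ((gridOff D c - 1) / D)
      ((gridOff D c - 1) % D)

open Classical in
/-- The set of used candidates. -/
noncomputable def gridSet (R : ℕ → ℕ → ℕ → ℕ → Prop) : Finset ℕ :=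
  (Finset.range (K * (K + 1) * (D * D + 1))).filter (GridPresent K D R)

/-- The candidate with a given block and offset. -/
def gridMk (t e : ℕ) : ℕ := t * (D * D + 1) + e

/-! ### Coordinates of separators and pair points -/

variable {K D}

theorem gridBlock_mk {t e : ℕ} (he : e < D * D + 1) : gridBlock D (gridMk D t e) = t := by
  rw [gridBlock, gridMk, mul_comm, Nat.mul_add_div (by omega), Nat.div_eq_of_lt he, add_zero]

theorem gridOff_mk {t e : ℕ} (he : e < D * D + 1) : gridOff D (gridMk D t e) = e := by
  rw [gridOff, gridMk, mul_comm, Nat.mul_add_mod, Nat.mod_eq_of_lt he]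

theorem pair_lt {u v : ℕ} (hu : u < D) (hv : v < D) : u * D + v + 1 < D * D + 1 := by
  have := mul_add_lt_mul_add (v' := 0) hu hv
  omega

theorem block_div {i j : ℕ} (hj : j ≤ K) : (i * (K + 1) + j) / (K + 1) = i := by
  rw [mul_comm, Nat.mul_add_div (by omega), Nat.div_eq_of_lt (by omega), add_zero]

theorem block_mod {i j : ℕ} (hj : j ≤ K) : (i * (K + 1) + j) % (K + 1) = j := by
  rw [mul_comm, Nat.mul_add_mod, Nat.mod_eq_of_lt (by omega)]

theorem pair_div {u v : ℕ} (hv : v < D) : (u * D + v + 1 - 1) / D = u := by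
  rw [Nat.add_sub_cancel, mul_comm, Nat.mul_add_div (by omega), Nat.div_eq_of_lt hv, add_zero]

theorem pair_mod {u v : ℕ} (hv : v < D) : (u * D + v + 1 - 1) % D = v := by
  rw [Nat.add_sub_cancel, mul_comm, Nat.mul_add_mod, Nat.mod_eq_of_lt hv]

theorem gridX_sep (t : ℕ) : gridX K D (gridMk D t 0) = t := by
  rw [gridX, gridOff_mk (by omega), if_pos rfl, gridBlock_mk (by omega)]

theorem gridY_sep (t : ℕ) : gridY K D (gridMk D t 0) = t := by
  rw [gridY, gridOff_mk (by omega), if_pos rfl, gridBlock_mk (by omega)]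

theorem gridX_pair {i j u v : ℕ} (hj : j ≤ K) (hu : u < D) (hv : v < D) :
    gridX K D (gridMk D (i * (K + 1) + j) (u * D + v + 1)) =
      K * (K + 1) + (((i * D + u) * (K + 2) + gridSubX K i j) * D + v) := by
  rw [gridX, gridOff_mk (pair_lt hu hv), if_neg (by omega), gridBlock_mk (pair_lt hu hv),
    pair_div hv, pair_mod hv, block_div hj, block_mod hj, add_assoc]

theorem gridY_pair {i j u v : ℕ} (hj : j ≤ K) (hu : u < D) (hv : v < D) :
    gridY K D (gridMk D (i * (K + 1) + j) (u * D + v + 1)) =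
      K * (K + 1) + (((gridCol K i j * D + v) * (K + 2) + gridSubY K i j) * D + u) := by
  rw [gridY, gridOff_mk (pair_lt hu hv), if_neg (by omega), gridBlock_mk (pair_lt hu hv),
    pair_div hv, pair_mod hv, block_div hj, block_mod hj, add_assoc]

theorem gridSubX_lt {i j : ℕ} (hj : j ≤ K) : gridSubX K i j < K + 2 := by
  unfold gridSubX; split_ifs <;> omega

theorem gridSubY_lt {i j : ℕ} (hi : i < K) : gridSubY K i j < K + 2 := by
  unfold gridSubY; split_ifs <;> omega

theorem block_lt {i j : ℕ} (hi : i < K) (hj : j ≤ K) : i * (K + 1) + j < K * (K + 1) := by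
  simpa using mul_add_lt_mul_add (D := K + 1) (v' := 0) hi (show j < K + 1 by omega)

theorem exists_block {t : ℕ} (ht : t < K * (K + 1)) :
    ∃ i < K, ∃ j ≤ K, t = i * (K + 1) + j :=
  ⟨t / (K + 1), Nat.div_lt_of_lt_mul (by rwa [mul_comm]), t % (K + 1),
    Nat.le_of_lt_succ (Nat.mod_lt _ (by omega)), (Nat.div_add_mod' _ _).symm⟩

/-- Every candidate is a separator or a pair. -/
theorem exists_gridMk {c : ℕ} (hc : c < K * (K + 1) * (D * D + 1)) :
    ∃ i < K, ∃ j ≤ K, c = gridMk D (i * (K + 1) + j) 0 ∨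
      ∃ u < D, ∃ v < D, c = gridMk D (i * (K + 1) + j) (u * D + v + 1) := by
  obtain ⟨i, hi, j, hj, hij⟩ := exists_block (K := K) (t := c / (D * D + 1))
    (Nat.div_lt_of_lt_mul (by rwa [mul_comm]))
  refine ⟨i, hi, j, hj, ?_⟩
  have hc' : c = gridMk D (i * (K + 1) + j) (c % (D * D + 1)) := by
    rw [← hij, gridMk, Nat.div_add_mod']
  have hlt : c % (D * D + 1) < D * D + 1 := Nat.mod_lt _ (by omega)
  rcases Nat.eq_zero_or_pos (c % (D * D + 1)) with h | h
  · exact Or.inl (by rw [h] at hc'; exact hc')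
  · right
    have hD : 0 < D := by
      by_contra h0
      obtain rfl : D = 0 := by omega
      omega
    refine ⟨(c % (D * D + 1) - 1) / D, Nat.div_lt_of_lt_mul (by omega),
      (c % (D * D + 1) - 1) % D, Nat.mod_lt _ hD, ?_⟩
    rw [Nat.div_add_mod', Nat.sub_add_cancel h]
    exact hc'

theorem gridMk_lt {t e : ℕ} (ht : t < K * (K + 1)) (he : e < D * D + 1) :
    gridMk D t e < K * (K + 1) * (D * D + 1) := by
  simpa [gridMk] using mul_add_lt_mul_add (v' := 0) ht he

/-- Separators have the keys below `K * (K + 1)`. Above them, the key is a number with the digits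
`i`, `u`, rank in the strip, `v`, and within the vertical strip `i` the rank determines `j`. -/
theorem gridX_injOn : Set.InjOn (gridX K D) {c | c < K * (K + 1) * (D * D + 1)} := by
  intro c hc c' hc' h
  obtain ⟨i, hi, j, hj, h1⟩ := exists_gridMk hc
  obtain ⟨i', hi', j', hj', h2⟩ := exists_gridMk hc'
  have hb := block_lt hi hj
  have hb' := block_lt hi' hj'
  rcases h1 with rfl | ⟨u, hu, v, hv, rfl⟩ <;> rcases h2 with rfl | ⟨u', hu', v', hv', rfl⟩
  · rw [gridX_sep, gridX_sep] at h
    rw [h]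
  · rw [gridX_sep, gridX_pair hj' hu' hv'] at h
    omega
  · rw [gridX_sep, gridX_pair hj hu hv] at h
    omega
  · rw [gridX_pair hj hu hv, gridX_pair hj' hu' hv'] at h
    obtain ⟨h1, rfl⟩ := eq_and_eq_of_mul_add_eq hv hv' (Nat.add_left_cancel h)
    obtain ⟨h2, h3⟩ := eq_and_eq_of_mul_add_eq (gridSubX_lt hj) (gridSubX_lt hj') h1
    obtain ⟨rfl, rfl⟩ := eq_and_eq_of_mul_add_eq hu hu' h2
    obtain rfl : j = j' := by
      unfold gridSubX at h3
      split_ifs at h3 <;> omega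
    rfl

/-- Here the horizontal strip and the rank in it determine the block: rank `0` belongs to the extra
column, rank `K + 1` to the diagonal, and every other rank is `i + 1`. -/
theorem gridY_injOn : Set.InjOn (gridY K D) {c | c < K * (K + 1) * (D * D + 1)} := by
  intro c hc c' hc' h
  obtain ⟨i, hi, j, hj, h1⟩ := exists_gridMk hc
  obtain ⟨i', hi', j', hj', h2⟩ := exists_gridMk hc'
  have hb := block_lt hi hj
  have hb' := block_lt hi' hj'
  rcases h1 with rfl | ⟨u, hu, v, hv, rfl⟩ <;> rcases h2 with rfl | ⟨u', hu', v', hv', rfl⟩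
  · rw [gridY_sep, gridY_sep] at h
    rw [h]
  · rw [gridY_sep, gridY_pair hj' hu' hv'] at h
    omega
  · rw [gridY_sep, gridY_pair hj hu hv] at h
    omega
  · rw [gridY_pair hj hu hv, gridY_pair hj' hu' hv'] at h
    obtain ⟨h1, rfl⟩ := eq_and_eq_of_mul_add_eq hu hu' (Nat.add_left_cancel h)
    obtain ⟨h2, h3⟩ := eq_and_eq_of_mul_add_eq (gridSubY_lt hi) (gridSubY_lt hi') h1
    obtain ⟨h4, rfl⟩ := eq_and_eq_of_mul_add_eq hv hv' h2
    obtain ⟨rfl, rfl⟩ : i = i' ∧ j = j' := by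
      unfold gridSubY at h3
      unfold gridCol at h4
      split_ifs at h3 h4 <;> omega
    rfl

/-- Inside a block, the first order agrees with the third. -/
theorem gridX_lt_of_lt {c c' : ℕ} (hc : c < K * (K + 1) * (D * D + 1))
    (hc' : c' < K * (K + 1) * (D * D + 1)) (hb : gridBlock D c = gridBlock D c') (h : c < c') :
    gridX K D c < gridX K D c' := by
  obtain ⟨i, hi, j, hj, h1⟩ := exists_gridMk hc
  obtain ⟨i', hi', j', hj', h2⟩ := exists_gridMk hc'
  have hbl := block_lt hi hj
  have hbb : i * (K + 1) + j = i' * (K + 1) + j' := by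
    rcases h1 with rfl | ⟨u, hu, v, hv, rfl⟩ <;> rcases h2 with rfl | ⟨u', hu', v', hv', rfl⟩
    · rwa [gridBlock_mk (by omega), gridBlock_mk (by omega)] at hb
    · rwa [gridBlock_mk (by omega), gridBlock_mk (pair_lt hu' hv')] at hb
    · rwa [gridBlock_mk (pair_lt hu hv), gridBlock_mk (by omega)] at hb
    · rwa [gridBlock_mk (pair_lt hu hv), gridBlock_mk (pair_lt hu' hv')] at hb
  obtain ⟨rfl, rfl⟩ := eq_and_eq_of_mul_add_eq (show j < K + 1 by omega)
    (show j' < K + 1 by omega) hbb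
  rcases h1 with rfl | ⟨u, hu, v, hv, rfl⟩ <;> rcases h2 with rfl | ⟨u', hu', v', hv', rfl⟩
  · omega
  · rw [gridX_sep, gridX_pair hj hu' hv']
    omega
  · simp only [gridMk] at h
    omega
  · rw [gridX_pair hj hu hv, gridX_pair hj hu' hv']
    simp only [gridMk] at h
    rcases lt_or_eq_of_mul_add_lt hv' (show u * D + v < u' * D + v' by omega) with h' | ⟨rfl, h'⟩
    · refine Nat.add_lt_add_left (mul_add_lt_mul_add (mul_add_lt_mul_add ?_ (gridSubX_lt hj)) hv) _
      omega
    · omega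

/-- `φ` preserves the three orders between two grids. -/
structure IsGridEmbedding (K D : ℕ) (R : ℕ → ℕ → ℕ → ℕ → Prop) (φ : ℕ → ℕ) : Prop where
  mem : ∀ c ∈ gridSet K 1 fun _ _ _ _ => True, φ c ∈ gridSet K D R
  x_iff : ∀ c ∈ gridSet K 1 fun _ _ _ _ => True, ∀ c' ∈ gridSet K 1 fun _ _ _ _ => True,
    (gridX K 1 c < gridX K 1 c' ↔ gridX K D (φ c) < gridX K D (φ c'))
  y_iff : ∀ c ∈ gridSet K 1 fun _ _ _ _ => True, ∀ c' ∈ gridSet K 1 fun _ _ _ _ => True,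
    (gridY K 1 c < gridY K 1 c' ↔ gridY K D (φ c) < gridY K D (φ c'))
  z_iff : ∀ c ∈ gridSet K 1 fun _ _ _ _ => True, ∀ c' ∈ gridSet K 1 fun _ _ _ _ => True,
    (c < c' ↔ φ c < φ c')

/-- Over a one-element domain the only pair is `(0, 0)`, which every block admits. So the pattern
has two points per block: `2 * t` is the separator of block `t` and `2 * t + 1` its pair point. -/
theorem gridSet_one : gridSet K 1 (fun _ _ _ _ => True) = Finset.range (K * (K + 1) * 2) := by
  ext c
  simp only [gridSet, mul_one, Nat.reduceAdd, Finset.mem_filter, Finset.mem_range, GridPresent,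
    Nat.div_one, Nat.mod_one, and_iff_left_iff_imp]
  intro _
  have : gridOff 1 c < 2 := Nat.mod_lt _ (by omega)
  right
  split_ifs
  omega

/-! ### Solutions of the constraint problem and grid embeddings -/

variable {R : ℕ → ℕ → ℕ → ℕ → Prop}

/-- Separators go to separators, and the point of block `(i, j)` to the pair formed from the values
of its two strips. Points in a common strip then share the value that the key compares before the
rank, so the ranks decide, exactly as in the pattern. -/
theorem exists_isGridEmbedding {val : ℕ → ℕ} (hval : SolvesCsp K D R val) :
    ∃ φ, IsGridEmbedding K D R φ := by
  classical
  have hcol : ∀ {i j}, i < K → j ≤ K → gridCol K i j < K := fun {i j} hi hj => by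
    unfold gridCol; split_ifs <;> omega
  set φ : ℕ → ℕ := fun c => if c % 2 = 0 then gridMk D (c / 2) 0 else
    gridMk D (c / 2) (val (c / 2 / (K + 1)) * D +
      val (gridCol K (c / 2 / (K + 1)) (c / 2 % (K + 1))) + 1) with hφ
  have φsep : ∀ t, φ (gridMk 1 t 0) = gridMk D t 0 := fun t => by
    have h1 : t * 2 % 2 = 0 := by omega
    have h2 : t * 2 / 2 = t := by omega
    simp [hφ, gridMk]
  have φpt : ∀ i j, j ≤ K → φ (gridMk 1 (i * (K + 1) + j) (0 * 1 + 0 + 1)) =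
      gridMk D (i * (K + 1) + j) (val i * D + val (gridCol K i j) + 1) := fun i j hj => by
    have h1 : gridMk 1 (i * (K + 1) + j) (0 * 1 + 0 + 1) % 2 = 1 := by simp only [gridMk]; omega
    have h2 : gridMk 1 (i * (K + 1) + j) (0 * 1 + 0 + 1) / 2 = i * (K + 1) + j := by
      simp only [gridMk]; omega
    simp only [hφ, h1, h2, block_div hj, block_mod hj]
    simp
  have hdich : ∀ c, c < K * (K + 1) * (1 * 1 + 1) → ∃ i < K, ∃ j ≤ K,
      c = gridMk 1 (i * (K + 1) + j) 0 ∨ c = gridMk 1 (i * (K + 1) + j) (0 * 1 + 0 + 1) := by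
    intro c hc
    obtain ⟨i, hi, j, hj, h⟩ := exists_gridMk hc
    refine ⟨i, hi, j, hj, h.imp_right ?_⟩
    rintro ⟨u, hu, v, hv, h⟩
    obtain rfl : u = 0 := by omega
    obtain rfl : v = 0 := by omega
    exact h
  have hx : ∀ c < K * (K + 1) * (1 * 1 + 1), ∀ c' < K * (K + 1) * (1 * 1 + 1),
      gridX K 1 c < gridX K 1 c' → gridX K D (φ c) < gridX K D (φ c') := by
    intro c hc c' hc' h
    obtain ⟨i, hi, j, hj, h1⟩ := hdich c hc
    obtain ⟨i', hi', j', hj', h2⟩ := hdich c' hc'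
    have hb := block_lt hi hj
    have hb' := block_lt hi' hj'
    rcases h1 with rfl | rfl <;> rcases h2 with rfl | rfl
    · rw [gridX_sep, gridX_sep] at h
      rwa [φsep, φsep, gridX_sep, gridX_sep]
    · rw [φsep, φpt _ _ hj', gridX_sep, gridX_pair hj' (hval.1 _ hi') (hval.1 _ (hcol hi' hj'))]
      omega
    · rw [gridX_sep, gridX_pair (D := 1) (u := 0) (v := 0) hj (by omega) (by omega)] at h
      omega
    · rw [gridX_pair (D := 1) (u := 0) (v := 0) hj (by omega) (by omega),
        gridX_pair (D := 1) (u := 0) (v := 0) hj' (by omega) (by omega)] at h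
      rw [φpt _ _ hj, φpt _ _ hj', gridX_pair hj (hval.1 _ hi) (hval.1 _ (hcol hi hj)),
        gridX_pair hj' (hval.1 _ hi') (hval.1 _ (hcol hi' hj'))]
      refine Nat.add_lt_add_left (mul_add_lt_mul_add ?_ (hval.1 _ (hcol hi hj))) _
      simp only [mul_one, add_zero] at h
      rcases lt_or_eq_of_mul_add_lt (gridSubX_lt hj') (Nat.lt_of_add_lt_add_left h) with
        h' | ⟨rfl, h'⟩
      · exact mul_add_lt_mul_add (mul_add_lt_mul_add h' (hval.1 _ hi)) (gridSubX_lt hj)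
      · omega
  have hy : ∀ c < K * (K + 1) * (1 * 1 + 1), ∀ c' < K * (K + 1) * (1 * 1 + 1),
      gridY K 1 c < gridY K 1 c' → gridY K D (φ c) < gridY K D (φ c') := by
    intro c hc c' hc' h
    obtain ⟨i, hi, j, hj, h1⟩ := hdich c hc
    obtain ⟨i', hi', j', hj', h2⟩ := hdich c' hc'
    have hb := block_lt hi hj
    have hb' := block_lt hi' hj'
    rcases h1 with rfl | rfl <;> rcases h2 with rfl | rfl
    · rw [gridY_sep, gridY_sep] at h
      rwa [φsep, φsep, gridY_sep, gridY_sep]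
    · rw [φsep, φpt _ _ hj', gridY_sep, gridY_pair hj' (hval.1 _ hi') (hval.1 _ (hcol hi' hj'))]
      omega
    · rw [gridY_sep, gridY_pair (D := 1) (u := 0) (v := 0) hj (by omega) (by omega)] at h
      omega
    · rw [gridY_pair (D := 1) (u := 0) (v := 0) hj (by omega) (by omega),
        gridY_pair (D := 1) (u := 0) (v := 0) hj' (by omega) (by omega)] at h
      rw [φpt _ _ hj, φpt _ _ hj', gridY_pair hj (hval.1 _ hi) (hval.1 _ (hcol hi hj)),
        gridY_pair hj' (hval.1 _ hi') (hval.1 _ (hcol hi' hj'))]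
      refine Nat.add_lt_add_left (mul_add_lt_mul_add ?_ (hval.1 _ hi)) _
      simp only [mul_one, add_zero] at h
      rcases lt_or_eq_of_mul_add_lt (gridSubY_lt hi') (Nat.lt_of_add_lt_add_left h) with
        h' | ⟨h', h''⟩
      · exact mul_add_lt_mul_add (mul_add_lt_mul_add h' (hval.1 _ (hcol hi hj))) (gridSubY_lt hi)
      · rw [h']
        omega
  have hz : ∀ c < K * (K + 1) * (1 * 1 + 1), ∀ c' < K * (K + 1) * (1 * 1 + 1),
      c < c' → φ c < φ c' := by
    intro c hc c' hc' h
    obtain ⟨i, hi, j, hj, h1⟩ := hdich c hc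
    obtain ⟨i', hi', j', hj', h2⟩ := hdich c' hc'
    have hp := pair_lt (hval.1 _ hi) (hval.1 _ (hcol hi hj))
    rcases h1 with rfl | rfl <;> rcases h2 with rfl | rfl
    · simp only [gridMk] at h
      rw [φsep, φsep]
      exact mul_add_lt_mul_add (by omega) (by omega)
    · simp only [gridMk] at h
      rw [φsep, φpt _ _ hj']
      rcases lt_or_eq_of_mul_add_lt (by omega) h with h' | ⟨h', -⟩
      · exact mul_add_lt_mul_add h' (by omega)
      · rw [h']
        simp only [gridMk]
        omega
    · simp only [gridMk] at h
      rw [φsep, φpt _ _ hj]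
      exact mul_add_lt_mul_add (by omega) hp
    · simp only [gridMk] at h
      rw [φpt _ _ hj, φpt _ _ hj']
      exact mul_add_lt_mul_add (by omega) hp
  -- For linear orders one implication suffices: the keys of the pattern are injective, so any two
  -- distinct points are strictly comparable and the reverse comparison would be preserved as well.
  have iff_of : ∀ {f g : ℕ → ℕ}, Set.InjOn f {c | c < K * (K + 1) * (1 * 1 + 1)} →
      (∀ c < K * (K + 1) * (1 * 1 + 1), ∀ c' < K * (K + 1) * (1 * 1 + 1),
        f c < f c' → g c < g c') →
      ∀ c < K * (K + 1) * (1 * 1 + 1), ∀ c' < K * (K + 1) * (1 * 1 + 1),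
        (f c < f c' ↔ g c < g c') := by
    intro f g hf hfg c hc c' hc'
    refine ⟨hfg c hc c' hc', fun h => ?_⟩
    rcases lt_trichotomy (f c) (f c') with h' | h' | h'
    · exact h'
    · rw [hf hc hc' h'] at h
      omega
    · have := hfg c' hc' c hc h'
      omega
  have hmem : ∀ c, c ∈ gridSet K 1 (fun _ _ _ _ => True) ↔ c < K * (K + 1) * (1 * 1 + 1) := by
    intro c
    rw [gridSet_one, Finset.mem_range]
  refine ⟨φ, fun c hc => ?_, fun c hc c' hc' => ?_, fun c hc c' hc' => ?_, fun c hc c' hc' => ?_⟩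
  · obtain ⟨i, hi, j, hj, h⟩ := hdich c ((hmem c).1 hc)
    have hb := block_lt hi hj
    rw [gridSet, Finset.mem_filter, Finset.mem_range]
    rcases h with rfl | rfl
    · rw [φsep]
      exact ⟨gridMk_lt hb (by omega), Or.inl (gridOff_mk (by omega))⟩
    · rw [φpt _ _ hj]
      have hp := pair_lt (hval.1 _ hi) (hval.1 _ (hcol hi hj))
      refine ⟨gridMk_lt hb hp, Or.inr ?_⟩
      rw [gridBlock_mk hp, gridOff_mk hp, block_div hj, block_mod hj, pair_div (hval.1 _ (hcol hi hj)),
        pair_mod (hval.1 _ (hcol hi hj))]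
      unfold gridCol
      by_cases h1 : j = K
      · simp [h1]
      by_cases h2 : i = j
      · simp [h2]
      simpa [h1, h2] using hval.2 i hi j (by omega) h2
  · exact iff_of (f := gridX K 1) (g := fun c => gridX K D (φ c)) gridX_injOn hx
      c ((hmem c).1 hc) c' ((hmem c').1 hc')
  · exact iff_of (f := gridY K 1) (g := fun c => gridY K D (φ c)) gridY_injOn hy
      c ((hmem c).1 hc) c' ((hmem c').1 hc')
  · exact iff_of (f := id) (g := φ) (Set.injOn_id _) hz c ((hmem c).1 hc) c' ((hmem c').1 hc')

/-- The separators force every block of the pattern into the same block of the text. The selected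
pairs are then related by a cycle of weak inequalities along the strips, which makes the choices in
each strip equal; the value of variable `i` is read in the diagonal block `(i, i)`. -/
theorem IsGridEmbedding.exists_solvesCsp {φ : ℕ → ℕ} (h : IsGridEmbedding K D R φ) :
    ∃ val, SolvesCsp K D R val := by
  classical
  have hmem : ∀ c < K * (K + 1) * 2, c ∈ gridSet K 1 (fun _ _ _ _ => True) := by
    intro c
    rw [gridSet_one, Finset.mem_range]
    exact id
  have hφ : ∀ c < K * (K + 1) * 2, φ c < K * (K + 1) * (D * D + 1) ∧ GridPresent K D R (φ c) := by
    intro c hc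
    have := h.mem c (hmem c hc)
    rwa [gridSet, Finset.mem_filter, Finset.mem_range] at this
  have hmono : ∀ c c', c < c' → c' < K * (K + 1) * 2 → φ c < φ c' := fun c c' hcc hc' =>
    (h.z_iff c (hmem c (by omega)) c' (hmem c' hc')).1 hcc
  have hbmono : ∀ c c', c ≤ c' → c' < K * (K + 1) * 2 → gridBlock D (φ c) ≤ gridBlock D (φ c') := by
    intro c c' hcc hc'
    rcases hcc.eq_or_lt with rfl | hlt
    · exact le_rfl
    · exact Nat.div_le_div_right (hmono c c' hlt hc').le
  have hX1 : ∀ t, gridX K 1 (t * 2) = t := fun t => gridX_sep (D := 1) t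
  have hX2 : ∀ t < K * (K + 1), K * (K + 1) ≤ gridX K 1 (t * 2 + 1) := by
    intro t ht
    obtain ⟨i, hi, j, hj, rfl⟩ := exists_block ht
    have := gridX_pair (D := 1) (i := i) (u := 0) (v := 0) hj (by omega) (by omega)
    simp only [gridMk] at this
    rw [this]
    omega
  -- If the point of block `t` and the next separator landed in one block, the first order would
  -- agree with the third on them; in the pattern the two orders disagree.
  have hstep : ∀ t, t + 1 < K * (K + 1) →
      gridBlock D (φ (t * 2 + 1)) < gridBlock D (φ ((t + 1) * 2)) := by
    intro t ht
    refine (hbmono (t * 2 + 1) ((t + 1) * 2) (by omega) (by omega)).lt_of_ne fun heq => ?_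
    have h1 := gridX_lt_of_lt (hφ (t * 2 + 1) (by omega)).1 (hφ ((t + 1) * 2) (by omega)).1 heq
      (hmono _ _ (by omega) (by omega))
    rw [← h.x_iff _ (hmem _ (by omega)) _ (hmem _ (by omega)), hX1] at h1
    have := hX2 t (by omega)
    omega
  have hlow : ∀ t < K * (K + 1), t ≤ gridBlock D (φ (t * 2)) := by
    intro t
    induction t with
    | zero => exact fun _ => Nat.zero_le _
    | succ t ih =>
      intro ht
      have := ih (by omega)
      have := hstep t ht
      have := hbmono (t * 2) (t * 2 + 1) (by omega) (by omega)
      omega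
  -- Downward induction from the last block: only `K * (K + 1)` blocks are available, so the
  -- strictly increasing block numbers leave no slack in either direction.
  have hhigh : ∀ r t, t + r + 1 = K * (K + 1) → gridBlock D (φ (t * 2 + 1)) ≤ t := by
    intro r
    induction r with
    | zero =>
      intro t ht
      have := (hφ (t * 2 + 1) (by omega)).1
      have := Nat.div_lt_of_lt_mul (show φ (t * 2 + 1) < (D * D + 1) * (K * (K + 1)) by
        rw [mul_comm (D * D + 1)]; exact this)
      unfold gridBlock
      omega
    | succ r ih =>
      intro t ht
      have := ih (t + 1) (by omega)
      have := hstep t (by omega)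
      have := hbmono ((t + 1) * 2) ((t + 1) * 2 + 1) (by omega) (by omega)
      omega
  -- The image of the point is not the separator of its block, as the image of the pattern's
  -- separator lies strictly below it in the same block.
  have hpt : ∀ i j, i < K → j ≤ K → ∃ u < D, ∃ v < D,
      φ ((i * (K + 1) + j) * 2 + 1) = gridMk D (i * (K + 1) + j) (u * D + v + 1) := by
    intro i j hi hj
    have hb := block_lt hi hj
    set t := i * (K + 1) + j with ht
    have h1 := hlow t hb
    have h2 := hhigh (K * (K + 1) - 1 - t) t (by omega)
    have h3 := hbmono (t * 2) (t * 2 + 1) (by omega) (by omega)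
    have h4 := hmono (t * 2) (t * 2 + 1) (by omega) (by omega)
    obtain ⟨i', hi', j', hj', h5⟩ := exists_gridMk (hφ (t * 2 + 1) (by omega)).1
    rcases h5 with h5 | ⟨u, hu, v, hv, h5⟩
    · have hbt : gridBlock D (φ (t * 2 + 1)) = t := by omega
      rw [h5, gridBlock_mk (by omega)] at hbt
      have hb0 : gridBlock D (φ (t * 2)) = t := by omega
      have h6 := Nat.div_mul_le_self (φ (t * 2)) (D * D + 1)
      rw [gridBlock] at hb0
      rw [hb0] at h6
      rw [h5, hbt, gridMk] at h4
      omega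
    · have hbt : gridBlock D (φ (t * 2 + 1)) = t := by omega
      rw [h5, gridBlock_mk (pair_lt hu hv)] at hbt
      exact ⟨u, hu, v, hv, by rw [h5, hbt]⟩
  choose! U hU V hV hUV using hpt
  have hdiag : ∀ i j, i < K → j ≤ K → (j = K ∨ i = j) → U i j = V i j := by
    intro i j hi hj hij
    have hb := block_lt hi hj
    have := (hφ ((i * (K + 1) + j) * 2 + 1) (by omega)).2
    rw [hUV i j hi hj] at this
    have hp := pair_lt (hU i j hi hj) (hV i j hi hj)
    rcases this with h' | h'
    · rw [gridOff_mk hp] at h'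
      omega
    · rwa [gridBlock_mk hp, gridOff_mk hp, block_div hj, block_mod hj, if_pos hij,
        pair_div (hV i j hi hj), pair_mod (hV i j hi hj)] at h'
  -- In a common strip the key compares `u` before the rank, so a smaller rank in the pattern yields
  -- only `≤` between the values in the text.
  have hX : ∀ i j j', i < K → j ≤ K → j' ≤ K → gridSubX K i j < gridSubX K i j' →
      U i j ≤ U i j' := by
    intro i j j' hi hj hj' hlt
    have hb := block_lt hi hj
    have hb' := block_lt hi hj'
    have h1 := gridX_pair (D := 1) (i := i) (u := 0) (v := 0) hj (by omega) (by omega)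
    have h2 := gridX_pair (D := 1) (i := i) (u := 0) (v := 0) hj' (by omega) (by omega)
    simp only [gridMk] at h1 h2
    have h3 := (h.x_iff ((i * (K + 1) + j) * 2 + 1) (hmem _ (by omega))
      ((i * (K + 1) + j') * 2 + 1) (hmem _ (by omega))).1 (by
        have e : ∀ j, (i * (K + 1) + j) * 2 + 1 = (i * (K + 1) + j) * (1 * 1 + 1) + (0 * 1 + 0 + 1) :=
          fun j => by omega
        rw [e j, e j', h1, h2]
        omega)
    rw [hUV i j hi hj, hUV i j' hi hj', gridX_pair hj (hU i j hi hj) (hV i j hi hj),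
      gridX_pair hj' (hU i j' hi hj') (hV i j' hi hj')] at h3
    by_contra hcon
    have := mul_add_lt_mul_add (D := D) (v' := V i j) (mul_add_lt_mul_add (D := K + 2)
      (v' := gridSubX K i j) (show i * D + U i j' < i * D + U i j by omega) (gridSubX_lt (i := i) hj'))
      (hV i j' hi hj')
    omega
  have hY : ∀ i j i' j', i < K → j ≤ K → i' < K → j' ≤ K → gridCol K i j = gridCol K i' j' →
      gridSubY K i j < gridSubY K i' j' → V i j ≤ V i' j' := by
    intro i j i' j' hi hj hi' hj' hcol hlt
    have hb := block_lt hi hj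
    have hb' := block_lt hi' hj'
    have h1 := gridY_pair (D := 1) (i := i) (u := 0) (v := 0) hj (by omega) (by omega)
    have h2 := gridY_pair (D := 1) (i := i') (u := 0) (v := 0) hj' (by omega) (by omega)
    simp only [gridMk] at h1 h2
    have h3 := (h.y_iff ((i * (K + 1) + j) * 2 + 1) (hmem _ (by omega))
      ((i' * (K + 1) + j') * 2 + 1) (hmem _ (by omega))).1 (by
        have e : ∀ i j, (i * (K + 1) + j) * 2 + 1 =
          (i * (K + 1) + j) * (1 * 1 + 1) + (0 * 1 + 0 + 1) := fun i j => by omega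
        rw [e i j, e i' j', h1, h2, hcol]
        omega)
    rw [hUV i j hi hj, hUV i' j' hi' hj', gridY_pair hj (hU i j hi hj) (hV i j hi hj),
      gridY_pair hj' (hU i' j' hi' hj') (hV i' j' hi' hj'), hcol] at h3
    by_contra hcon
    have := mul_add_lt_mul_add (D := D) (v' := U i j) (mul_add_lt_mul_add (D := K + 2)
      (v' := gridSubY K i j) (show gridCol K i' j' * D + V i' j' < gridCol K i' j' * D + V i j by
        omega) (gridSubY_lt (j := j') hi')) (hU i' j' hi' hj')
    omega
  refine ⟨fun i => U i i, fun i hi => hU i i hi hi.le, fun i hi j hj hij => ?_⟩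
  have sX0 : ∀ i < K, gridSubX K i i = 0 := fun i hi => by simp [gridSubX, hi.ne]
  have sX1 : ∀ i, gridSubX K i K = K + 1 := fun i => by simp [gridSubX]
  have sY0 : ∀ i, gridSubY K i K = 0 := fun i => by simp [gridSubY]
  have sY1 : ∀ i < K, gridSubY K i i = K + 1 := fun i hi => by simp [gridSubY, hi.ne]
  have sX : gridSubX K i j = j + 1 := by simp [gridSubX, hij, hj.ne]
  have sY : gridSubY K i j = i + 1 := by simp [gridSubY, hij, hj.ne]
  have c0 : ∀ i, gridCol K i K = i := fun i => by simp [gridCol]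
  have c1 : ∀ i j, j < K → gridCol K i j = j := fun i j hj => by simp [gridCol, hj.ne]
  -- The cycle is `U i i ≤ U i j ≤ U i K = V i K ≤ V i i = U i i`.
  have hUij : U i j = U i i := by
    have h1 := hX i i j hi hi.le hj.le (by rw [sX0 i hi, sX]; omega)
    have h2 := hX i j K hi hj.le le_rfl (by rw [sX1, sX]; omega)
    have h3 := hY i K i i hi le_rfl hi hi.le (by rw [c0, c1 i i hi]) (by rw [sY0, sY1 i hi]; omega)
    have h4 := hdiag i i hi hi.le (Or.inr rfl)
    have h5 := hdiag i K hi le_rfl (Or.inl rfl)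
    omega
  -- The cycle is `V j K ≤ V i j ≤ V j j = U j j ≤ U j K = V j K`.
  have hVij : V i j = U j j := by
    have h1 := hY j K i j hj le_rfl hi hj.le (by rw [c0, c1 i j hj]) (by rw [sY0, sY]; omega)
    have h2 := hY i j j j hi hj.le hj hj.le (by rw [c1 i j hj, c1 j j hj])
      (by rw [sY1 j hj, sY]; omega)
    have h3 := hX j j K hj hj.le le_rfl (by rw [sX0 j hj, sX1]; omega)
    have h4 := hdiag j j hj hj.le (Or.inr rfl)
    have h5 := hdiag j K hj le_rfl (Or.inl rfl)
    omega
  have hb := block_lt hi hj.le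
  have := (hφ ((i * (K + 1) + j) * 2 + 1) (by omega)).2
  rw [hUV i j hi hj.le] at this
  have hp := pair_lt (hU i j hi hj.le) (hV i j hi hj.le)
  rcases this with h' | h'
  · rw [gridOff_mk hp] at h'
    omega
  · rwa [gridBlock_mk hp, gridOff_mk hp, block_div hj.le, block_mod hj.le, if_neg (by omega),
      pair_div (hV i j hi hj.le), pair_mod (hV i j hi hj.le), hUij, hVij] at h'

end Grid

/-! ### Permutations from point sets with three orders -/

/-- The rank of `c` in `C` by the key `f`, starting with `1`. -/
def keyRank (C : Finset ℕ) (f : ℕ → ℕ) (c : ℕ) : ℕ := (C.filter fun c' => f c' ≤ f c).card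

section Rank

variable {C : Finset ℕ} {f : ℕ → ℕ}

theorem keyRank_lt_iff {c c' : ℕ} (hc' : c' ∈ C) :
    keyRank C f c < keyRank C f c' ↔ f c < f c' := by
  constructor
  · intro h
    by_contra hcon
    refine absurd h (not_lt.2 (Finset.card_le_card fun x hx => ?_))
    simp only [Finset.mem_filter] at hx ⊢
    exact ⟨hx.1, by omega⟩
  · intro h
    refine Finset.card_lt_card ⟨fun x hx => ?_, fun hsub => ?_⟩
    · simp only [Finset.mem_filter] at hx ⊢
      exact ⟨hx.1, by omega⟩
    · have := hsub (Finset.mem_filter.2 ⟨hc', le_rfl⟩)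
      simp only [Finset.mem_filter] at this
      omega

theorem keyRank_injOn (hf : Set.InjOn f C) : Set.InjOn (keyRank C f) C := by
  intro c hc c' hc' h
  have h1 := keyRank_lt_iff (f := f) (c := c) hc'
  have h2 := keyRank_lt_iff (f := f) (c := c') hc
  exact hf hc hc' (by omega)

theorem keyRank_mem {c : ℕ} (hc : c ∈ C) : keyRank C f c ∈ Finset.Icc 1 C.card := by
  rw [Finset.mem_Icc]
  exact ⟨Finset.card_pos.2 ⟨c, Finset.mem_filter.2 ⟨hc, le_rfl⟩⟩, Finset.card_filter_le _ _⟩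

/-- The ranks are distinct and lie in a set with as many elements as `C`, so every rank occurs. -/
theorem exists_keyRank_eq (hf : Set.InjOn f C) {s : ℕ} (hs : s ∈ Finset.Icc 1 C.card) :
    ∃ c ∈ C, keyRank C f c = s := by
  have : C.image (keyRank C f) = Finset.Icc 1 C.card := by
    refine Finset.eq_of_subset_of_card_le (fun x hx => ?_) ?_
    · obtain ⟨c, hc, rfl⟩ := Finset.mem_image.1 hx
      exact keyRank_mem hc
    · rw [Finset.card_image_of_injOn (keyRank_injOn hf)]
      simp
  rw [← this] at hs
  simpa using hs

end Rank

/-- The keys of the three orders. -/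
def keyOf (f g : ℕ → ℕ) (a : ℕ) : ℕ → ℕ := if a = 0 then f else if a = 1 then g else id

/-- The coordinate `a` of the point with label `s`. -/
def keyPoint (C : Finset ℕ) (f g : ℕ → ℕ) (s a : ℕ) : ℕ :=
  ∑ c ∈ C, if keyRank C id c = s then keyRank C (keyOf f g a) c else 0

section KeyPerm

variable {C : Finset ℕ} {f g : ℕ → ℕ} {d : ℕ}

theorem keyPoint_keyRank {c a : ℕ} (hc : c ∈ C) :
    keyPoint C f g (keyRank C id c) a = keyRank C (keyOf f g a) c := by
  rw [keyPoint, Finset.sum_eq_single_of_mem c hc]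
  · simp
  · intro c' hc' hne
    rw [if_neg]
    exact fun h => hne (keyRank_injOn (Set.injOn_id _) hc' hc h)

theorem keyOf_injOn (hf : Set.InjOn f C) (hg : Set.InjOn g C) (a : ℕ) :
    Set.InjOn (keyOf f g a) C := by
  unfold keyOf
  split_ifs
  exacts [hf, hg, Set.injOn_id _]

theorem keyPoint_injOn (hf : Set.InjOn f C) (hg : Set.InjOn g C) (a : ℕ) :
    Set.InjOn (fun s => keyPoint C f g s a) (Finset.Icc 1 C.card) := by
  intro s hs s' hs' h
  obtain ⟨c, hc, rfl⟩ := exists_keyRank_eq (f := id) (Set.injOn_id _) hs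
  obtain ⟨c', hc', rfl⟩ := exists_keyRank_eq (f := id) (Set.injOn_id _) hs'
  simp only [keyPoint_keyRank hc, keyPoint_keyRank hc'] at h
  rw [keyRank_injOn (keyOf_injOn hf hg a) hc hc' h]

/-- The `d`-dimensional permutation whose points are the members of `C`, ordered by `f`, by `g`, and
by their values in all other coordinates. -/
def keyPerm (d : ℕ) [NeZero d] (C : Finset ℕ) (f g : ℕ → ℕ) (hf : Set.InjOn f C)
    (hg : Set.InjOn g C) : DimPerm d where
  S := Finset.Icc 1 C.card
  P := fun s a => keyPoint C f g s a
  injOn := fun _ hs _ hs' h => keyPoint_injOn hf hg _ hs hs' (congrFun h (0 : Fin d))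
  general := by
    rintro a _ ⟨s, hs, rfl⟩ _ ⟨s', hs', rfl⟩ h
    rw [keyPoint_injOn hf hg a hs hs' h]

variable [NeZero d] {hf : Set.InjOn f C} {hg : Set.InjOn g C}

theorem keyPerm_length : (keyPerm d C f g hf hg).length = C.card := by
  simp [DimPerm.length, keyPerm]

theorem keyPerm_isReduced : (keyPerm d C f g hf hg).IsReduced := by
  refine ⟨by rw [keyPerm_length]; rfl, fun s hs a => ?_⟩
  obtain ⟨c, hc, rfl⟩ := exists_keyRank_eq (f := id) (Set.injOn_id _) hs
  rw [keyPerm_length]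
  simp only [keyPerm, keyPoint_keyRank hc]
  exact keyRank_mem hc

/-- Labels and members of the sets correspond through the rank in the natural order, and ranks
preserve each key order. Coordinates from the third on all carry the natural order, so `d ≥ 3`
coordinates say no more and no less than three orders. -/
theorem exists_isEmbedding_keyPerm_iff (hd : 3 ≤ d) {C' : Finset ℕ} {f' g' : ℕ → ℕ}
    {hf' : Set.InjOn f' C'} {hg' : Set.InjOn g' C'} :
    (∃ φ, DimPerm.IsEmbedding (keyPerm d C f g hf hg) (keyPerm d C' f' g' hf' hg') φ) ↔
      ∃ φ : ℕ → ℕ, (∀ c ∈ C, φ c ∈ C') ∧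
        (∀ c ∈ C, ∀ c' ∈ C, (f c < f c' ↔ f' (φ c) < f' (φ c'))) ∧
        (∀ c ∈ C, ∀ c' ∈ C, (g c < g c' ↔ g' (φ c) < g' (φ c'))) ∧
        ∀ c ∈ C, ∀ c' ∈ C, (c < c' ↔ φ c < φ c') := by
  constructor
  · rintro ⟨ψ, hψ⟩
    have : ∀ c, ∃ c', ∀ hc : c ∈ C, c' ∈ C' ∧
        keyRank C' id c' = ψ ⟨keyRank C id c, keyRank_mem hc⟩ := by
      intro c
      by_cases hc : c ∈ C
      · obtain ⟨c', hc', h⟩ := exists_keyRank_eq (f := id) (Set.injOn_id _)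
          (ψ ⟨keyRank C id c, keyRank_mem hc⟩).2
        exact ⟨c', fun _ => ⟨hc', h⟩⟩
      · exact ⟨0, fun h => absurd h hc⟩
    choose φ hφ using this
    have key : ∀ a : Fin d, ∀ c ∈ C, ∀ c' ∈ C, (keyOf f g a c < keyOf f g a c' ↔
        keyOf f' g' a (φ c) < keyOf f' g' a (φ c')) := by
      intro a c hc c' hc'
      have h := hψ ⟨keyRank C id c, keyRank_mem hc⟩ ⟨keyRank C id c', keyRank_mem hc'⟩ a
      rw [← keyRank_lt_iff hc', ← keyRank_lt_iff (hφ c' hc').1, ← keyPoint_keyRank hc,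
        ← keyPoint_keyRank hc', ← keyPoint_keyRank (hφ c hc).1, ← keyPoint_keyRank (hφ c' hc').1,
        (hφ c hc).2, (hφ c' hc').2]
      exact h
    exact ⟨φ, fun c hc => (hφ c hc).1, key ⟨0, by omega⟩, key ⟨1, by omega⟩, key ⟨2, by omega⟩⟩
  · rintro ⟨φ, hm, hx, hy, hz⟩
    choose γ hγ hγ' using fun s : (keyPerm d C f g hf hg).S =>
      exists_keyRank_eq (f := id) (C := C) (Set.injOn_id _) s.2
    refine ⟨fun s => ⟨keyRank C' id (φ (γ s)), keyRank_mem (hm _ (hγ s))⟩, fun s s' a => ?_⟩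
    have h1 : ∀ s : (keyPerm d C f g hf hg).S, (keyPerm d C f g hf hg).P s a =
        keyRank C (keyOf f g a) (γ s) := fun s => by
      rw [← keyPoint_keyRank (hγ s), hγ' s]
      rfl
    rw [h1 s, h1 s', keyRank_lt_iff (hγ s')]
    have h2 : ∀ s : (keyPerm d C f g hf hg).S, (keyPerm d C' f' g' hf' hg').P
        (keyRank C' id (φ (γ s))) a = keyRank C' (keyOf f' g' a) (φ (γ s)) := fun s => by
      rw [← keyPoint_keyRank (hm _ (hγ s))]
      rfl
    simp only [h2]
    rw [keyRank_lt_iff (hm _ (hγ s'))]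
    unfold keyOf
    split_ifs
    exacts [hx _ (hγ s) _ (hγ s'), hy _ (hγ s) _ (hγ s'), hz _ (hγ s) _ (hγ s')]

end KeyPerm

/-! ### Encodings -/

theorem encodeNats_nil : encodeNats [] = [] := rfl

theorem encodeNats_cons (m : ℕ) (l : List ℕ) :
    encodeNats (m :: l) = List.replicate m true ++ false :: encodeNats l := by
  simp [encodeNats]

theorem encodeNats_append (l l' : List ℕ) :
    encodeNats (l ++ l') = encodeNats l ++ encodeNats l' := by
  simp [encodeNats]

theorem encodeNats_concat (l : List ℕ) (m : ℕ) :
    encodeNats (l ++ [m]) = encodeNats l ++ (List.replicate m true ++ [false]) := by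
  rw [encodeNats_append, encodeNats_cons, encodeNats_nil]

theorem encodeNats_injective : Function.Injective encodeNats := by
  have key : ∀ (m m' : ℕ) (r r' : List Bool),
      List.replicate m true ++ false :: r = List.replicate m' true ++ false :: r' →
        m = m' ∧ r = r' := by
    intro m
    induction m with
    | zero =>
      intro m' r r' h
      rcases m' with _ | m'
      · simpa using h
      · simp [List.replicate_succ] at h
    | succ m ih =>
      intro m' r r' h
      rcases m' with _ | m'
      · simp [List.replicate_succ] at h
      · simp only [List.replicate_succ, List.cons_append, List.cons.injEq, true_and] at h
        obtain ⟨rfl, rfl⟩ := ih m' r r' h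
        exact ⟨rfl, rfl⟩
  intro l
  induction l with
  | nil =>
    intro l' h
    rcases l' with _ | ⟨m', l'⟩
    · rfl
    · rw [encodeNats_cons, encodeNats_nil] at h
      simp at h
  | cons m l ih =>
    intro l' h
    rcases l' with _ | ⟨m', l'⟩
    · rw [encodeNats_cons, encodeNats_nil] at h
      simp at h
    · rw [encodeNats_cons, encodeNats_cons] at h
      obtain ⟨rfl, h'⟩ := key _ _ _ _ h
      rw [ih h']

theorem count_false_encodeNats (l : List ℕ) : (encodeNats l).count false = l.length := by
  induction l with
  | nil => rfl
  | cons m l ih => simp [encodeNats_cons, ih, List.count_replicate]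

/-- The position of the zero that ends the number `i` of the sequence `g`. -/
def endPos (g : ℕ → ℕ) (i : ℕ) : ℕ := ∑ j ∈ Finset.range (i + 1), g j + i

theorem length_encodeNats_map_range (g : ℕ → ℕ) (n : ℕ) :
    (encodeNats ((List.range n).map g)).length = ∑ j ∈ Finset.range n, g j + n := by
  induction n with
  | zero => rfl
  | succ n ih =>
    rw [List.range_succ, List.map_append, List.map_singleton, encodeNats_concat,
      List.length_append, ih, Finset.sum_range_succ]
    simp
    omega

/-- The only zeros of the word are the terminators of the numbers, so the whole word can be written
once the positions of the terminators are known. -/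
theorem getD_encodeNats_map_range (g : ℕ → ℕ) (n : ℕ) : ∀ x < (encodeNats ((List.range n).map
    g)).length, ((encodeNats ((List.range n).map g)).getD x false = false ↔
      ∃ i < n, x = endPos g i) := by
  induction n with
  | zero => intro x hx; simp [encodeNats_nil] at hx
  | succ n ih =>
    intro x hx
    rw [length_encodeNats_map_range, Finset.sum_range_succ] at hx
    have hlen := length_encodeNats_map_range g n
    rw [List.range_succ, List.map_append, List.map_singleton, encodeNats_concat]
    rcases lt_or_ge x (encodeNats ((List.range n).map g)).length with h | h
    · rw [List.getD_append _ _ _ _ h, ih x h]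
      refine ⟨fun ⟨i, hi, hi'⟩ => ⟨i, by omega, hi'⟩, fun ⟨i, hi, hi'⟩ => ?_⟩
      rcases eq_or_ne i n with rfl | hne
      · rw [hlen] at h
        rw [endPos, Finset.sum_range_succ] at hi'
        omega
      · exact ⟨i, by omega, hi'⟩
    · rw [List.getD_append_right _ _ _ _ h]
      rcases lt_or_ge x (∑ j ∈ Finset.range n, g j + g n + n) with h' | h'
      · have h1 : x - (encodeNats ((List.range n).map g)).length < (List.replicate (g n) true).length := by
          rw [List.length_replicate]
          omega
        rw [List.getD_append _ _ _ _ h1, List.getD_eq_getElem _ _ h1, List.getElem_replicate]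
        simp only [Bool.true_eq_false, false_iff, not_exists, not_and]
        intro i hi hx'
        rw [endPos] at hx'
        rcases eq_or_ne i n with rfl | hne
        · rw [Finset.sum_range_succ] at hx'
          omega
        · have := Finset.sum_le_sum_of_subset (f := g)
            (Finset.range_subset_range.2 (show i + 1 ≤ n by omega))
          omega
      · have hx' : x = endPos g n := by
          rw [endPos, Finset.sum_range_succ]
          omega
        have h1 : (List.replicate (g n) true).length ≤
            x - (encodeNats ((List.range n).map g)).length := by
          rw [List.length_replicate]
          omega
        rw [List.getD_append_right _ _ _ _ h1]
        have h2 : x - (encodeNats ((List.range n).map g)).length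
            - (List.replicate (g n) true).length = 0 := by
          rw [List.length_replicate]
          omega
        rw [h2]
        simp only [List.getD_cons_zero, true_iff]
        exact ⟨n, by omega, hx'⟩

/-- The number of zero cells before cell `j`. -/
def zerosBefore (a : ℕ → ℕ) (j : ℕ) : ℕ := ∑ i ∈ Finset.range j, if a i ≠ 0 then 0 else 1

/-- The number of nonzero cells, among the first `n`, that have `i` zero cells before them. -/
def decodeNat (a : ℕ → ℕ) (n i : ℕ) : ℕ :=
  ∑ j ∈ Finset.range n, if a j ≠ 0 then (if zerosBefore a j = i then 1 else 0) else 0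

/-- A one belongs to the number whose index is the count of zeros before it. Hence decoding needs
only prefix sums, which suits tabulation. -/
theorem decode_encodeNats (a : ℕ → ℕ) (l : List ℕ)
    (ha : ∀ j < (encodeNats l).length, a j = ((encodeNats l).getD j false).toNat) :
    zerosBefore a (encodeNats l).length = l.length ∧
      ∀ i, decodeNat a (encodeNats l).length i = l.getD i 0 := by
  induction l using List.reverseRecOn with
  | nil => simp [encodeNats_nil, zerosBefore, decodeNat]
  | append_singleton l m ih =>
    have hlen : (encodeNats (l ++ [m])).length = (encodeNats l).length + (m + 1) := by
      rw [encodeNats_concat]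
      simp
    obtain ⟨h1, h2⟩ := ih fun j hj => by
      rw [ha j (by omega), encodeNats_concat, List.getD_append _ _ _ _ hj]
    set n := (encodeNats l).length with hn
    have hone : ∀ r < m, a (n + r) ≠ 0 := by
      intro r hr
      rw [ha _ (by omega), encodeNats_concat, List.getD_append_right _ _ _ _ (by omega),
        List.getD_append _ _ _ _ (by simp; omega), ← hn, Nat.add_sub_cancel_left,
        List.getD_eq_getElem _ _ (by simpa using hr), List.getElem_replicate]
      simp
    have hzero : a (n + m) = 0 := by
      rw [ha _ (by omega), encodeNats_concat, List.getD_append_right _ _ _ _ (by omega),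
        List.getD_append_right _ _ _ _ (by simp; omega), ← hn]
      simp
    have hz : ∀ r ≤ m, zerosBefore a (n + r) = l.length := by
      intro r hr
      rw [zerosBefore, Finset.sum_range_add, ← zerosBefore, h1, Finset.sum_eq_zero, add_zero]
      intro i hi
      rw [if_pos (hone i (by rw [Finset.mem_range] at hi; omega))]
    rw [hlen]
    constructor
    · rw [← add_assoc, zerosBefore, Finset.sum_range_succ, ← zerosBefore, hz m le_rfl, hzero]
      simp
    · intro i
      rw [← add_assoc, decodeNat, Finset.sum_range_succ, Finset.sum_range_add, ← decodeNat, h2,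
        hzero]
      have : ∑ r ∈ Finset.range m, (if a (n + r) ≠ 0 then
          if zerosBefore a (n + r) = i then 1 else 0 else 0) = if i = l.length then m else 0 := by
        rw [Finset.sum_congr rfl (g := fun _ => if i = l.length then 1 else 0)]
        · split_ifs <;> simp
        · intro r hr
          rw [Finset.mem_range] at hr
          rw [if_pos (hone r hr), hz r hr.le]
          simp only [eq_comm]
      rw [this]
      simp only [ne_eq, not_true_eq_false, ite_false, add_zero]
      rcases lt_trichotomy i l.length with h | h | h
      · rw [if_neg h.ne, List.getD_append _ _ _ _ h, add_zero]
      · subst h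
        rw [if_pos rfl, List.getD_append_right _ _ _ _ le_rfl]
        simp
      · rw [if_neg h.ne', List.getD_append_right _ _ _ _ h.le]
        rw [List.getD_eq_default _ _ h.le, List.getD_eq_default _ _ (by simp; omega)]

/-- Any word is an encoding followed by an incomplete block of ones; a final zero, or emptiness,
excludes that block. -/
theorem exists_eq_encodeNats (w : List Bool) (hw : w = [] ∨ w.getD (w.length - 1) false = false) :
    ∃ l, w = encodeNats l := by
  have key : ∀ w : List Bool, ∃ l m, w = encodeNats l ++ List.replicate m true := by
    intro w
    induction w using List.reverseRecOn with
    | nil => exact ⟨[], 0, rfl⟩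
    | append_singleton w b ih =>
      obtain ⟨l, m, rfl⟩ := ih
      cases b with
      | true => exact ⟨l, m + 1, by rw [List.append_assoc, List.replicate_succ']⟩
      | false => exact ⟨l ++ [m], 0, by rw [encodeNats_concat]; simp⟩
  obtain ⟨l, m, rfl⟩ := key w
  rcases m with _ | m
  · exact ⟨l, by simp⟩
  · exfalso
    rcases hw with h | h
    · simp at h
    · rw [List.getD_append_right _ _ _ _ (by simp),
        List.getD_eq_getElem _ _ (by simp), List.getElem_replicate] at h
      simp at h

theorem getD_encodeNats_last (l : List ℕ) :
    encodeNats l = [] ∨ (encodeNats l).getD ((encodeNats l).length - 1) false = false := by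
  induction l using List.reverseRecOn with
  | nil => exact Or.inl rfl
  | append_singleton l m _ =>
    right
    rw [encodeNats_concat, ← List.append_assoc, List.getD_append_right _ _ _ _ (by simp)]
    simp

/-! ### Membership of the instances built here -/

namespace DimPerm

variable {d : ℕ}

theorem getElem_flatMap_ofFn (P : ℕ → Fin d → ℕ) (n i : ℕ) (hi : i < n) (a : Fin d) :
    ((List.range n).flatMap fun i => List.ofFn (P (i + 1)))[i * d + a]? = some (P (i + 1) a) := by
  induction n with
  | zero => omega
  | succ n ih =>
    have hlen : ((List.range n).flatMap fun i => List.ofFn (P (i + 1))).length = n * d := by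
      simp [List.length_flatMap]
    rw [List.range_succ, List.flatMap_append, List.flatMap_singleton]
    rcases Nat.lt_succ_iff_lt_or_eq.1 hi with h | rfl
    · rw [List.getElem?_append_left, ih h]
      rw [hlen]
      simpa using mul_add_lt_mul_add (v' := 0) h a.2
    · rw [List.getElem?_append_right (by rw [hlen]; omega), hlen, Nat.add_sub_cancel_left]
      simp

theorem length_flatMap_ofFn (P : ℕ → Fin d → ℕ) (n : ℕ) :
    ((List.range n).flatMap fun i => List.ofFn (P (i + 1))).length = n * d := by
  simp [List.length_flatMap]

/-- The leading length makes the sequence self-delimiting, so both permutations can be recovered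
from a concatenation. Values of `P` outside `S` are not recovered, nor needed. -/
theorem eq_of_toNats_append_eq {σ σ' : DimPerm d} (hσ : σ.IsReduced) (hσ' : σ'.IsReduced)
    {r r' : List ℕ} (h : σ.toNats ++ r = σ'.toNats ++ r') :
    σ.S = σ'.S ∧ (∀ s ∈ σ.S, σ.P s = σ'.P s) ∧ r = r' := by
  simp only [toNats, List.cons_append, List.cons.injEq] at h
  obtain ⟨hl, h⟩ := h
  rw [← hl] at h
  obtain ⟨h1, h2⟩ := List.append_inj h (by rw [length_flatMap_ofFn, length_flatMap_ofFn])
  refine ⟨by rw [hσ.1, hσ'.1, hl], fun s hs => ?_, h2⟩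
  rw [hσ.1, Finset.mem_Icc] at hs
  obtain ⟨i, rfl⟩ : ∃ i, s = i + 1 := ⟨s - 1, by omega⟩
  funext a
  have e1 := getElem_flatMap_ofFn σ.P σ.length i (by omega) a
  have e2 := getElem_flatMap_ofFn σ'.P σ.length i (by omega) a
  rw [h1, e2] at e1
  exact (Option.some.inj e1).symm

theorem mem_dimPermPattern_iff {σ π : DimPerm d} (hσ : σ.IsReduced) (hπ : π.IsReduced) :
    (encodeNats (σ.toNats ++ π.toNats), σ.length) ∈ DimPermPattern d ↔
      ∃ φ, IsEmbedding σ π φ := by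
  constructor
  · rintro ⟨σ', π', hσ', hπ', hI, φ, hφ⟩
    have h := encodeNats_injective (Prod.mk.inj hI).1
    obtain ⟨hS, hP, h'⟩ := eq_of_toNats_append_eq hσ hσ' h
    obtain ⟨hS', hP', -⟩ := eq_of_toNats_append_eq (r := []) (r' := []) hπ hπ' (by rw [h'])
    have hm : ∀ s : σ.S, s.1 ∈ σ'.S := fun s => by rw [← hS]; exact s.2
    have hm' : ∀ s : π'.S, s.1 ∈ π.S := fun s => by rw [hS']; exact s.2
    refine ⟨fun s => ⟨φ ⟨s, hm s⟩, hm' _⟩, fun p p' a => ?_⟩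
    rw [hP _ p.2, hP _ p'.2, hP' _ (hm' (φ ⟨p, hm p⟩)), hP' _ (hm' (φ ⟨p', hm p'⟩))]
    exact hφ ⟨p, hm p⟩ ⟨p', hm p'⟩ a
  · rintro ⟨φ, hφ⟩
    exact ⟨σ, π, hσ, hπ, rfl, φ, hφ⟩

end DimPerm

/-- The empty word serves as the no-instance that is output for invalid input. -/
theorem nil_notMem_dimPermPattern (d k : ℕ) : ([], k) ∉ DimPermPattern d := by
  rintro ⟨σ, π, -, -, hI, -⟩
  have := (Prod.mk.inj hI).1
  rw [DimPerm.toNats, List.cons_append, encodeNats_cons] at this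
  simp at this

/-- The numbers of the encoding of `keyPerm`. -/
def keyNats (d : ℕ) (C : Finset ℕ) (f g : ℕ → ℕ) (x : ℕ) : ℕ :=
  if x = 0 then C.card else keyPoint C f g ((x - 1) / d + 1) ((x - 1) % d)

theorem keyPerm_toNats {d : ℕ} [NeZero d] {C : Finset ℕ} {f g : ℕ → ℕ} {hf : Set.InjOn f C}
    {hg : Set.InjOn g C} : (keyPerm d C f g hf hg).toNats =
      (List.range (1 + C.card * d)).map (keyNats d C f g) := by
  have hd : 0 < d := Nat.pos_of_ne_zero (NeZero.ne d)
  rw [DimPerm.toNats, keyPerm_length, add_comm, List.range_succ_eq_map, List.map_cons, List.map_map]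
  congr 1
  refine List.ext_getElem (by rw [DimPerm.length_flatMap_ofFn]; simp) fun x h1 h2 => ?_
  simp only [List.length_map, List.length_range] at h2
  have hx : x / d < C.card := Nat.div_lt_of_lt_mul (by rwa [mul_comm])
  have := DimPerm.getElem_flatMap_ofFn (keyPerm d C f g hf hg).P C.card (x / d) hx
    ⟨x % d, Nat.mod_lt _ hd⟩
  rw [Nat.div_add_mod', List.getElem?_eq_getElem h1] at this
  rw [Option.some.inj this]
  simp [keyNats, keyPerm]

theorem map_range_append (f g : ℕ → ℕ) (n m : ℕ) :
    (List.range n).map f ++ (List.range m).map g =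
      (List.range (n + m)).map fun x => if x < n then f x else g (x - n) := by
  refine List.ext_getElem (by simp) fun x h1 h2 => ?_
  simp only [List.length_map, List.length_range] at h2
  rw [List.getElem_map, List.getElem_range]
  rcases lt_or_ge x n with h | h
  · rw [List.getElem_append_left (by simpa using h)]
    simp [h]
  · rw [List.getElem_append_right (by simpa using h)]
    simp [not_lt.2 h]

/-! ### Decoding of formulas -/

namespace CnfFormula

/-- The numbers of the encoding of a formula. -/
def nats (F : CnfFormula) : List ℕ :=
  F.flatMap fun C => C.length :: C.flatMap fun l => [l.1, l.2.toNat]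

theorem encode_eq (F : CnfFormula) : F.encode = encodeNats F.nats := rfl

theorem nats_cons (C : List Lit) (F : CnfFormula) :
    nats (C :: F) = (C.length :: C.flatMap fun l => [l.1, l.2.toNat]) ++ nats F := rfl

theorem nats_append (F G : CnfFormula) : nats (F ++ G) = nats F ++ nats G := by
  simp [nats]

theorem length_lits (C : List Lit) :
    (C.flatMap fun l => [l.1, l.2.toNat]).length = 2 * C.length := by
  induction C with
  | nil => rfl
  | cons l C ih => simp [ih]; omega

end CnfFormula

/-- The index at which clause `c` starts in the sequence `N` of length `n`. -/
def clauseStart (N : ℕ → ℕ) (n : ℕ) : ℕ → ℕ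
  | 0 => 0
  | c + 1 => if clauseStart N n c < n then clauseStart N n c + 1 + 2 * N (clauseStart N n c)
      else clauseStart N n c

/-- The number of clauses. -/
def clauseCount (N : ℕ → ℕ) (n b : ℕ) : ℕ :=
  ∑ c ∈ Finset.range b, if clauseStart N n c < n then 1 else 0

/-- The clause that starts at `p`. -/
def decodeClause (N : ℕ → ℕ) (p : ℕ) : List Lit :=
  (List.range (N p)).map fun r => (N (p + 1 + 2 * r), decide (N (p + 2 + 2 * r) ≠ 0))

/-- The formula with `m` clauses that is encoded by the sequence `N` of length `n`. -/
def decodeCnf (N : ℕ → ℕ) (n m : ℕ) : CnfFormula :=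
  (List.range m).map fun c => decodeClause N (clauseStart N n c)

/-- The sequence is the encoding of a formula with at most `q` literals per clause. -/
def IsValidCnf (q : ℕ) (N : ℕ → ℕ) (n m : ℕ) : Prop :=
  clauseStart N n m = n ∧ ∀ c < m, N (clauseStart N n c) ≤ q ∧
    ∀ r < N (clauseStart N n c), N (clauseStart N n c + 2 + 2 * r) ≤ 1

section Decode

variable {N : ℕ → ℕ} {n : ℕ}

theorem clauseStart_le_succ (c : ℕ) : clauseStart N n c ≤ clauseStart N n (c + 1) := by
  rw [clauseStart]
  split_ifs <;> omega

theorem clauseStart_mono : Monotone (clauseStart N n) :=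
  monotone_nat_of_le_succ clauseStart_le_succ

theorem le_clauseStart {c : ℕ} (h' : ∀ c' < c, clauseStart N n c' < n) :
    c ≤ clauseStart N n c := by
  induction c with
  | zero => exact Nat.zero_le _
  | succ c ih =>
    have := ih fun c' hc' => h' c' (by omega)
    rw [clauseStart, if_pos (h' c (by omega))]
    omega

/-- Clause starts are monotone, so those before the end form an initial segment and counting them
finds the number of clauses. -/
theorem clauseCount_eq {m b : ℕ} (hmb : m ≤ b) (h : ∀ c < m, clauseStart N n c < n)
    (hm : n ≤ clauseStart N n m) : clauseCount N n b = m := by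
  obtain ⟨r, rfl⟩ := Nat.exists_eq_add_of_le hmb
  rw [clauseCount, Finset.sum_range_add, Finset.sum_congr rfl (g := fun _ => 1),
    Finset.sum_eq_zero (s := Finset.range r)]
  · simp
  · intro c _
    rw [if_neg]
    exact not_lt.2 (hm.trans (clauseStart_mono (by omega)))
  · intro c hc
    rw [if_pos (h c (Finset.mem_range.1 hc))]

/-- The clauses that start before the end are the first ones. -/
theorem clauseCount_spec {b : ℕ} (hb : n ≤ b) : clauseCount N n b ≤ b ∧
    (∀ c < clauseCount N n b, clauseStart N n c < n) ∧
      n ≤ clauseStart N n (clauseCount N n b) := by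
  have hex : ∃ c, n ≤ clauseStart N n c := by
    by_contra hcon
    push Not at hcon
    have := le_clauseStart (c := n) fun c' _ => hcon c'
    have := hcon n
    omega
  have hmin : ∀ c < Nat.find hex, clauseStart N n c < n := fun c hc =>
    not_le.1 (Nat.find_min hex hc)
  have hle : Nat.find hex ≤ b := by
    refine Nat.find_le (?_ : n ≤ clauseStart N n b)
    by_contra hcon
    have := le_clauseStart (c := b) fun c' hc' =>
      (clauseStart_mono hc'.le).trans_lt (not_le.1 hcon)
    omega
  rw [clauseCount_eq hle hmin (Nat.find_spec hex)]
  exact ⟨hle, hmin, Nat.find_spec hex⟩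

theorem decodeClause_nats {p : ℕ} (h : ∀ r < N p, N (p + 2 + 2 * r) ≤ 1) :
    ((decodeClause N p).length :: (decodeClause N p).flatMap fun l => [l.1, l.2.toNat]) =
      (List.range (1 + 2 * N p)).map fun j => N (p + j) := by
  have key : ∀ s ≤ N p, ((List.range s).map fun r =>
      ((N (p + 1 + 2 * r), decide (N (p + 2 + 2 * r) ≠ 0)) : Lit)).flatMap
        (fun l => [l.1, l.2.toNat]) = (List.range (2 * s)).map fun j => N (p + 1 + j) := by
    intro s
    induction s with
    | zero => exact fun _ => rfl
    | succ s ih =>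
      intro hs
      rw [List.range_succ, List.map_append, List.flatMap_append, ih (by omega),
        show 2 * (s + 1) = 2 * s + 1 + 1 by ring, List.range_succ, List.range_succ]
      have h1 := h s (by omega)
      have h2 : (decide (N (p + 2 + 2 * s) ≠ 0)).toNat = N (p + 2 + 2 * s) := by
        by_cases h0 : N (p + 2 + 2 * s) = 0
        · simp [h0]
        · simp [h0]; omega
      simp only [List.map_append, List.flatMap_singleton, h2,
        show p + 1 + (2 * s + 1) = p + 2 + 2 * s by ring, List.append_assoc, List.singleton_append,
        List.map_cons, List.map_nil]
  rw [add_comm 1, List.range_succ_eq_map, List.map_cons, List.map_map]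
  congr 1
  · simp [decodeClause]
  · rw [decodeClause, key (N p) le_rfl]
    simp only [Function.comp_def, Nat.succ_eq_add_one]
    congr 1
    funext j
    ring_nf

variable {l : List ℕ} {q : ℕ}

/-- The validity conditions are just what makes decoding lossless: the last clause ends exactly at
the end of the sequence, and the sign entries are `0` or `1`. -/
theorem decodeCnf_nats (hN : ∀ i, N i = l.getD i 0) {m : ℕ} (h : IsValidCnf q N l.length m)
    (hm : ∀ c < m, clauseStart N l.length c < l.length) :
    (decodeCnf N l.length m).nats = l := by
  have key : ∀ c ≤ m, (decodeCnf N l.length c).nats = l.take (clauseStart N l.length c) := by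
    intro c
    induction c with
    | zero => exact fun _ => by simp [decodeCnf, CnfFormula.nats, clauseStart]
    | succ c ih =>
      intro hc
      have hle : clauseStart N l.length (c + 1) ≤ l.length := by
        have := clauseStart_mono (N := N) (n := l.length) hc
        rwa [h.1] at this
      have hle' := (clauseStart_le_succ c).trans hle
      have e : decodeCnf N l.length (c + 1) = decodeCnf N l.length c ++
          [decodeClause N (clauseStart N l.length c)] := by
        rw [decodeCnf, List.range_succ]
        simp [decodeCnf]
      rw [e, CnfFormula.nats_append, ih (by omega), CnfFormula.nats_cons,
        decodeClause_nats (h.2 c (by omega)).2]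
      rw [clauseStart, if_pos (hm c (by omega))] at hle ⊢
      rw [add_assoc, List.take_add]
      congr 1
      simp only [CnfFormula.nats, List.flatMap_nil, List.append_nil]
      refine List.ext_getElem (by simp; omega) fun j h1 h2 => ?_
      simp only [List.length_map, List.length_range] at h1
      rw [List.getElem_map, List.getElem_range, hN, List.getElem_take, List.getElem_drop,
        List.getD_eq_getElem _ _ (by omega)]
  rw [key m le_rfl, h.1, List.take_length]

/-- The computed clause starts agree with the lengths of the encodings of the initial parts of `F`,
which gives all lengths and literals back. The bound `b` is large enough, since every clause
contributes at least one number. -/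
theorem of_eq_nats {F : CnfFormula} (hN : ∀ i, N i = F.nats.getD i 0)
    (hF : ∀ C ∈ F, C.length ≤ q) {b : ℕ} (hb : F.nats.length ≤ b) :
    IsValidCnf q N F.nats.length (clauseCount N F.nats.length b) ∧
      decodeCnf N F.nats.length (clauseCount N F.nats.length b) = F := by
  have hsplit : ∀ c (hc : c < F.length), F.nats = (CnfFormula.nats (F.take c)) ++
      ((F[c].length :: F[c].flatMap fun l => [l.1, l.2.toNat]) ++
        (CnfFormula.nats (F.drop (c + 1)))) := by
    intro c hc
    rw [← CnfFormula.nats_cons, ← CnfFormula.nats_append, ← List.drop_eq_getElem_cons hc,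
      List.take_append_drop]
  have hget : ∀ c (hc : c < F.length), ∀ j < 1 + 2 * F[c].length,
      N ((CnfFormula.nats (F.take c)).length + j) =
        (F[c].length :: F[c].flatMap fun l => [l.1, l.2.toNat]).getD j 0 := by
    intro c hc j hj
    rw [hN, hsplit c hc, List.getD_append_right _ _ _ _ (by omega), Nat.add_sub_cancel_left,
      List.getD_append _ _ _ _]
    rw [List.length_cons, CnfFormula.length_lits]
    omega
  have htake : ∀ c (hc : c < F.length), (CnfFormula.nats (F.take (c + 1))).length =
      (CnfFormula.nats (F.take c)).length + 1 + 2 * F[c].length := by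
    intro c hc
    rw [List.take_succ_eq_append_getElem hc, CnfFormula.nats_append, CnfFormula.nats_cons]
    rw [List.length_append, List.length_append, List.length_cons, CnfFormula.length_lits]
    simp only [CnfFormula.nats, List.flatMap_nil, List.length_nil]
    omega
  have hlt : ∀ c < F.length, (CnfFormula.nats (F.take c)).length < F.nats.length := by
    intro c hc
    conv_rhs => rw [hsplit c hc]
    simp
  have hstart : ∀ c ≤ F.length, clauseStart N F.nats.length c =
      (CnfFormula.nats (F.take c)).length := by
    intro c
    induction c with
    | zero => exact fun _ => by simp [clauseStart, CnfFormula.nats]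
    | succ c ih =>
      intro hc
      rw [clauseStart, ih (by omega), if_pos (hlt c (by omega)), htake c (by omega)]
      have := hget c (by omega) 0 (by omega)
      simp only [add_zero, List.getD_cons_zero] at this
      rw [this]
  have hm : clauseCount N F.nats.length b = F.length := by
    refine clauseCount_eq ?_ (fun c hc => by rw [hstart c hc.le]; exact hlt c hc) ?_
    · refine le_trans ?_ hb
      rw [CnfFormula.nats, List.length_flatMap]
      refine le_trans ?_ (List.length_le_sum_of_one_le _ ?_)
      · simp
      · simp only [List.mem_map]
        rintro _ ⟨C, -, rfl⟩
        simp
    · rw [hstart _ le_rfl, List.take_length]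
  have hlit : ∀ c (hc : c < F.length), ∀ r (hr : r < F[c].length),
      N (clauseStart N F.nats.length c + 1 + 2 * r) = F[c][r].1 ∧
      N (clauseStart N F.nats.length c + 2 + 2 * r) = F[c][r].2.toNat := by
    intro c hc r hr
    have aux : ∀ (C : List Lit) (r : ℕ) (hr : r < C.length),
        (C.flatMap fun l => [l.1, l.2.toNat]).getD (2 * r) 0 = C[r].1 ∧
        (C.flatMap fun l => [l.1, l.2.toNat]).getD (2 * r + 1) 0 = C[r].2.toNat := by
      intro C
      induction C with
      | nil => intro r hr; simp at hr
      | cons a C ih =>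
        intro r hr
        rcases r with _ | r
        · simp
        · have := ih r (by simpa using hr)
          simpa [List.flatMap_cons, show 2 * (r + 1) = 2 * r + 1 + 1 by ring] using this
    have h1 := hget c hc (1 + 2 * r) (by omega)
    have h2 := hget c hc (2 + 2 * r) (by omega)
    rw [hstart c hc.le]
    rw [← add_assoc, add_comm 1 (2 * r), List.getD_cons_succ, (aux _ r hr).1] at h1
    rw [← add_assoc, show 2 + 2 * r = 2 * r + 1 + 1 by ring, List.getD_cons_succ, (aux _ r hr).2] at h2
    exact ⟨h1, h2⟩
  have hlen : ∀ c (hc : c < F.length), N (clauseStart N F.nats.length c) = F[c].length := by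
    intro c hc
    have := hget c hc 0 (by omega)
    rw [hstart c hc.le]
    simpa using this
  refine ⟨⟨by rw [hm, hstart _ le_rfl, List.take_length], fun c hc => ?_⟩, ?_⟩
  · rw [hm] at hc
    rw [hlen c hc]
    refine ⟨hF _ (List.getElem_mem hc), fun r hr => ?_⟩
    rw [(hlit c hc r hr).2]
    exact Bool.toNat_le _
  · rw [hm]
    refine List.ext_getElem (by simp [decodeCnf]) fun c h1 h2 => ?_
    simp only [decodeCnf, List.getElem_map, List.getElem_range]
    refine List.ext_getElem (by simp [decodeClause, hlen c h2]) fun r h3 h4 => ?_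
    simp only [decodeClause, List.getElem_map, List.getElem_range]
    rw [(hlit c h2 r h4).1, (hlit c h2 r h4).2]
    refine Prod.ext rfl ?_
    cases F[c][r].2 <;> simp

end Decode

/-- The encoded word of a decoded formula, for the contents `a` of the first `n` cells. -/
theorem mem_weightedCnfSat_iff {q k : ℕ} {w : List Bool} {a : ℕ → ℕ}
    (ha : ∀ j < w.length, a j = (w.getD j false).toNat) :
    (w, k) ∈ WeightedCnfSat q ↔ (w.length = 0 ∨ a (w.length - 1) = 0) ∧
      IsValidCnf q (decodeNat a w.length) (zerosBefore a w.length)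
        (clauseCount (decodeNat a w.length) (zerosBefore a w.length) w.length) ∧
      (decodeCnf (decodeNat a w.length) (zerosBefore a w.length)
        (clauseCount (decodeNat a w.length) (zerosBefore a w.length) w.length)).WeightedSat k := by
  constructor
  · rintro ⟨F, hF, hw, hk⟩
    simp only at hw hk
    rw [CnfFormula.encode_eq] at hw
    subst hw
    obtain ⟨h1, h2⟩ := decode_encodeNats a F.nats ha
    have hb : F.nats.length ≤ (encodeNats F.nats).length := by
      rw [← count_false_encodeNats]
      exact List.count_le_length
    obtain ⟨h3, h4⟩ := of_eq_nats h2 hF hb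
    rw [h1, h4]
    refine ⟨?_, h3, hk⟩
    rcases getD_encodeNats_last F.nats with h | h
    · exact Or.inl (by rw [h]; rfl)
    · rcases Nat.eq_zero_or_pos (encodeNats F.nats).length with h0 | h0
      · exact Or.inl h0
      · exact Or.inr (by rw [ha _ (by omega), h]; rfl)
  · rintro ⟨h0, h1, h2⟩
    obtain ⟨l, rfl⟩ := exists_eq_encodeNats w (by
      rcases h0 with h | h
      · exact Or.inl (List.length_eq_zero_iff.1 h)
      · rcases Nat.eq_zero_or_pos w.length with h0 | h0
        · exact Or.inl (List.length_eq_zero_iff.1 h0)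
        · right
          rw [ha _ (by omega)] at h
          cases hb : w.getD (w.length - 1) false
          · rfl
          · rw [hb] at h
            simp at h)
    obtain ⟨h3, h4⟩ := decode_encodeNats a l ha
    have hb : l.length ≤ (encodeNats l).length := by
      rw [← count_false_encodeNats]
      exact List.count_le_length
    rw [h3] at h1 h2
    refine ⟨_, fun C hC => ?_, ?_, h2⟩
    · simp only [decodeCnf, List.mem_map, List.mem_range] at hC
      obtain ⟨c, hc, rfl⟩ := hC
      simpa [decodeClause] using (h1.2 c hc).1
    · rw [CnfFormula.encode_eq, decodeCnf_nats h4 h1 (clauseCount_spec hb).2.1]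

/-- Encodings of satisfiable formulas have no long runs of zeros. -/
theorem not_long_run {q k : ℕ} {w u v : List Bool}
    (h : w = u ++ List.replicate (2 * q + 2) false ++ v) : (w, k) ∉ WeightedCnfSat q := by
  rintro ⟨F, hF, hw, T, -, -, hT⟩
  simp only at hw
  have hne : ∀ C ∈ F, C ≠ [] := by
    rintro C hC rfl
    obtain ⟨l, hl, -⟩ := hT _ hC
    simp at hl
  clear hT
  -- Since its length is positive, the code of each clause starts with a one, so no run of zeros
  -- extends into the next clause; and within one clause there are only `1 + 2 * C.length < 2 * q +
  -- 2` zeros.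
  have key : ∀ (F : CnfFormula), (∀ C ∈ F, C.length ≤ q) → (∀ C ∈ F, C ≠ []) →
      (F.encode = [] ∨ ∃ r, F.encode = true :: r) ∧
      ∀ u, F.encode ≠ u ++ (List.replicate (2 * q + 2) false ++ v) := by
    intro F
    induction F with
    | nil =>
      refine fun _ _ => ⟨Or.inl rfl, fun u h => ?_⟩
      have := congrArg List.length h
      simp [CnfFormula.encode, encodeNats_nil] at this
      omega
    | cons C F ih =>
      intro h1 h2
      obtain ⟨ih1, ih2⟩ := ih (fun C hC => h1 C (by simp [hC])) fun C hC => h2 C (by simp [hC])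
      have he : CnfFormula.encode (C :: F) =
          encodeNats (C.length :: C.flatMap fun l => [l.1, l.2.toNat]) ++
            CnfFormula.encode F := by
        rw [CnfFormula.encode_eq, CnfFormula.nats_cons, encodeNats_append, CnfFormula.encode_eq]
      have hcount : (encodeNats (C.length :: C.flatMap fun l => [l.1, l.2.toNat])).count false
          < 2 * q + 2 := by
        rw [count_false_encodeNats, List.length_cons, CnfFormula.length_lits]
        have := h1 C (by simp)
        omega
      refine ⟨Or.inr ?_, fun u hu => ?_⟩
      · have : C ≠ [] := h2 C (by simp)
        obtain ⟨l, C, rfl⟩ := List.exists_cons_of_ne_nil this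
        rw [he, encodeNats_cons, List.length_cons, List.replicate_succ]
        exact ⟨_, rfl⟩
      · rw [he] at hu
        rcases List.append_eq_append_iff.1 hu with ⟨a, h3, h4⟩ | ⟨a, h3, h4⟩
        · exact ih2 a h4
        · rcases List.append_eq_append_iff.1 h4 with ⟨b, h5, h6⟩ | ⟨b, h5, h6⟩
          · rw [h3, h5] at hcount
            simp [List.count_append] at hcount
            omega
          · rcases b with _ | ⟨x, b⟩
            · rw [List.append_nil] at h5
              rw [h3, ← h5] at hcount
              simp [List.count_append] at hcount
            · have hx : x = false := by
                have : x ∈ List.replicate (2 * q + 2) false := by rw [h5]; simp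
                exact List.eq_of_mem_replicate this
              rcases ih1 with h7 | ⟨r, h7⟩
              · rw [h7] at h6
                simp at h6
              · rw [h7, hx] at h6
                simp at h6
  exact (key F hF hne).2 u (by rw [← hw, h, List.append_assoc])

/-! ### A library of expressions -/

namespace RamExpr

/-- The expression has a nonzero value. -/
def Holds (M : ℕ) (A : ℕ → ℕ → ℕ) (e : RamExpr) (ρ : ℕ → ℕ) : Prop := e.eval M A ρ ≠ 0

instance (M : ℕ) (A : ℕ → ℕ → ℕ) (e : RamExpr) (ρ : ℕ → ℕ) : Decidable (e.Holds M A ρ) :=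
  inferInstanceAs (Decidable (_ ≠ _))

def ltE (a b : RamExpr) : RamExpr := sub b a
def leE (a b : RamExpr) : RamExpr := sub (add b (const 1)) a
def notE (a : RamExpr) : RamExpr := ite a (const 0) (const 1)
def andE (a b : RamExpr) : RamExpr := ite a b (const 0)
def orE (a b : RamExpr) : RamExpr := ite a (const 1) b
def impE (a b : RamExpr) : RamExpr := ite a b (const 1)
def eqE (a b : RamExpr) : RamExpr := andE (leE a b) (leE b a)
def iffE (a b : RamExpr) : RamExpr := ite a b (notE b)
def exE (x : ℕ) (n e : RamExpr) : RamExpr := sum x n e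
def allE (x : ℕ) (n e : RamExpr) : RamExpr := notE (exE x n (notE e))
def mulE (a b : RamExpr) : RamExpr := call (sum 2 (var 0) (var 1)) a b
def divE (a b : RamExpr) : RamExpr :=
  call (sum 2 (var 0) (ite (leE (mulE (add (var 2) (const 1)) (var 1)) (var 0))
    (const 1) (const 0))) a b
def modE (a b : RamExpr) : RamExpr :=
  call (sub (var 0) (mulE (divE (var 0) (var 1)) (var 1))) a b

/-- Division, as computed with the cap `M`. -/
def capDiv (M a b : ℕ) : ℕ :=
  ∑ i ∈ Finset.range (min M a), if min M (i + 1) * b ≤ a then 1 else 0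

/-- The quotient is the number of `i < a` with `(i + 1) * b ≤ a`; for `a ≤ M` the cap cuts off
nothing. -/
theorem capDiv_eq {M a b : ℕ} (ha : a ≤ M) (hb : 0 < b) : capDiv M a b = a / b := by
  have h1 : ∀ i ∈ Finset.range a, (if min M (i + 1) * b ≤ a then 1 else 0) =
      if i < a / b then 1 else 0 := by
    intro i hi
    rw [Finset.mem_range] at hi
    rw [min_eq_right (by omega)]
    exact if_congr (Nat.le_div_iff_mul_le hb).symm rfl rfl
  rw [capDiv, min_eq_right ha, Finset.sum_congr rfl h1, Finset.sum_boole]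
  have h2 : (Finset.range a).filter (· < a / b) = Finset.range (a / b) := by
    ext i
    have := Nat.div_le_self a b
    simp only [Finset.mem_filter, Finset.mem_range]
    omega
  simp [h2]

/-- Remainder, as computed with the cap `M`. -/
def capMod (M a b : ℕ) : ℕ := a - min M (capDiv M a b) * b

theorem capMod_eq {M a b : ℕ} (ha : a ≤ M) (hb : 0 < b) : capMod M a b = a % b := by
  rw [capMod, capDiv_eq ha hb, min_eq_right ((Nat.div_le_self a b).trans ha)]
  have := Nat.div_add_mod' a b
  omega

/-! ### Evaluation rules -/

section Simp

variable {M : ℕ} {A : ℕ → ℕ → ℕ} {ρ : ℕ → ℕ} (a b c e n : RamExpr) (x : ℕ)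

theorem eval_var : (var x).eval M A ρ = ρ x := rfl
theorem eval_const : (const x).eval M A ρ = x := rfl
theorem eval_add : (add a b).eval M A ρ = a.eval M A ρ + b.eval M A ρ := rfl
theorem eval_sub : (sub a b).eval M A ρ = a.eval M A ρ - b.eval M A ρ := rfl
theorem eval_arr : (arr x e).eval M A ρ = A x (e.eval M A ρ) := rfl
theorem eval_sum : (sum x n e).eval M A ρ =
    ∑ i ∈ Finset.range (min M (n.eval M A ρ)), e.eval M A (Function.update ρ x i) := rfl
theorem eval_letE : (letE x e b).eval M A ρ =
    b.eval M A (Function.update ρ x (e.eval M A ρ)) := rfl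
theorem eval_ite : (ite c a b).eval M A ρ =
    if c.Holds M A ρ then a.eval M A ρ else b.eval M A ρ := rfl
theorem holds_ltE : (ltE a b).Holds M A ρ ↔ a.eval M A ρ < b.eval M A ρ := by
  simp only [Holds, ltE, eval]; omega
theorem holds_leE : (leE a b).Holds M A ρ ↔ a.eval M A ρ ≤ b.eval M A ρ := by
  simp only [Holds, leE, eval]; omega
theorem holds_notE : (notE a).Holds M A ρ ↔ ¬ a.Holds M A ρ := by
  simp only [Holds, notE, eval]; split_ifs <;> simp_all
theorem holds_andE : (andE a b).Holds M A ρ ↔ a.Holds M A ρ ∧ b.Holds M A ρ := by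
  simp only [Holds, andE, eval]; split_ifs <;> simp_all
theorem holds_orE : (orE a b).Holds M A ρ ↔ a.Holds M A ρ ∨ b.Holds M A ρ := by
  simp only [Holds, orE, eval]; split_ifs <;> simp_all
theorem holds_impE : (impE a b).Holds M A ρ ↔ (a.Holds M A ρ → b.Holds M A ρ) := by
  simp only [Holds, impE, eval]; split_ifs <;> simp_all
theorem holds_eqE : (eqE a b).Holds M A ρ ↔ a.eval M A ρ = b.eval M A ρ := by
  rw [eqE, holds_andE, holds_leE, holds_leE]; omega
theorem holds_iffE : (iffE a b).Holds M A ρ ↔ (a.Holds M A ρ ↔ b.Holds M A ρ) := by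
  have := holds_notE b (M := M) (A := A) (ρ := ρ)
  simp only [Holds] at this
  simp only [Holds, iffE, eval]
  split_ifs <;> tauto
theorem holds_exE : (exE x n e).Holds M A ρ ↔
    ∃ i < min M (n.eval M A ρ), e.Holds M A (Function.update ρ x i) := by
  simp only [Holds, exE, eval, ne_eq, Finset.sum_eq_zero_iff, Finset.mem_range, not_forall]
  simp only [exists_prop]
theorem holds_allE : (allE x n e).Holds M A ρ ↔
    ∀ i < min M (n.eval M A ρ), e.Holds M A (Function.update ρ x i) := by
  rw [allE, holds_notE, holds_exE]
  simp only [holds_notE]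
  push Not
  rfl
-- Only the first factor acts as a summation bound and is cut off, so products are exact when their
-- first factor is at most the cap, even if the result exceeds it.
theorem eval_mulE : (mulE a b).eval M A ρ = min M (a.eval M A ρ) * b.eval M A ρ := by
  simp [mulE, eval]
theorem eval_divE : (divE a b).eval M A ρ = capDiv M (a.eval M A ρ) (b.eval M A ρ) := by
  simp only [divE, capDiv, eval, eval_mulE, ne_eq, leE]
  refine Finset.sum_congr (by simp) fun i _ => if_congr ?_ rfl rfl
  simp
  omega
theorem eval_modE : (modE a b).eval M A ρ = capMod M (a.eval M A ρ) (b.eval M A ρ) := by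
  simp [modE, capMod, eval, eval_mulE, eval_divE]

theorem globals_zero (n k M x : ℕ) : globals n k M x 0 = x := rfl
theorem globals_one (n k M x : ℕ) : globals n k M x 1 = n := rfl
theorem globals_two (n k M x : ℕ) : globals n k M x 2 = k := rfl

end Simp

end RamExpr

/-! ### The tables of the reduction: formula, search table, constraints -/

namespace RamExpr

theorem holds_ite {M : ℕ} {A : ℕ → ℕ → ℕ} {ρ : ℕ → ℕ} (c a b : RamExpr) :
    (ite c a b).Holds M A ρ ↔ if c.Holds M A ρ then a.Holds M A ρ else b.Holds M A ρ := by
  by_cases h : c.eval M A ρ ≠ 0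
  · rw [if_pos (show c.Holds M A ρ from h), Holds, eval, if_pos h, Holds]
  · rw [if_neg (show ¬ c.Holds M A ρ from h), Holds, eval, if_neg h, Holds]

theorem holds_arr {M : ℕ} {A : ℕ → ℕ → ℕ} {ρ : ℕ → ℕ} (i : ℕ) (e : RamExpr) :
    (arr i e).Holds M A ρ ↔ A i (e.eval M A ρ) ≠ 0 := Iff.rfl

theorem holds_letE {M : ℕ} {A : ℕ → ℕ → ℕ} {ρ : ℕ → ℕ} (x : ℕ) (e b : RamExpr) :
    (letE x e b).Holds M A ρ ↔ b.Holds M A (Function.update ρ x (e.eval M A ρ)) := Iff.rfl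

theorem holds_var {M : ℕ} {A : ℕ → ℕ → ℕ} {ρ : ℕ → ℕ} (x : ℕ) :
    (var x).Holds M A ρ ↔ ρ x ≠ 0 := Iff.rfl

theorem holds_boolE {M : ℕ} {A : ℕ → ℕ → ℕ} {ρ : ℕ → ℕ} (c : RamExpr) :
    (ite c (const 1) (const 0)).Holds M A ρ ↔ c.Holds M A ρ := by
  rw [holds_ite]
  split_ifs with h <;> simp [h] <;> simp [Holds, eval_const]

/-- The length of the sequence of numbers. -/
def natCountE : RamExpr := arr 1 (var 1)
/-- The length of a row of the search table. -/
def rowE (q : ℕ) : RamExpr := add (const (q + 2)) (var 2)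
/-- The number of clauses. -/
def clauseCountE : RamExpr := arr 4 (const 0)
/-- A digit in the mixed radix system. -/
def digitE (u l : RamExpr) : RamExpr := modE (divE u (arr 6 l)) (arr 5 l)
/-- A cell of the search table. -/
def cellE (q : ℕ) (u l : RamExpr) : RamExpr := arr 7 (add (mulE u (rowE q)) l)
/-- The variable `v` is listed in the row `var 10`, before position `l`. -/
def listedE (q : ℕ) (v l : RamExpr) : RamExpr :=
  exE 17 l (eqE (cellE q (var 10) (var 17)) (add v (const 1)))
/-- The clause `c` holds under the variables listed in the row `var 10`, before position `l`. -/
def satE (q : ℕ) (c l : RamExpr) : RamExpr :=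
  letE 15 (arr 3 c) <| exE 16 (arr 2 (var 15)) <|
    iffE (listedE q (arr 2 (add (add (var 15) (const 1)) (mulE (const 2) (var 16)))) l)
      (arr 2 (add (add (var 15) (const 2)) (mulE (const 2) (var 16))))

/-! ### The defining expressions of arrays `1` to `9` -/

def zerosTab : RamExpr := sum 10 (var 0) (ite (arr 0 (var 10)) (const 0) (const 1))

def natTab : RamExpr :=
  sum 10 (var 1) (ite (arr 0 (var 10)) (ite (eqE (arr 1 (var 10)) (var 0)) (const 1) (const 0))
    (const 0))

def startTab : RamExpr :=
  ite (var 0) (letE 10 (arr 3 (sub (var 0) (const 1))) <| ite (ltE (var 10) natCountE)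
    (add (add (var 10) (const 1)) (mulE (const 2) (arr 2 (var 10)))) (var 10)) (const 0)

def countTab : RamExpr :=
  sum 10 (var 1) (ite (ltE (arr 3 (var 10)) natCountE) (const 1) (const 0))

def baseTab (q : ℕ) : RamExpr :=
  ite (ltE (var 0) (rowE q)) (add (var 2) (const 1)) <|
    ite (ltE (var 0) (add (rowE q) (const (q + 2)))) (add (var 1) (const 2)) (const (q + 2))

def placeTab : RamExpr :=
  ite (var 0) (mulE (arr 5 (sub (var 0) (const 1))) (arr 6 (sub (var 0) (const 1)))) (const 1)

def searchTab (q : ℕ) : RamExpr :=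
  letE 10 (divE (var 0) (rowE q)) <| letE 11 (modE (var 0) (rowE q)) <|
    ite (ltE (var 11) (const (q + 2))) (digitE (var 10) (add (rowE q) (var 11))) <|
    letE 12 (sum 13 clauseCountE
      (ite (allE 14 (add (var 13) (const 1)) (satE q (var 14) (var 11))) (const 1) (const 0))) <|
    ite (ltE (var 12) clauseCountE) (add (arr 2 (add (add (arr 3 (var 12)) (const 1))
      (mulE (const 2) (digitE (var 10) (add (rowE q) (var 11)))))) (const 1)) (const 0)

def okTab (q : ℕ) : RamExpr :=
  letE 10 (var 0) <| ite (andE (allE 14 clauseCountE (satE q (var 14) (rowE q)))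
    (allE 18 (const (q + 2)) <| allE 19 (const (q + 2)) <|
      impE (ltE (digitE (var 10) (var 18)) (digitE (var 10) (var 19)))
        (ltE (cellE q (var 10) (var 18)) (cellE q (var 10) (var 19))))) (const 1) (const 0)

def occTab : RamExpr :=
  ite (orE (eqE (var 0) (const 0)) <| exE 14 clauseCountE <| exE 16 (arr 2 (arr 3 (var 14))) <|
    eqE (add (arr 2 (add (add (arr 3 (var 14)) (const 1)) (mulE (const 2) (var 16)))) (const 1))
      (var 0)) (const 1) (const 0)

/-- The constraint between the variables `var 20` and `var 21` for the values `var 22` and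
`var 23`. -/
def relE (q : ℕ) : RamExpr :=
  impE (ltE (var 20) (arr 6 (const (q + 2)))) <| impE (leE (arr 6 (const (q + 2))) (var 21)) <|
    letE 24 (sub (var 21) (arr 6 (const (q + 2)))) <|
    andE (allE 18 (const (q + 2)) (eqE (digitE (var 22) (var 18)) (digitE (var 20) (var 18)))) <|
    andE (arr 8 (var 22)) <|
    andE (allE 18 (rowE q) (impE (eqE (digitE (var 22) (var 18)) (var 24))
      (eqE (cellE q (var 22) (var 18)) (var 23)))) <|
    andE (iffE (eqE (var 23) (const 0)) (eqE (var 24) (const 0))) (arr 9 (var 23))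

/-! ### Correctness of the formula, search and constraint tables -/

section Tables

variable {q n k M : ℕ} {A : ℕ → ℕ → ℕ}

theorem zerosTab_spec (h : ∀ x < M, A 1 x = zerosTab.eval M A (globals n k M x)) :
    ∀ x < M, A 1 x = zerosBefore (A 0) x := by
  intro x hx
  rw [h x hx]
  simp only [zerosTab, eval_sum, eval_ite, eval_var, eval_const, holds_arr, globals_zero,
    min_eq_right hx.le, Function.update_self, zerosBefore]

theorem zerosBefore_le (a : ℕ → ℕ) (x : ℕ) : zerosBefore a x ≤ x := by
  refine (Finset.sum_le_card_nsmul _ _ 1 fun i _ => ?_).trans (by simp)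
  split_ifs <;> omega

theorem decodeNat_le (a : ℕ → ℕ) (n x : ℕ) : decodeNat a n x ≤ n := by
  refine (Finset.sum_le_card_nsmul _ _ 1 fun i _ => ?_).trans (by simp)
  split_ifs <;> omega

theorem natTab_spec (hn : n < M) (h1 : ∀ x < M, A 1 x = zerosBefore (A 0) x)
    (h : ∀ x < M, A 2 x = natTab.eval M A (globals n k M x)) :
    ∀ x < M, A 2 x = decodeNat (A 0) n x := by
  intro x hx
  rw [h x hx]
  simp only [natTab, eval_sum, eval_ite, eval_var, eval_const, holds_arr, holds_eqE, eval_arr,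
    globals_one, min_eq_right hn.le, Function.update_self, decodeNat]
  refine Finset.sum_congr rfl fun i hi => ?_
  rw [Finset.mem_range] at hi
  rw [h1 i (by omega)]
  rfl

theorem startTab_spec {f : ℕ → ℕ → ℕ} (hn : n + 2 < M)
    (h1 : ∀ x < M, A 1 x = zerosBefore (A 0) x) (h2 : ∀ x < M, A 2 x = decodeNat (A 0) n x)
    (h : ∀ x < M, A 3 x = startTab.eval M (Function.update A 3 fun y => if y < x then A 3 y
      else f x y) (globals n k M x)) :
    ∀ x < M, A 3 x = clauseStart (decodeNat (A 0) n) (zerosBefore (A 0) n) x := by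
  intro x
  have hz := zerosBefore_le (A 0) n
  induction x with
  | zero =>
    intro hx
    rw [h 0 hx]
    rfl
  | succ x ih =>
    intro hx
    have hA := ih (by omega)
    rw [h _ hx]
    simp only [startTab, natCountE, eval_letE, eval_ite, eval_var, eval_const, eval_arr, eval_sub,
      eval_add, eval_mulE, holds_var, holds_ltE, globals_zero, Function.update_self]
    have e1 : (globals n k M (x + 1)) 1 = n := rfl
    simp only [ne_eq, Nat.add_eq_zero_iff, one_ne_zero, and_false, not_false_eq_true, if_true,
      Nat.add_sub_cancel, Nat.lt_succ_self, Function.update_of_ne, Nat.reduceEqDiff,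
      OfNat.one_ne_ofNat, e1, h1 n (by omega), hA, min_eq_right (show 2 ≤ M by omega)]
    rw [clauseStart]
    split_ifs with hlt
    · rw [h2 _ (by omega)]
    · rfl

theorem countTab_spec (hn : n < M) (h1 : ∀ x < M, A 1 x = zerosBefore (A 0) x) {st : ℕ → ℕ}
    (h3 : ∀ x < M, A 3 x = st x)
    (h : ∀ x < M, A 4 x = countTab.eval M A (globals n k M x)) :
    A 4 0 = ∑ c ∈ Finset.range n, if st c < zerosBefore (A 0) n then 1 else 0 := by
  rw [h 0 (by omega)]
  simp only [countTab, natCountE, eval_sum, eval_ite, eval_var, eval_const, holds_ltE, eval_arr,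
    globals_one, min_eq_right hn.le, Function.update_self]
  refine Finset.sum_congr rfl fun i hi => ?_
  rw [Finset.mem_range] at hi
  have e1 : (Function.update (globals n k M 0) 10 i) 1 = n := rfl
  rw [e1, h1 n hn, h3 i (by omega)]

theorem baseTab_spec (h : ∀ x < M, A 5 x = (baseTab q).eval M A (globals n k M x)) :
    ∀ x < M, A 5 x = cspBase (q + 2) k (n + 2) x := by
  intro x hx
  rw [h x hx]
  simp only [baseTab, rowE, eval_ite, eval_var, eval_const, eval_add, holds_ltE, globals_zero,
    globals_one, globals_two, cspBase]

theorem placeTab_spec {f : ℕ → ℕ → ℕ} (hM : n + k + q + 3 ≤ M)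
    (h5 : ∀ x < M, A 5 x = cspBase (q + 2) k (n + 2) x)
    (h : ∀ x < M, A 6 x = placeTab.eval M (Function.update A 6 fun y => if y < x then A 6 y
      else f x y) (globals n k M x)) :
    ∀ x < M, A 6 x = placeValue (cspBase (q + 2) k (n + 2)) x := by
  intro x
  induction x with
  | zero =>
    intro hx
    rw [h 0 hx]
    rfl
  | succ x ih =>
    intro hx
    have hA := ih (by omega)
    rw [h _ hx]
    simp only [placeTab, eval_ite, eval_var, eval_const, eval_arr, eval_sub,
      eval_mulE, holds_var, globals_zero, Function.update_self]
    have hb : cspBase (q + 2) k (n + 2) x ≤ M := by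
      unfold cspBase
      split_ifs <;> omega
    simp only [ne_eq, Nat.add_eq_zero_iff, one_ne_zero, and_false, not_false_eq_true, if_true,
      Nat.add_sub_cancel, Nat.lt_succ_self, Function.update_of_ne, Nat.reduceEqDiff,
      h5 x (by omega), hA, min_eq_right hb]
    rw [placeValue_succ, mul_comm]

theorem capDigit_eq (h5 : ∀ x < M, A 5 x = cspBase (q + 2) k (n + 2) x)
    (h6 : ∀ x < M, A 6 x = placeValue (cspBase (q + 2) k (n + 2)) x) {u l : ℕ} (hu : u ≤ M)
    (hl : l < M) :
    capMod M (capDiv M u (A 6 l)) (A 5 l) = mixedDigit (cspBase (q + 2) k (n + 2)) u l := by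
  rw [h5 l hl, h6 l hl, capDiv_eq hu (placeValue_pos fun _ _ => cspBase_pos (by omega) (by omega) _),
    capMod_eq ((Nat.div_le_self _ _).trans hu) (cspBase_pos (by omega) (by omega) _), mixedDigit]

theorem clauseSat_decodeClause (N : ℕ → ℕ) (p : ℕ) (P : ℕ → Prop) :
    ClauseSat (decodeClause N p) P ↔
      ∃ r < N p, (P (N (p + 1 + 2 * r)) ↔ N (p + 2 + 2 * r) ≠ 0) := by
  simp [ClauseSat, decodeClause]

/-- The data read off the tables `2`, `3` and `4`. -/
structure IsFormulaTable (n M : ℕ) (A : ℕ → ℕ → ℕ) (N st : ℕ → ℕ) (m : ℕ) : Prop where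
  nat_eq : ∀ x < M, A 2 x = N x
  start_eq : ∀ x < M, A 3 x = st x
  count_eq : A 4 0 = m
  nat_le : ∀ x, N x ≤ n
  start_lt : ∀ c < m, st c < n
  count_le : m ≤ n

/-- The hypotheses allow use while array `7` is still being filled: `B` may differ from `A` there,
and only the cells of the row before `y` are read. The position expression `l` must not depend on
the variables `15` and `16`, which are bound inside. -/
theorem holds_satE {N st : ℕ → ℕ} {m : ℕ} (hF : IsFormulaTable n M A N st m)
    (hM : 3 * n + k + q + 8 ≤ M) {c l : RamExpr} {ρ : ℕ → ℕ} {s : ℕ → ℕ}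
    {x y : ℕ} {B : ℕ → ℕ → ℕ} (hB : ∀ i, i ≠ 7 → B i = A i)
    (h2 : ρ 2 = k) (hu : ρ 10 ≤ M) (hc : c.eval M B ρ = x)
    (hl : ∀ v w z, l.eval M B (Function.update (Function.update ρ 15 v) 16 w) = z → z = y)
    (hx : x < m) (hy : y ≤ M)
    (hs : ∀ i < y, B 7 (ρ 10 * (q + 2 + k) + i) = s i) :
    (satE q c l).Holds M B ρ ↔ ClauseSat (decodeClause N (st x)) (Listed s y) := by
  have hst := hF.start_lt x hx
  have hxn := hF.count_le
  have hN := hF.nat_le (st x)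
  have e3 : B 3 = A 3 := hB 3 (by omega)
  have e2 : B 2 = A 2 := hB 2 (by omega)
  have hv : (arr 3 c).eval M B ρ = st x := by rw [eval_arr, hc, e3, hF.start_eq x (by omega)]
  rw [clauseSat_decodeClause, satE, holds_letE, hv, holds_exE, eval_arr, eval_var,
    Function.update_self, e2, hF.nat_eq _ (by omega), min_eq_right (by omega)]
  refine exists_congr fun r => and_congr_right fun hr => ?_
  rw [holds_iffE, holds_arr, e2]
  simp only [listedE, holds_exE, hl _ _ _ rfl, holds_eqE, eval_add, eval_arr, eval_mulE, eval_var, eval_const,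
    min_eq_right (show 2 ≤ M by omega), min_eq_right hy, cellE, rowE, Function.update_self,
    ne_eq, Nat.reduceEqDiff, not_false_eq_true, Function.update_of_ne, h2, min_eq_right hu, e2]
  rw [hF.nat_eq _ (by omega), hF.nat_eq _ (by omega)]
  refine iff_congr (exists_congr fun i => and_congr_right fun hi => ?_) Iff.rfl
  rw [hs i hi]

/-- The sum counts the initial segments on which `P` holds throughout, so it equals the least index
at which `P` fails, or `m` if there is none. It stands in for a search loop. -/
theorem sum_first {P : ℕ → Prop} [DecidablePred P] {m i : ℕ} (hi : i ≤ m) (h : ∀ j < i, P j)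
    (h' : i < m → ¬ P i) :
    (∑ c ∈ Finset.range m, if ∀ j < c + 1, P j then 1 else 0) = i := by
  have : (Finset.range m).filter (fun c => ∀ j < c + 1, P j) = Finset.range i := by
    ext c
    simp only [Finset.mem_filter, Finset.mem_range]
    refine ⟨fun hc => ?_, fun hc => ⟨by omega, fun j hj => h j (by omega)⟩⟩
    by_contra hcon
    exact h' (by omega) (hc.2 i (by omega))
  rw [Finset.sum_boole, this]
  simp

theorem exists_first {P : ℕ → Prop} (m : ℕ) :
    ∃ i ≤ m, (∀ j < i, P j) ∧ (i < m → ¬ P i) := by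
  classical
  by_cases h : ∃ i, i < m ∧ ¬ P i
  · refine ⟨Nat.find h, (Nat.find_spec h).1.le, fun j hj => ?_, fun _ => (Nat.find_spec h).2⟩
    by_contra hcon
    exact Nat.find_min h hj ⟨hj.trans (Nat.find_spec h).1, hcon⟩
  · push Not at h
    exact ⟨m, le_rfl, h, fun h => absurd h (lt_irrefl _)⟩

/-- One recursive step of the search table, stated for an arbitrary index `i` that is the first
falsified clause, or `m` when all clauses hold. Clauses are tested on the cells of the same row to
the left, which are final when the cell is computed. -/
theorem eval_searchTab {N st : ℕ → ℕ} {m : ℕ} (hF : IsFormulaTable n M A N st m)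
    (hM : 3 * n + 2 * k + 2 * q + 8 ≤ M)
    (h5 : ∀ x < M, A 5 x = cspBase (q + 2) k (n + 2) x)
    (h6 : ∀ x < M, A 6 x = placeValue (cspBase (q + 2) k (n + 2)) x) {f : ℕ → ℕ → ℕ}
    (h : ∀ x < M, A 7 x = (searchTab q).eval M (Function.update A 7 fun y => if y < x then A 7 y
      else f x y) (globals n k M x)) {u l i : ℕ} (hx : u * (q + 2 + k) + l < M)
    (hl : l < q + 2 + k) (hi : i ≤ m)
    (hsat : ∀ j < i, ClauseSat (decodeClause N (st j)) (Listed (fun l => A 7 (u * (q + 2 + k) + l)) l))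
    (hunsat : i < m → ¬ ClauseSat (decodeClause N (st i))
      (Listed (fun l => A 7 (u * (q + 2 + k) + l)) l)) :
    A 7 (u * (q + 2 + k) + l) =
      if l < q + 2 then mixedDigit (cspBase (q + 2) k (n + 2)) u (q + 2 + k + l) else
      if i < m then
        N (st i + 1 + 2 * mixedDigit (cspBase (q + 2) k (n + 2)) u (q + 2 + k + l)) + 1 else 0 := by
  classical
  set x := u * (q + 2 + k) + l with hxdef
  set B := Function.update A 7 fun y => if y < x then A 7 y else f x y with hBdef
  have hux : u ≤ x := by
    have := Nat.mul_le_mul_left u (show 1 ≤ q + 2 + k by omega)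
    omega
  have hB : ∀ i, i ≠ 7 → B i = A i := fun i hi => Function.update_of_ne hi _ _
  have hdiv : x / (q + 2 + k) = u := by
    rw [hxdef, mul_comm, Nat.mul_add_div (by omega), Nat.div_eq_of_lt hl, add_zero]
  have hmod : x % (q + 2 + k) = l := by
    rw [hxdef, mul_comm, Nat.mul_add_mod, Nat.mod_eq_of_lt hl]
  have hmn := hF.count_le
  have hdig : (digitE (var 10) (add (rowE q) (var 11))).eval M B =
      fun ρ => capMod M (capDiv M (ρ 10) (B 6 (q + 2 + ρ 2 + ρ 11))) (B 5 (q + 2 + ρ 2 + ρ 11)) := by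
    funext ρ
    rw [digitE, eval_modE, eval_divE]
    rfl
  set ρ₁ := Function.update (Function.update (globals n k M x) 10 u) 11 l with hρ₁
  have hsum : (sum 13 clauseCountE (ite (allE 14 (add (var 13) (const 1))
      (satE q (var 14) (var 11))) (const 1) (const 0))).eval M B ρ₁ = i := by
    rw [eval_sum, clauseCountE, eval_arr, eval_const, hB 4 (by omega), hF.count_eq,
      min_eq_right (by omega), ← sum_first hi hsat hunsat]
    refine Finset.sum_congr rfl fun c hc => ?_
    rw [Finset.mem_range] at hc
    rw [eval_ite, eval_const, eval_const]
    refine if_congr ?_ rfl rfl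
    rw [holds_allE, eval_add, eval_var, eval_const, Function.update_self, min_eq_right (by omega)]
    refine forall_congr' fun j => forall_congr' fun hj => ?_
    refine holds_satE (k := k) hF (by omega) hB rfl (hux.trans hx.le) (x := j) ?_ ?_ (by omega)
      (y := l) (by omega) ?_
    · rfl
    · rintro v w z rfl
      rfl
    · intro i' hi'
      change B 7 (u * (q + 2 + k) + i') = _
      rw [hBdef, Function.update_self, if_pos (by omega)]
  have hcap : capMod M (capDiv M u (B 6 (q + 2 + k + l))) (B 5 (q + 2 + k + l)) =
      mixedDigit (cspBase (q + 2) k (n + 2)) u (q + 2 + k + l) := by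
    rw [hB 6 (by omega), hB 5 (by omega), capDigit_eq h5 h6 (by omega) (by omega)]
  -- Only digits from place `Q + k` on are used here, and their bases are `n + 2` or `q + 2`; either
  -- bound keeps the index of the literal's cell below the cap.
  have hbase : mixedDigit (cspBase (q + 2) k (n + 2)) u (q + 2 + k + l) < n + 2 ∨
      mixedDigit (cspBase (q + 2) k (n + 2)) u (q + 2 + k + l) < q + 2 := by
    have := Nat.mod_lt (u / placeValue (cspBase (q + 2) k (n + 2)) (q + 2 + k + l))
      (cspBase_pos (Q := q + 2) (k := k) (n := n + 2) (by omega) (by omega) (q + 2 + k + l))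
    rw [mixedDigit]
    revert this
    generalize placeValue (cspBase (q + 2) k (n + 2)) (q + 2 + k + l) = V
    unfold cspBase
    split_ifs <;> omega
  have hv10 : (divE (var 0) (rowE q)).eval M B (globals n k M x) = u := by
    rw [eval_divE, eval_var, rowE, eval_add, eval_const, eval_var, globals_zero, globals_two,
      capDiv_eq hx.le (by omega), hdiv]
  have hv11 : (modE (var 0) (rowE q)).eval M B (Function.update (globals n k M x) 10 u) = l := by
    rw [eval_modE, eval_var, rowE, eval_add, eval_const, eval_var]
    change capMod M x (q + 2 + k) = l
    rw [capMod_eq hx.le (by omega), hmod]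
  rw [h x hx, searchTab, eval_letE, hv10, eval_letE, hv11, eval_ite, hdig, eval_letE, hsum]
  refine if_congr (holds_ltE _ _) hcap ?_
  have hlt : (ltE (var 12) clauseCountE).Holds M B (Function.update ρ₁ 12 i) ↔ i < m := by
    rw [holds_ltE, clauseCountE, eval_arr, eval_const, hB 4 (by omega), hF.count_eq, eval_var,
      Function.update_self]
  rw [eval_ite, if_congr hlt rfl rfl]
  by_cases him : i < m
  · rw [if_pos him, if_pos him, eval_add, eval_const, eval_arr, eval_add, eval_add, eval_arr,
      eval_var, eval_mulE, eval_const, eval_const, hdig, Function.update_self]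
    change B 2 (B 3 i + 1 + min M 2 *
      capMod M (capDiv M u (B 6 (q + 2 + k + l))) (B 5 (q + 2 + k + l))) + 1 = _
    have := hF.start_lt i him
    rw [hcap, min_eq_right (by omega), hB 3 (by omega), hB 2 (by omega), hF.start_eq i (by omega),
      hF.nat_eq _ (by omega)]
  · rw [if_neg him, if_neg him]
    rfl

/-- The cell `u * (Q + k) + l` stores entry `l` of row `u`; the size condition keeps all rows with
indices in the domain below the cap. -/
theorem isSearchTable_of_tab {N : ℕ → ℕ} {m r : ℕ}
    (hF : IsFormulaTable n M A N (clauseStart N r) m)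
    (hM : 3 * n + 2 * k + 2 * q + 8 ≤ M) (hD : cspDom (q + 2) k (n + 2) * (q + 2 + k) ≤ M)
    (h5 : ∀ x < M, A 5 x = cspBase (q + 2) k (n + 2) x)
    (h6 : ∀ x < M, A 6 x = placeValue (cspBase (q + 2) k (n + 2)) x) {f : ℕ → ℕ → ℕ}
    (h : ∀ x < M, A 7 x = (searchTab q).eval M (Function.update A 7 fun y => if y < x then A 7 y
      else f x y) (globals n k M x)) :
    IsSearchTable (decodeCnf N r m) (q + 2) k (n + 2) fun u l => A 7 (u * (q + 2 + k) + l) := by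
  have hx : ∀ u < cspDom (q + 2) k (n + 2), ∀ l < q + 2 + k, u * (q + 2 + k) + l < M := by
    intro u hu l hl
    have := Nat.mul_le_mul_right (q + 2 + k) (show u + 1 ≤ _ from hu)
    rw [add_mul] at this
    omega
  have hlen : (decodeCnf N r m).length = m := by simp [decodeCnf]
  refine ⟨fun u hu l hl => ?_, fun u hu l hl hl' hall => ?_, fun u hu l hl hl' i hi hsat hun b hb
    hbd => ?_⟩
  · obtain ⟨i, hi, h1, h2⟩ := exists_first (P := fun j => ClauseSat (decodeClause N
      (clauseStart N r j)) (Listed (fun l => A 7 (u * (q + 2 + k) + l)) l)) m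
    rw [eval_searchTab hF hM h5 h6 h (hx u hu l (by omega)) (by omega) hi h1 h2, if_pos hl]
  · rw [eval_searchTab hF hM h5 h6 h (hx u hu l hl) hl (le_refl m) (fun j hj => hall _ ?_)
      fun h => absurd h (lt_irrefl _), if_neg (by omega), if_neg (lt_irrefl _)]
    exact List.mem_map_of_mem (List.mem_range.2 hj)
  · have hi' : i < m := by omega
    rw [eval_searchTab hF hM h5 h6 h (hx u hu l hl) hl hi'.le (fun j hj => ?_) (fun _ => ?_),
      if_neg (by omega), if_pos hi', hbd]
    · simp [decodeCnf, decodeClause]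
    · have := hsat j hj
      simpa [decodeCnf] using this
    · simpa [decodeCnf] using hun

theorem eval_digitE (h5 : ∀ x < M, A 5 x = cspBase (q + 2) k (n + 2) x)
    (h6 : ∀ x < M, A 6 x = placeValue (cspBase (q + 2) k (n + 2)) x) (u l : RamExpr) {ρ : ℕ → ℕ}
    {x y : ℕ} (hu : u.eval M A ρ = x) (hl : l.eval M A ρ = y) (hx : x ≤ M) (hy : y < M) :
    (digitE u l).eval M A ρ = mixedDigit (cspBase (q + 2) k (n + 2)) x y := by
  rw [digitE, eval_modE, eval_divE, eval_arr, eval_arr, hu, hl, capDigit_eq h5 h6 hx hy]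

theorem eval_cellE (u l : RamExpr) {ρ : ℕ → ℕ} {x : ℕ} (hk : ρ 2 = k) (hu : u.eval M A ρ = x)
    (hx : x ≤ M) :
    (cellE q u l).eval M A ρ = A 7 (x * (q + 2 + k) + l.eval M A ρ) := by
  rw [cellE, eval_arr, eval_add, eval_mulE, hu, min_eq_right hx, rowE, eval_add, eval_const,
    eval_var, hk]

theorem okTab_spec {N : ℕ → ℕ} {m r : ℕ} (hF : IsFormulaTable n M A N (clauseStart N r) m)
    (hM : 3 * n + 2 * k + 2 * q + 8 ≤ M)
    (h5 : ∀ x < M, A 5 x = cspBase (q + 2) k (n + 2) x)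
    (h6 : ∀ x < M, A 6 x = placeValue (cspBase (q + 2) k (n + 2)) x)
    (h : ∀ x < M, A 8 x = (okTab q).eval M A (globals n k M x)) {u : ℕ} (hu : u < M) :
    A 8 u ≠ 0 ↔ (∀ C ∈ decodeCnf N r m,
        ClauseSat C (Listed (fun l => A 7 (u * (q + 2 + k) + l)) (q + 2 + k))) ∧
      ∀ l < q + 2, ∀ l' < q + 2, mixedDigit (cspBase (q + 2) k (n + 2)) u l <
        mixedDigit (cspBase (q + 2) k (n + 2)) u l' →
        A 7 (u * (q + 2 + k) + l) < A 7 (u * (q + 2 + k) + l') := by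
  have hmn := hF.count_le
  rw [h u hu, ← Holds, okTab, holds_letE, holds_boolE, holds_andE, holds_allE, holds_allE, clauseCountE, eval_arr, eval_const, hF.count_eq,
    min_eq_right (by omega), eval_const, min_eq_right (by omega)]
  refine and_congr ?_ (forall_congr' fun l => forall_congr' fun hl => ?_)
  · simp only [decodeCnf, List.forall_mem_map, List.mem_range]
    refine forall_congr' fun c => forall_congr' fun hc => ?_
    refine holds_satE (k := k) hF (by omega) (fun _ _ => rfl) rfl (x := c) hu.le rfl ?_ hc
      (y := q + 2 + k) (by omega) ?_
    · rintro v w z rfl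
      rfl
    · intro _ _
      rfl
  · rw [holds_allE, eval_const, min_eq_right (by omega)]
    refine forall_congr' fun l' => forall_congr' fun hl' => ?_
    rw [holds_impE, holds_ltE, holds_ltE]
    rw [eval_digitE h5 h6 _ _ (x := u) (y := l) rfl rfl hu.le (by omega),
      eval_digitE h5 h6 _ _ (x := u) (y := l') rfl rfl hu.le (by omega),
      eval_cellE (k := k) _ _ rfl (x := u) rfl hu.le, eval_cellE (k := k) _ _ rfl (x := u) rfl hu.le]
    rfl

theorem mem_vars_decodeCnf {N : ℕ → ℕ} {m r v : ℕ} : v ∈ (decodeCnf N r m).vars ↔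
    ∃ c < m, ∃ i < N (clauseStart N r c), N (clauseStart N r c + 1 + 2 * i) = v := by
  simp [CnfFormula.vars, decodeCnf, decodeClause]

theorem occTab_spec {N : ℕ → ℕ} {m r : ℕ} (hF : IsFormulaTable n M A N (clauseStart N r) m)
    (hM : 3 * n + 2 * k + 2 * q + 8 ≤ M)
    (h : ∀ x < M, A 9 x = occTab.eval M A (globals n k M x)) {v : ℕ} (hv : v < M) :
    A 9 v ≠ 0 ↔ v = 0 ∨ v - 1 ∈ (decodeCnf N r m).vars := by
  have hmn := hF.count_le
  rw [h v hv, ← Holds, occTab, holds_boolE, holds_orE, holds_eqE, holds_exE, clauseCountE, eval_arr, eval_const, hF.count_eq,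
    min_eq_right (by omega), mem_vars_decodeCnf]
  change v = 0 ∨ _ ↔ _
  rcases Nat.eq_zero_or_pos v with rfl | hpos
  · simp
  refine or_congr Iff.rfl (exists_congr fun c => and_congr_right fun hc => ?_)
  have hst := hF.start_lt c hc
  have hN := hF.nat_le (clauseStart N r c)
  rw [holds_exE]
  simp only [holds_eqE, eval_add, eval_arr, eval_mulE, eval_var, eval_const, Function.update_self,
    min_eq_right (show 2 ≤ M by omega), ne_eq, Nat.reduceEqDiff, not_false_eq_true,
    Function.update_of_ne, hF.start_eq c (by omega), hF.nat_eq _ (show clauseStart N r c < M by omega),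
    min_eq_right (show N (clauseStart N r c) ≤ M by omega), globals_zero, OfNat.zero_ne_ofNat]
  refine exists_congr fun i => and_congr_right fun hi => ?_
  rw [hF.nat_eq _ (by omega)]
  omega

/-- The parts of the constraint that involve only `u`, or only `v`, have been tabulated in arrays
`8` and `9`; the remaining conditions are comparisons of digits and row entries. -/
theorem holds_relE {N : ℕ → ℕ} {m r : ℕ} (hF : IsFormulaTable n M A N (clauseStart N r) m)
    (hM : 3 * n + 2 * k + 2 * q + 8 ≤ M)
    (h5 : ∀ x < M, A 5 x = cspBase (q + 2) k (n + 2) x)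
    (h6 : ∀ x < M, A 6 x = placeValue (cspBase (q + 2) k (n + 2)) x)
    (h8 : ∀ x < M, A 8 x = (okTab q).eval M A (globals n k M x))
    (h9 : ∀ x < M, A 9 x = occTab.eval M A (globals n k M x)) {ρ : ℕ → ℕ} (hk : ρ 2 = k)
    (hp : ρ 20 < M) (hu : ρ 22 < M) (hv : ρ 23 < M) :
    (relE q).Holds M A ρ ↔ cspRel (decodeCnf N r m) (q + 2) k (n + 2)
      (fun u l => A 7 (u * (q + 2 + k) + l)) (ρ 20) (ρ 21) (ρ 22) (ρ 23) := by
  have hK : (arr 6 (const (q + 2))).eval M A ρ =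
      placeValue (cspBase (q + 2) k (n + 2)) (q + 2) := h6 (q + 2) (by omega)
  rw [relE, holds_impE, holds_ltE, holds_impE, holds_leE, hK, eval_var, eval_var, holds_letE,
    eval_sub, hK, eval_var, cspRel]
  refine imp_congr Iff.rfl (imp_congr Iff.rfl ?_)
  rw [cspCore, ← and_assoc (c := (∀ l < q + 2 + k, _ → _) ∧ _), ← okTab_spec hF hM h5 h6 h8 hu,
    holds_andE, holds_andE, holds_andE, holds_andE, holds_allE, eval_const,
    min_eq_right (show q + 2 ≤ M by omega), holds_allE, ← occTab_spec hF hM h9 hv]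
  refine and_congr (forall_congr' fun l => forall_congr' fun hl => ?_) (and_congr Iff.rfl
    (and_congr ?_ (and_congr ?_ Iff.rfl)))
  · rw [holds_eqE, eval_digitE h5 h6 _ _ (x := ρ 22) (y := l) rfl rfl hu.le (by omega),
      eval_digitE h5 h6 _ _ (x := ρ 20) (y := l) rfl rfl hp.le (by omega)]
  · change (∀ l < min M (q + 2 + ρ 2), _) ↔ _
    rw [hk, min_eq_right (by omega)]
    refine forall_congr' fun l => forall_congr' fun hl => ?_
    rw [holds_impE, holds_eqE, holds_eqE,
      eval_digitE h5 h6 _ _ (x := ρ 22) (y := l) rfl rfl hu.le (by omega),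
      eval_cellE (k := k) _ _ (by exact hk) (x := ρ 22) rfl hu.le]
    rfl
  · rw [holds_iffE, holds_eqE, holds_eqE]
    rfl

end Tables

end RamExpr

/-! ### The tables of a grid permutation -/

namespace RamExpr

section GridExpr

variable (dE kE : RamExpr)

def gridSqE : RamExpr := add (mulE dE dE) (const 1)
def gridOffE : RamExpr := modE (var 0) (gridSqE dE)
def gridBlockE : RamExpr := divE (var 0) (gridSqE dE)
def gridRowE : RamExpr := divE (gridBlockE dE) (add kE (const 1))
def gridColE : RamExpr := modE (gridBlockE dE) (add kE (const 1))
def gridFstE : RamExpr := divE (sub (gridOffE dE) (const 1)) dE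
def gridSndE : RamExpr := modE (sub (gridOffE dE) (const 1)) dE
/-- The number of candidates. -/
def gridSizeE : RamExpr := mulE (mulE kE (add kE (const 1))) (gridSqE dE)

def presentTab (rE : RamExpr) : RamExpr :=
  letE 20 (gridRowE dE kE) <| letE 21 (gridColE dE kE) <| letE 22 (gridFstE dE) <|
    letE 23 (gridSndE dE) <| ite (orE (eqE (gridOffE dE) (const 0))
      (ite (orE (eqE (var 21) kE) (eqE (var 20) (var 21))) (eqE (var 22) (var 23)) rE))
      (const 1) (const 0)

def gridKeyE (a b c s : RamExpr) : RamExpr :=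
  ite (eqE (gridOffE dE) (const 0)) (gridBlockE dE) <|
    add (add (mulE kE (add kE (const 1))) (mulE dE (add (mulE (add kE (const 2))
      (add (mulE dE a) b)) s))) c

def gridXTab : RamExpr :=
  letE 20 (gridRowE dE kE) <| letE 21 (gridColE dE kE) <|
    gridKeyE dE kE (var 20) (gridFstE dE) (gridSndE dE) <|
      ite (eqE (var 21) kE) (add kE (const 1)) <|
        ite (eqE (var 20) (var 21)) (const 0) (add (var 21) (const 1))

def gridYTab : RamExpr :=
  letE 20 (gridRowE dE kE) <| letE 21 (gridColE dE kE) <|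
    gridKeyE dE kE (ite (eqE (var 21) kE) (var 20) (var 21)) (gridSndE dE) (gridFstE dE) <|
      ite (eqE (var 21) kE) (const 0) <|
        ite (eqE (var 20) (var 21)) (add kE (const 1)) (add (var 20) (const 1))

def rankTab (b : ℕ) (f g : RamExpr) : RamExpr :=
  sum 10 (gridSizeE dE kE) (ite (andE (arr b (var 10)) (leE f g)) (const 1) (const 0))

def keyNatsTab (b d : ℕ) : RamExpr :=
  ite (eqE (var 0) (const 0)) (sum 10 (gridSizeE dE kE) (ite (arr b (var 10)) (const 1) (const 0)))
    <| letE 11 (add (divE (sub (var 0) (const 1)) (const d)) (const 1)) <|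
      letE 12 (modE (sub (var 0) (const 1)) (const d)) <|
        sum 10 (gridSizeE dE kE) <| ite (andE (arr b (var 10)) (eqE (arr (b + 3) (var 10)) (var 11)))
          (ite (eqE (var 12) (const 0)) (arr (b + 4) (var 10)) <|
            ite (eqE (var 12) (const 1)) (arr (b + 5) (var 10)) (arr (b + 3) (var 10))) (const 0)

/-- The tables that lead to the numbers of a grid permutation; they start at array `b`. -/
def gridTabs (rE : RamExpr) (b d : ℕ) : List RamExpr :=
  [presentTab dE kE rE, gridXTab dE kE, gridYTab dE kE, rankTab dE kE b (var 10) (var 0),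
    rankTab dE kE b (arr (b + 1) (var 10)) (arr (b + 1) (var 0)),
    rankTab dE kE b (arr (b + 2) (var 10)) (arr (b + 2) (var 0)), keyNatsTab dE kE b d]

end GridExpr

/-! ### Values of the grid tables -/

section

variable {n k M D K : ℕ} {A : ℕ → ℕ → ℕ} {dE kE rE : RamExpr} {R : ℕ → ℕ → ℕ → ℕ → Prop}

theorem gridBlock_lt {x : ℕ} (hx : x < M) : gridBlock D x < M := (Nat.div_le_self _ _).trans_lt hx

theorem gridOff_lt {x : ℕ} (hx : x < M) : gridOff D x < M := (Nat.mod_le _ _).trans_lt hx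

/-- The expressions have the values `D` and `K`, and these are below the cap. -/
structure IsGridSize (k M : ℕ) (A : ℕ → ℕ → ℕ) (dE kE : RamExpr) (D K : ℕ) : Prop where
  eval_d : ∀ ρ : ℕ → ℕ, ρ 2 = k → dE.eval M A ρ = D
  eval_k : ∀ ρ : ℕ → ℕ, ρ 2 = k → kE.eval M A ρ = K
  pos : 0 < D
  d_le : D ≤ M
  k_le : K + 2 ≤ M
  size_le : K * (K + 1) * (D * D + 1) ≤ M

namespace IsGridSize

variable (h : IsGridSize k M A dE kE D K) {ρ : ℕ → ℕ}

include h

theorem eval_sq (hk : ρ 2 = k) : (gridSqE dE).eval M A ρ = D * D + 1 := by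
  rw [gridSqE, eval_add, eval_mulE, h.eval_d ρ hk, eval_const, min_eq_right h.d_le]

theorem eval_off (hk : ρ 2 = k) (hx : ρ 0 < M) : (gridOffE dE).eval M A ρ = gridOff D (ρ 0) := by
  rw [gridOffE, eval_modE, h.eval_sq hk, eval_var, capMod_eq hx.le (by omega), gridOff]

theorem eval_block (hk : ρ 2 = k) (hx : ρ 0 < M) :
    (gridBlockE dE).eval M A ρ = gridBlock D (ρ 0) := by
  rw [gridBlockE, eval_divE, h.eval_sq hk, eval_var, capDiv_eq hx.le (by omega), gridBlock]

theorem eval_row (hk : ρ 2 = k) (hx : ρ 0 < M) :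
    (gridRowE dE kE).eval M A ρ = gridBlock D (ρ 0) / (K + 1) := by
  rw [gridRowE, eval_divE, h.eval_block hk hx, eval_add, h.eval_k ρ hk, eval_const,
    capDiv_eq (gridBlock_lt hx).le (by omega)]

theorem eval_col (hk : ρ 2 = k) (hx : ρ 0 < M) :
    (gridColE dE kE).eval M A ρ = gridBlock D (ρ 0) % (K + 1) := by
  rw [gridColE, eval_modE, h.eval_block hk hx, eval_add, h.eval_k ρ hk, eval_const,
    capMod_eq (gridBlock_lt hx).le (by omega)]

theorem eval_fst (hk : ρ 2 = k) (hx : ρ 0 < M) :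
    (gridFstE dE).eval M A ρ = (gridOff D (ρ 0) - 1) / D := by
  have := gridOff_lt (D := D) hx
  rw [gridFstE, eval_divE, eval_sub, h.eval_off hk hx, eval_const, h.eval_d ρ hk,
    capDiv_eq (by omega) h.pos]

theorem eval_snd (hk : ρ 2 = k) (hx : ρ 0 < M) :
    (gridSndE dE).eval M A ρ = (gridOff D (ρ 0) - 1) % D := by
  have := gridOff_lt (D := D) hx
  rw [gridSndE, eval_modE, eval_sub, h.eval_off hk hx, eval_const, h.eval_d ρ hk,
    capMod_eq (by omega) h.pos]

theorem eval_size (hk : ρ 2 = k) :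
    (gridSizeE dE kE).eval M A ρ = K * (K + 1) * (D * D + 1) := by
  have h1 := h.size_le
  have h2 := Nat.mul_le_mul_left (K * (K + 1)) (show 1 ≤ D * D + 1 by omega)
  have := h.k_le
  rw [gridSizeE, eval_mulE, eval_mulE, eval_add, h.eval_k ρ hk, eval_const, h.eval_sq hk,
    min_eq_right (show K ≤ M by omega), min_eq_right (by omega)]

theorem presentTab_spec (hr : ∀ ρ : ℕ → ℕ, ρ 2 = k → ρ 20 < M → ρ 22 < M → ρ 23 < M →
      (rE.Holds M A ρ ↔ R (ρ 20) (ρ 21) (ρ 22) (ρ 23))) {x : ℕ} (hx : x < M) :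
    (presentTab dE kE rE).Holds M A (globals n k M x) ↔ GridPresent K D R x := by
  have hb := gridBlock_lt (D := D) hx
  have ho := gridOff_lt (D := D) hx
  rw [presentTab, holds_letE, h.eval_row rfl hx, holds_letE, h.eval_col rfl (by exact hx), holds_letE,
    h.eval_fst rfl (by exact hx), holds_letE, h.eval_snd rfl (by exact hx), holds_boolE, holds_orE,
    holds_eqE, h.eval_off rfl (by exact hx), holds_ite, GridPresent]
  refine or_congr Iff.rfl ?_
  have e : ∀ {P P' Q Q' S S' : Prop} [Decidable P] [Decidable P'], (P ↔ P') → (Q ↔ Q') → (S ↔ S') →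
      ((if P then Q else S) ↔ if P' then Q' else S') := by
    intro P P' Q Q' S S' _ _ h1 h2 h3
    by_cases hp : P
    · rw [if_pos hp, if_pos (h1.1 hp), h2]
    · rw [if_neg hp, if_neg (fun hp' => hp (h1.2 hp')), h3]
  refine e ?_ ?_ ?_
  · rw [holds_orE, holds_eqE, holds_eqE, h.eval_k _ rfl]
    rfl
  · rw [holds_eqE]
    rfl
  · refine hr _ rfl ?_ ?_ ?_
    · exact (Nat.div_le_self _ _).trans_lt hb
    · exact (Nat.div_le_self _ _).trans_lt ((Nat.sub_le _ _).trans_lt ho)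
    · exact (Nat.mod_le _ _).trans_lt ((Nat.sub_le _ _).trans_lt ho)

theorem eval_key (hk : ρ 2 = k) (hx : ρ 0 < M) (a b c s : RamExpr) :
    (gridKeyE dE kE a b c s).eval M A ρ = if gridOff D (ρ 0) = 0 then gridBlock D (ρ 0) else
      K * (K + 1) + ((a.eval M A ρ * D + b.eval M A ρ) * (K + 2) + s.eval M A ρ) * D
        + c.eval M A ρ := by
  have := h.k_le
  rw [gridKeyE, eval_ite, if_congr (holds_eqE _ _) rfl rfl]
  refine if_congr (by rw [h.eval_off hk hx, eval_const]) (h.eval_block hk hx) ?_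
  simp only [eval_add, eval_mulE, h.eval_k ρ hk, h.eval_d ρ hk, eval_const,
    min_eq_right h.k_le, min_eq_right h.d_le, min_eq_right (show K ≤ M by omega)]
  ring

theorem gridXTab_spec {x : ℕ} (hx : x < M) :
    (gridXTab dE kE).eval M A (globals n k M x) = gridX K D x := by
  rw [gridXTab, eval_letE, h.eval_row rfl hx, eval_letE, h.eval_col rfl (by exact hx),
    h.eval_key rfl (by exact hx), gridX, h.eval_fst rfl (by exact hx), h.eval_snd rfl (by exact hx),
    gridSubX]
  have hK : ∀ i j, kE.eval M A (Function.update (Function.update (globals n k M x) 20 i) 21 j) = K :=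
    fun _ _ => h.eval_k _ rfl
  simp only [eval_ite, holds_eqE, eval_add, eval_const, hK]
  rfl

theorem gridYTab_spec {x : ℕ} (hx : x < M) :
    (gridYTab dE kE).eval M A (globals n k M x) = gridY K D x := by
  rw [gridYTab, eval_letE, h.eval_row rfl hx, eval_letE, h.eval_col rfl (by exact hx),
    h.eval_key rfl (by exact hx), gridY, h.eval_fst rfl (by exact hx), h.eval_snd rfl (by exact hx),
    gridSubY, gridCol]
  have hK : ∀ i j, kE.eval M A (Function.update (Function.update (globals n k M x) 20 i) 21 j) = K :=
    fun _ _ => h.eval_k _ rfl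
  simp only [eval_ite, holds_eqE, eval_add, eval_const, hK]
  rfl

/-- Sums over the used candidates are computed as sums over all candidates whose summand vanishes on
the absent ones; cardinalities, ranks and coordinates are all of this form. -/
theorem sum_present (hk : ρ 2 = k) (e : RamExpr) (g : ℕ → ℕ)
    (he : ∀ c < M, (GridPresent K D R c → e.eval M A (Function.update ρ 10 c) = g c) ∧
      (¬ GridPresent K D R c → e.eval M A (Function.update ρ 10 c) = 0)) :
    (sum 10 (gridSizeE dE kE) e).eval M A ρ = ∑ c ∈ gridSet K D R, g c := by
  classical
  rw [eval_sum, h.eval_size hk, min_eq_right h.size_le, gridSet, Finset.sum_filter]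
  refine Finset.sum_congr rfl fun c hc => ?_
  have hc' := he c ((Finset.mem_range.1 hc).trans_le h.size_le)
  split_ifs with hp
  exacts [hc'.1 hp, hc'.2 hp]

variable {b : ℕ} (hb : ∀ x < M, (A b x ≠ 0 ↔ GridPresent K D R x))

include hb

theorem eval_card (hk : ρ 2 = k) : (sum 10 (gridSizeE dE kE)
    (ite (arr b (var 10)) (const 1) (const 0))).eval M A ρ = (gridSet K D R).card := by
  rw [h.sum_present (R := R) hk _ fun _ => 1, Finset.card_eq_sum_ones]
  intro c hc
  have : (arr b (var 10)).Holds M A (Function.update ρ 10 c) ↔ GridPresent K D R c := hb c hc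
  exact ⟨fun hp => by rw [eval_ite, if_pos (this.2 hp), eval_const],
    fun hp => by rw [eval_ite, if_neg (fun hp' => hp (this.1 hp')), eval_const]⟩

theorem rankTab_spec (f : ℕ → ℕ) (e e' : RamExpr) {x : ℕ}
    (he : ∀ c < M, e.eval M A (Function.update (globals n k M x) 10 c) = f c)
    (he' : ∀ c < M, e'.eval M A (Function.update (globals n k M x) 10 c) = f x) :
    (rankTab dE kE b e e').eval M A (globals n k M x) = keyRank (gridSet K D R) f x := by
  rw [rankTab, h.sum_present (R := R) rfl _ fun c => if f c ≤ f x then 1 else 0, keyRank,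
    Finset.card_filter]
  intro c hc
  classical
  have : (arr b (var 10)).Holds M A (Function.update (globals n k M x) 10 c) ↔
    GridPresent K D R c := hb c hc
  rw [eval_ite, eval_const, eval_const, if_congr (holds_andE _ _) rfl rfl,
    if_congr (and_congr this (holds_leE _ _)) rfl rfl, he c hc, he' c hc]
  exact ⟨fun hp => by simp [hp], fun hp => by simp [hp]⟩

theorem keyNatsTab_spec {d : ℕ} (hd : 0 < d)
    (h3 : ∀ x < M, A (b + 3) x = keyRank (gridSet K D R) id x)
    (h4 : ∀ x < M, A (b + 4) x = keyRank (gridSet K D R) (gridX K D) x)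
    (h5 : ∀ x < M, A (b + 5) x = keyRank (gridSet K D R) (gridY K D) x) {x : ℕ} (hx : x < M) :
    (keyNatsTab dE kE b d).eval M A (globals n k M x) =
      keyNats d (gridSet K D R) (gridX K D) (gridY K D) x := by
  rw [keyNatsTab, eval_ite, keyNats]
  refine if_congr (holds_eqE _ _) (h.eval_card hb rfl) ?_
  rw [eval_letE, eval_letE, keyPoint]
  have e1 : (add (divE (sub (var 0) (const 1)) (const d)) (const 1)).eval M A (globals n k M x) =
      (x - 1) / d + 1 := by
    rw [eval_add, eval_divE, eval_sub, eval_const, eval_const, eval_var]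
    change capDiv M (x - 1) d + 1 = _
    rw [capDiv_eq (by omega) hd]
  have e2 : ∀ v, (modE (sub (var 0) (const 1)) (const d)).eval M A
      (Function.update (globals n k M x) 11 v) = (x - 1) % d := by
    intro v
    rw [eval_modE, eval_sub, eval_const, eval_const, eval_var]
    change capMod M (x - 1) d = _
    rw [capMod_eq (by omega) hd]
  rw [e1, e2]
  refine h.sum_present rfl _ _ fun c hc => ?_
  classical
  set ρ' := Function.update (Function.update (Function.update (globals n k M x) 11 ((x - 1) / d + 1))
    12 ((x - 1) % d)) 10 c
  have hp : (arr b (var 10)).Holds M A ρ' ↔ GridPresent K D R c := hb c hc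
  have hr : (eqE (arr (b + 3) (var 10)) (var 11)).Holds M A ρ' ↔
      keyRank (gridSet K D R) id c = (x - 1) / d + 1 := by
    rw [holds_eqE, ← h3 c hc]
    rfl
  have hv : (ite (eqE (var 12) (const 0)) (arr (b + 4) (var 10)) <| ite (eqE (var 12) (const 1))
      (arr (b + 5) (var 10)) (arr (b + 3) (var 10))).eval M A ρ' =
      keyRank (gridSet K D R) (keyOf (gridX K D) (gridY K D) ((x - 1) % d)) c := by
    have hc0 : (eqE (var 12) (const 0)).Holds M A ρ' ↔ (x - 1) % d = 0 := holds_eqE _ _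
    have hc1 : (eqE (var 12) (const 1)).Holds M A ρ' ↔ (x - 1) % d = 1 := holds_eqE _ _
    rw [eval_ite, eval_ite, if_congr hc0 rfl (if_congr hc1 rfl rfl), keyOf]
    split_ifs
    exacts [h4 c hc, h5 c hc, h3 c hc]
  rw [eval_ite, if_congr ((holds_andE _ _).trans (and_congr hp hr)) hv rfl, eval_const]
  exact ⟨fun hp => by simp [hp], fun hp => by simp [hp]⟩

end IsGridSize

/-- The last of the grid tables holds the numbers of the grid permutation. -/
theorem gridTabs_spec (h : IsGridSize k M A dE kE D K)
    (hr : ∀ ρ : ℕ → ℕ, ρ 2 = k → ρ 20 < M → ρ 22 < M → ρ 23 < M →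
      (rE.Holds M A ρ ↔ R (ρ 20) (ρ 21) (ρ 22) (ρ 23))) {b d : ℕ} (hd : 0 < d)
    (hA : ∀ j (hj : j < (gridTabs dE kE rE b d).length), ∀ x < M,
      A (b + j) x = (gridTabs dE kE rE b d)[j].eval M A (globals n k M x)) :
    ∀ x < M, A (b + 6) x = keyNats d (gridSet K D R) (gridX K D) (gridY K D) x := by
  have hb : ∀ x < M, (A b x ≠ 0 ↔ GridPresent K D R x) := fun x hx => by
    have := hA 0 (by simp [gridTabs]) x hx
    rw [add_zero] at this
    rw [this]
    exact h.presentTab_spec hr hx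
  have h1 : ∀ x < M, A (b + 1) x = gridX K D x := fun x hx =>
    (hA 1 (by simp [gridTabs]) x hx).trans (h.gridXTab_spec hx)
  have h2 : ∀ x < M, A (b + 2) x = gridY K D x := fun x hx =>
    (hA 2 (by simp [gridTabs]) x hx).trans (h.gridYTab_spec hx)
  have h3 : ∀ x < M, A (b + 3) x = keyRank (gridSet K D R) id x := fun x hx =>
    (hA 3 (by simp [gridTabs]) x hx).trans (h.rankTab_spec hb id _ _ (fun _ _ => rfl) fun _ _ => rfl)
  have h4 : ∀ x < M, A (b + 4) x = keyRank (gridSet K D R) (gridX K D) x := fun x hx =>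
    (hA 4 (by simp [gridTabs]) x hx).trans
      (h.rankTab_spec hb (gridX K D) _ _ (fun c hc => h1 c hc) fun _ _ => h1 x hx)
  have h5 : ∀ x < M, A (b + 5) x = keyRank (gridSet K D R) (gridY K D) x := fun x hx =>
    (hA 5 (by simp [gridTabs]) x hx).trans
      (h.rankTab_spec hb (gridY K D) _ _ (fun c hc => h2 c hc) fun _ _ => h2 x hx)
  exact fun x hx => (hA 6 (by simp [gridTabs]) x hx).trans (h.keyNatsTab_spec hb hd h3 h4 h5 hx)

end

end RamExpr

/-! ### The reduction -/

section Instance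

variable (K D : ℕ) (R : ℕ → ℕ → ℕ → ℕ → Prop) (d : ℕ)

/-- The number of points of the pattern. -/
noncomputable def gridPatternCard : ℕ := (gridSet K 1 fun _ _ _ _ => True).card

/-- The number of numbers in the instance. -/
noncomputable def gridNatsLength : ℕ := 1 + gridPatternCard K * d + (1 + (gridSet K D R).card * d)

/-- The numbers of the instance: those of the pattern, then those of the text. -/
noncomputable def gridNats (x : ℕ) : ℕ :=
  if x < 1 + gridPatternCard K * d then
    keyNats d (gridSet K 1 fun _ _ _ _ => True) (gridX K 1) (gridY K 1) x
  else keyNats d (gridSet K D R) (gridX K D) (gridY K D) (x - (1 + gridPatternCard K * d))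

/-- The word of the instance. -/
noncomputable def gridWord : List Bool :=
  encodeNats ((List.range (gridNatsLength K D R d)).map (gridNats K D R d))

variable {K D R d}

theorem gridSet_subset : (gridSet K D R : Set ℕ) ⊆ {c | c < K * (K + 1) * (D * D + 1)} := by
  classical
  intro c hc
  exact Finset.mem_range.1 (Finset.mem_filter.1 hc).1

theorem card_gridSet_le : (gridSet K D R).card ≤ K * (K + 1) * (D * D + 1) := by
  classical
  exact (Finset.card_filter_le _ _).trans (by simp)

theorem gridPatternCard_eq : gridPatternCard K = K * (K + 1) * 2 := by
  rw [gridPatternCard, gridSet_one, Finset.card_range]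

/-- The word encodes the two permutations drawn from the grids, so reading them back reduces the
claim to grid embeddings, and these correspond to solutions. -/
theorem gridWord_mem_iff (hd : 3 ≤ d) :
    (gridWord K D R d, gridPatternCard K) ∈ DimPermPattern d ↔ ∃ val, SolvesCsp K D R val := by
  have : NeZero d := ⟨by omega⟩
  set σ := keyPerm d (gridSet K 1 fun _ _ _ _ => True) (gridX K 1) (gridY K 1)
    (gridX_injOn.mono gridSet_subset) (gridY_injOn.mono gridSet_subset)
  set π := keyPerm d (gridSet K D R) (gridX K D) (gridY K D)
    (gridX_injOn.mono gridSet_subset) (gridY_injOn.mono gridSet_subset)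
  have hw : gridWord K D R d = encodeNats (σ.toNats ++ π.toNats) := by
    rw [keyPerm_toNats, keyPerm_toNats, map_range_append]
    rfl
  have hl : gridPatternCard K = σ.length := keyPerm_length.symm
  rw [hw, hl, DimPerm.mem_dimPermPattern_iff keyPerm_isReduced keyPerm_isReduced,
    exists_isEmbedding_keyPerm_iff hd]
  constructor
  · rintro ⟨φ, h1, h2, h3, h4⟩
    exact IsGridEmbedding.exists_solvesCsp ⟨h1, h2, h3, h4⟩
  · rintro ⟨val, hval⟩
    obtain ⟨φ, h⟩ := exists_isGridEmbedding hval
    exact ⟨φ, h.mem, h.x_iff, h.y_iff, h.z_iff⟩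

theorem keyNats_le {C : Finset ℕ} {f g : ℕ → ℕ} (hd : 0 < d) {x : ℕ} (hx : x < 1 + C.card * d) :
    keyNats d C f g x ≤ C.card := by
  rw [keyNats]
  split_ifs with h0
  · exact le_rfl
  · have h1 : (x - 1) / d < C.card := (Nat.div_lt_iff_lt_mul hd).2 (by omega)
    obtain ⟨c, hc, h⟩ := exists_keyRank_eq (f := id) (Set.injOn_id (C : Set ℕ))
      (Finset.mem_Icc.2 ⟨Nat.succ_pos _, h1⟩ : (x - 1) / d + 1 ∈ Finset.Icc 1 C.card)
    rw [← h, keyPoint_keyRank hc]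
    exact Finset.card_filter_le _ _

theorem gridPatternCard_le (hD : 0 < D) : gridPatternCard K ≤ K * (K + 1) * (D * D + 1) := by
  rw [gridPatternCard_eq]
  exact Nat.mul_le_mul_left _ (by have := Nat.mul_pos hD hD; omega)

theorem gridNats_le (hd : 0 < d) (hD : 0 < D) {x : ℕ} (hx : x < gridNatsLength K D R d) :
    gridNats K D R d x ≤ K * (K + 1) * (D * D + 1) := by
  rw [gridNats]
  rw [gridNatsLength] at hx
  split_ifs with h
  · exact (keyNats_le hd h).trans (gridPatternCard_le hD)
  · exact (keyNats_le hd (by omega)).trans card_gridSet_le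

theorem gridNatsLength_le (hD : 0 < D) :
    gridNatsLength K D R d ≤ 2 + 2 * d * (K * (K + 1) * (D * D + 1)) := by
  have h1 := Nat.mul_le_mul_right d (gridPatternCard_le (K := K) hD)
  have h2 := Nat.mul_le_mul_right d (card_gridSet_le (K := K) (D := D) (R := R))
  rw [gridNatsLength]
  calc _ ≤ 1 + K * (K + 1) * (D * D + 1) * d + (1 + K * (K + 1) * (D * D + 1) * d) := by omega
    _ = _ := by ring

/-- Numbers are written in unary, so the length is the number of entries plus their sum; each entry
is a cardinality or a rank, hence at most the number of candidates. -/
theorem length_gridWord_le (hd : 0 < d) (hD : 0 < D) :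
    ∑ j ∈ Finset.range (gridNatsLength K D R d), gridNats K D R d j + gridNatsLength K D R d ≤
      (2 + 2 * d * (K * (K + 1) * (D * D + 1))) * (K * (K + 1) * (D * D + 1) + 1) := by
  have h1 : ∑ j ∈ Finset.range (gridNatsLength K D R d), gridNats K D R d j ≤ _ :=
    Finset.sum_le_card_nsmul _ _ _ fun x hx => gridNats_le hd hD (Finset.mem_range.1 hx)
  rw [Finset.card_range, smul_eq_mul] at h1
  have h2 := Nat.mul_le_mul_right (K * (K + 1) * (D * D + 1) + 1)
    (gridNatsLength_le (K := K) (R := R) (d := d) hD)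
  rw [mul_add, mul_one] at h2
  omega

end Instance

/-! ### The output tables and the complete list of tables -/

namespace RamExpr

theorem arrBound_mulE (a b : RamExpr) : (mulE a b).arrBound = max a.arrBound b.arrBound := by
  simp [mulE, arrBound]

theorem arrBound_divE (a b : RamExpr) : (divE a b).arrBound = max a.arrBound b.arrBound := by
  simp [divE, arrBound, arrBound_mulE, leE]

theorem arrBound_modE (a b : RamExpr) : (modE a b).arrBound = max a.arrBound b.arrBound := by
  simp [modE, arrBound, arrBound_mulE, arrBound_divE]

theorem arrBound_eqE (a b : RamExpr) : (eqE a b).arrBound = max a.arrBound b.arrBound := by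
  simp [eqE, arrBound, andE, leE, max_comm]

theorem arrBound_allE (x : ℕ) (n e : RamExpr) :
    (allE x n e).arrBound = max n.arrBound e.arrBound := by
  simp [allE, arrBound, notE, exE]

theorem arrBound_iffE (a b : RamExpr) : (iffE a b).arrBound = max a.arrBound b.arrBound := by
  simp [iffE, arrBound, notE]

def cspDomE (q : ℕ) : RamExpr := arr 6 (add (rowE q) (rowE q))
def cspVarsE (q : ℕ) : RamExpr := add (arr 6 (const (q + 2))) (add (var 2) (const 1))
/-- The length of the pattern's part of the output. -/
def patternLengthE (d : ℕ) : RamExpr := add (const 1) (mulE (arr 23 (const 0)) (const d))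
/-- The number of numbers in the output. -/
def outCountE (d : ℕ) : RamExpr :=
  add (patternLengthE d) (add (const 1) (mulE (arr 16 (const 0)) (const d)))

def outNatTab (d : ℕ) : RamExpr :=
  ite (ltE (var 0) (patternLengthE d)) (arr 23 (var 0)) (arr 16 (sub (var 0) (patternLengthE d)))

def outEndTab : RamExpr := add (sum 10 (add (var 0) (const 1)) (arr 24 (var 10))) (var 0)

def outBitTab (d : ℕ) : RamExpr :=
  ite (exE 10 (outCountE d) (eqE (var 0) (arr 25 (var 10)))) (const 0) (const 1)

def validTab (q : ℕ) : RamExpr :=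
  ite (andE (orE (eqE (var 1) (const 0)) (eqE (arr 0 (sub (var 1) (const 1))) (const 0))) <|
    andE (eqE (arr 3 clauseCountE) natCountE) <| allE 13 clauseCountE <|
    andE (leE (arr 2 (arr 3 (var 13))) (const q)) <| allE 14 (arr 2 (arr 3 (var 13))) <|
    leE (arr 2 (add (add (arr 3 (var 13)) (const 2)) (mulE (const 2) (var 14)))) (const 1))
    (const 1) (const 0)

def outLengthTab (d : ℕ) : RamExpr :=
  ite (arr 27 (const 0)) (add (sum 10 (outCountE d) (arr 24 (var 10))) (outCountE d)) (const 0)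

def outParamTab : RamExpr := ite (arr 27 (const 0)) (arr 23 (const 0)) (const 0)

/-- All tables of the reduction. -/
def reductionTabs (q d : ℕ) : List RamExpr :=
  [zerosTab, natTab, startTab, countTab, baseTab q, placeTab, searchTab q, okTab q, occTab] ++
    (gridTabs (cspDomE q) (cspVarsE q) (relE q) 10 d ++
    (gridTabs (const 1) (cspVarsE q) (const 1) 17 d ++
    [outNatTab d, outEndTab, outBitTab d, validTab q, outLengthTab d, outParamTab]))

/-- Only the tables of clause starts, place values and search rows, with the indices `2`, `5` and
`6`, are recursive and read their own array, number `1 + j`. The others read strictly earlier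
arrays. -/
theorem reductionTabs_arrBound (q d : ℕ) :
    ∀ j (h : j < (reductionTabs q d).length), (reductionTabs q d)[j].arrBound ≤
      if j = 2 ∨ j = 5 ∨ j = 6 then 1 + j else j := by
  intro j h
  have h' : j < 29 := h
  interval_cases j <;> simp [reductionTabs, gridTabs, zerosTab, natTab, startTab, countTab, baseTab,
    placeTab, searchTab, okTab, occTab, presentTab, gridXTab, gridYTab, rankTab, keyNatsTab,
    outNatTab, outEndTab, outBitTab, validTab, outLengthTab, outParamTab, gridKeyE, gridSqE,
    gridOffE, gridBlockE, gridRowE, gridColE, gridFstE, gridSndE, gridSizeE, cspDomE, cspVarsE,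
    patternLengthE, outCountE, natCountE, rowE, clauseCountE, digitE, cellE, listedE, satE, relE,
    ltE, leE, andE, orE, impE, exE, arrBound_mulE, arrBound_divE, arrBound_modE, arrBound_eqE,
    arrBound_allE, arrBound_iffE, arrBound]

section

variable {q d n k M : ℕ} {A : ℕ → ℕ → ℕ}

/-- A bit is `0` exactly when its index is one of the terminator positions tabulated in array `25`.
The bound on the word length keeps all indices involved below the cap. -/
theorem outBitTab_spec {g : ℕ → ℕ} {L : ℕ} (hL : ∑ j ∈ Finset.range L, g j + L ≤ M)
    (hc : ∀ ρ, (outCountE d).eval M A ρ = L) (h24 : ∀ x < M, A 24 x = g x)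
    (h25 : ∀ x < M, A 25 x = outEndTab.eval M A (globals n k M x))
    (h26 : ∀ x < M, A 26 x = (outBitTab d).eval M A (globals n k M x)) :
    ∀ x < (encodeNats ((List.range L).map g)).length,
      A 26 x = ((encodeNats ((List.range L).map g)).getD x false).toNat := by
  intro x hx
  have hb := getD_encodeNats_map_range g L x hx
  rw [length_encodeNats_map_range] at hx
  have he : ∀ i < L, A 25 i = endPos g i := by
    intro i hi
    rw [h25 i (by omega), outEndTab, eval_add, eval_sum, eval_add, eval_var, eval_const, endPos,
      globals_zero, min_eq_right (by omega)]
    congr 1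
    exact Finset.sum_congr rfl fun j hj => h24 j (by have := Finset.mem_range.1 hj; omega)
  have hex : (exE 10 (outCountE d) (eqE (var 0) (arr 25 (var 10)))).Holds M A (globals n k M x) ↔
      ∃ i < L, x = endPos g i := by
    rw [holds_exE, hc, min_eq_right (by omega)]
    refine exists_congr fun i => and_congr_right fun hi => ?_
    rw [holds_eqE, ← he i hi]
    rfl
  rw [h26 x (by omega), outBitTab, eval_ite, eval_const, eval_const]
  split_ifs with h
  · rw [hb.2 (hex.1 h)]
    rfl
  · have : (encodeNats ((List.range L).map g)).getD x false = true := by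
      rw [← Bool.not_eq_false]
      exact fun h' => h (hex.2 (hb.1 h'))
    rw [this]
    rfl

theorem validTab_spec {N : ℕ → ℕ} {m r : ℕ} (hF : IsFormulaTable n M A N (clauseStart N r) m)
    (hM : 3 * n + 8 ≤ M) (h1 : A 1 n = r)
    (h : ∀ x < M, A 27 x = (validTab q).eval M A (globals n k M x)) :
    A 27 0 ≠ 0 ↔ (n = 0 ∨ A 0 (n - 1) = 0) ∧ IsValidCnf q N r m := by
  have hmn := hF.count_le
  rw [h 0 (by omega), ← Holds, validTab, holds_boolE, holds_andE, holds_orE, holds_eqE, holds_eqE,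
    holds_andE, holds_eqE, holds_allE, clauseCountE, eval_arr (x := 3), eval_arr (x := 4), eval_const,
    hF.count_eq, hF.start_eq m (by omega), min_eq_right (by omega), IsValidCnf]
  have e1 : natCountE.eval M A (globals n k M 0) = r := h1
  rw [e1]
  refine and_congr Iff.rfl (and_congr Iff.rfl (forall_congr' fun c => forall_congr' fun hc => ?_))
  have hst := hF.start_lt c hc
  have hN := hF.nat_le (clauseStart N r c)
  rw [holds_andE, holds_leE, holds_allE]
  simp only [holds_leE, eval_add, eval_arr, eval_mulE, eval_var, eval_const, Function.update_self,
    min_eq_right (show 2 ≤ M by omega), ne_eq, Nat.reduceEqDiff, not_false_eq_true,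
    Function.update_of_ne, hF.start_eq c (by omega), hF.nat_eq _ (show clauseStart N r c < M by omega),
    min_eq_right (show N (clauseStart N r c) ≤ M by omega)]
  refine and_congr Iff.rfl (forall_congr' fun i => forall_congr' fun hi => ?_)
  rw [hF.nat_eq _ (by omega)]

end

end RamExpr

/-! ### The tables carry out the reduction -/

namespace RamExpr

/-- The cap is large enough for the tables of the reduction. -/
structure IsLargeCap (q d n k M : ℕ) : Prop where
  linear : 3 * n + 2 * k + 2 * q + 8 ≤ M
  table : cspDom (q + 2) k (n + 2) * (q + 2 + k) ≤ M
  output : (2 + 2 * d * (cspVars (q + 2) k (n + 2) * (cspVars (q + 2) k (n + 2) + 1) *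
    (cspDom (q + 2) k (n + 2) * cspDom (q + 2) k (n + 2) + 1))) *
    (cspVars (q + 2) k (n + 2) * (cspVars (q + 2) k (n + 2) + 1) *
      (cspDom (q + 2) k (n + 2) * cspDom (q + 2) k (n + 2) + 1) + 1) ≤ M

theorem cspDom_pos (q k n : ℕ) : 0 < cspDom (q + 2) k (n + 2) :=
  placeValue_pos fun _ _ => cspBase_pos (by omega) (by omega) _

/-- The reduction, as a property of its tables. -/
theorem reductionTabs_spec {q d n k M : ℕ} (hd : 3 ≤ d) (hM : IsLargeCap q d n k M)
    {A B : ℕ → ℕ → ℕ}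
    (hA : ∀ j (h : j < (reductionTabs q d).length), ∀ x < M, A (1 + j) x =
      (reductionTabs q d)[j].eval M (Function.update A (1 + j) fun y =>
        if y < x then A (1 + j) y else B (1 + j) y) (globals n k M x))
    {w : List Bool} (hn : w.length = n) (hw : ∀ j < n, A 0 j = (w.getD j false).toNat) :
    ∃ w' : List Bool, A 28 0 = w'.length ∧ w'.length ≤ M ∧
      (∀ x < w'.length, A 26 x = (w'.getD x false).toNat) ∧
      A 29 0 ≤ gridPatternCard (cspVars (q + 2) k (n + 2)) ∧
      ((w, k) ∈ WeightedCnfSat q ↔ (w', A 29 0) ∈ DimPermPattern d) := by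
  subst hn
  set n := w.length
  obtain ⟨hlin, htab, hout⟩ := hM
  -- For a non-recursive table the expression does not mention the array being filled, so the mixed
  -- array may be replaced by the final one.
  have tabEq : ∀ j (h : j < 29), ¬ (j = 2 ∨ j = 5 ∨ j = 6) → ∀ x < M,
      A (1 + j) x = (reductionTabs q d)[j].eval M A (globals n k M x) := by
    intro j h hj x hx
    have hb := reductionTabs_arrBound q d j h
    rw [if_neg hj] at hb
    rw [hA j h x hx]
    exact eval_congr (fun a ha => Function.update_of_ne (by omega) _ _) _ hb _
  have z1 := zerosTab_spec (tabEq 0 (by omega) (by omega))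
  have z2 := natTab_spec (by omega) z1 (tabEq 1 (by omega) (by omega))
  have z3 := startTab_spec (by omega) z1 z2 (hA 2 (Nat.le_of_ble_eq_true rfl))
  have z4 := countTab_spec (by omega) z1 z3 (tabEq 3 (by omega) (by omega))
  have z5 := baseTab_spec (tabEq 4 (by omega) (by omega))
  have z6 := placeTab_spec (by omega) z5 (hA 5 (Nat.le_of_ble_eq_true rfl))
  set N := decodeNat (A 0) n with hN
  set r := zerosBefore (A 0) n with hr
  set m := clauseCount N r n with hm
  have hrn : r ≤ n := zerosBefore_le _ _
  obtain ⟨hmn, hst, -⟩ := clauseCount_spec (N := N) hrn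
  have hF : IsFormulaTable n M A N (clauseStart N r) m :=
    ⟨z2, z3, z4, fun x => decodeNat_le _ _ _, fun c hc => (hst c hc).trans_le hrn, hmn⟩
  have hs := isSearchTable_of_tab hF hlin htab z5 z6 (hA 6 (Nat.le_of_ble_eq_true rfl))
  set K := cspVars (q + 2) k (n + 2) with hK
  set D := cspDom (q + 2) k (n + 2) with hD
  set R := cspRel (decodeCnf N r m) (q + 2) k (n + 2) fun u l => A 7 (u * (q + 2 + k) + l) with hR
  have hDpos : 0 < D := cspDom_pos q k n
  have hDM : D ≤ M := (Nat.le_mul_of_pos_right _ (by omega)).trans htab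
  have hdM : 0 < d := by omega
  set CN := K * (K + 1) * (D * D + 1) with hCN
  have hCN2 : K * (K + 1) * 2 ≤ CN :=
    Nat.mul_le_mul_left _ (by have := Nat.mul_pos hDpos hDpos; omega)
  have hCNM : CN ≤ M := by
    refine le_trans ?_ hout
    calc CN ≤ 1 * (CN + 1) := by omega
      _ ≤ _ := Nat.mul_le_mul_right _ (by omega)
  have hKM : K + 2 ≤ M := by
    have h1 : 1 ≤ K := by rw [hK, cspVars]; omega
    have h2 := Nat.mul_le_mul_right (K + 1) h1
    omega
  have eD : ∀ ρ : ℕ → ℕ, ρ 2 = k → (cspDomE q).eval M A ρ = D := by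
    intro ρ hk
    rw [cspDomE, eval_arr, rowE, eval_add, eval_add, eval_const, eval_var, hk, z6 _ (by omega), hD,
      cspDom, two_mul]
  have eK : ∀ ρ : ℕ → ℕ, ρ 2 = k → (cspVarsE q).eval M A ρ = K := by
    intro ρ hk
    rw [cspVarsE, eval_add, eval_arr, eval_add, eval_const, eval_const, eval_var, hk,
      z6 _ (by omega), hK, cspVars]
  have gT : IsGridSize k M A (cspDomE q) (cspVarsE q) D K := ⟨eD, eK, hDpos, hDM, hKM, hCNM⟩
  have gP : IsGridSize k M A (const 1) (cspVarsE q) 1 K :=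
    ⟨fun _ _ => rfl, eK, one_pos, by omega, hKM, by omega⟩
  have t16 := gridTabs_spec (R := R) (rE := relE q) (b := 10) gT
    (fun ρ hk h1 h2 h3 => holds_relE hF hlin z5 z6 (tabEq 7 (by omega) (by omega))
      (tabEq 8 (by omega) (by omega)) hk h1 h2 h3) hdM (by
    intro j hj
    have hj' : j < 7 := hj
    interval_cases j
    exacts [tabEq 9 (by omega) (by omega), tabEq 10 (by omega) (by omega),
      tabEq 11 (by omega) (by omega), tabEq 12 (by omega) (by omega),
      tabEq 13 (by omega) (by omega), tabEq 14 (by omega) (by omega),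
      tabEq 15 (by omega) (by omega)])
  have t23 := gridTabs_spec (R := fun _ _ _ _ => True) (rE := const 1) (b := 17) gP
    (fun ρ _ _ _ _ => by simp [Holds, eval_const]) hdM (by
    intro j hj
    have hj' : j < 7 := hj
    interval_cases j
    exacts [tabEq 16 (by omega) (by omega), tabEq 17 (by omega) (by omega),
      tabEq 18 (by omega) (by omega), tabEq 19 (by omega) (by omega),
      tabEq 20 (by omega) (by omega), tabEq 21 (by omega) (by omega),
      tabEq 22 (by omega) (by omega)])
  have c16 : A 16 0 = (gridSet K D R).card := (t16 0 (by omega)).trans (if_pos rfl)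
  have c23 : A 23 0 = gridPatternCard K := (t23 0 (by omega)).trans (if_pos rfl)
  have hp : ∀ ρ, (patternLengthE d).eval M A ρ = 1 + gridPatternCard K * d := by
    intro ρ
    rw [patternLengthE, eval_add, eval_mulE, eval_arr, eval_const, eval_const, eval_const, c23,
      min_eq_right ((gridPatternCard_le hDpos).trans hCNM)]
  have hc : ∀ ρ, (outCountE d).eval M A ρ = gridNatsLength K D R d := by
    intro ρ
    rw [outCountE, eval_add, hp, eval_add, eval_mulE, eval_arr, eval_const, eval_const, eval_const,
      c16, min_eq_right (card_gridSet_le.trans hCNM), gridNatsLength]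
  have t24 : ∀ x < M, A 24 x = gridNats K D R d x := by
    intro x hx
    rw [tabEq 23 (by omega) (by omega) x hx]
    change (outNatTab d).eval M A _ = _
    rw [outNatTab, eval_ite, gridNats]
    refine if_congr ?_ (t23 x hx) ?_
    · rw [holds_ltE, hp]
      rfl
    · rw [eval_arr, eval_sub, hp]
      exact t16 _ (lt_of_le_of_lt (Nat.sub_le _ _) hx)
  have hL : ∑ j ∈ Finset.range (gridNatsLength K D R d), gridNats K D R d j +
      gridNatsLength K D R d ≤ M := (length_gridWord_le hdM hDpos).trans hout
  have t26 := outBitTab_spec hL hc t24 (tabEq 24 (by omega) (by omega))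
    (tabEq 25 (by omega) (by omega))
  have t27 := validTab_spec hF (by omega) (z1 n (by omega)) (tabEq 26 (by omega) (by omega))
  have t28 : A 28 0 = if A 27 0 ≠ 0 then (gridWord K D R d).length else 0 := by
    rw [tabEq 27 (by omega) (by omega) 0 (by omega)]
    change (outLengthTab d).eval M A _ = _
    rw [outLengthTab, eval_ite, if_congr (holds_arr _ _) rfl rfl]
    refine if_congr Iff.rfl ?_ rfl
    rw [eval_add, eval_sum, hc, gridWord, length_encodeNats_map_range, min_eq_right (by omega)]
    congr 1
    exact Finset.sum_congr rfl fun j hj => t24 j (by have := Finset.mem_range.1 hj; omega)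
  have t29 : A 29 0 = if A 27 0 ≠ 0 then gridPatternCard K else 0 := by
    rw [tabEq 28 (by omega) (by omega) 0 (by omega), ← c23]
    rfl
  have hsat := mem_weightedCnfSat_iff (q := q) (k := k) hw
  rw [← and_assoc, ← t27] at hsat
  -- Array `27` tells whether the word encodes a formula of the required shape; if not, the input is
  -- a no-instance and the output is the empty word.
  by_cases hv : A 27 0 ≠ 0
  · rw [if_pos hv] at t28 t29
    have hlen : ∀ C ∈ decodeCnf N r m, C.length ≤ q + 2 := by
      simp only [decodeCnf, List.forall_mem_map, List.mem_range]
      intro c hc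
      have := (((t27.1 hv).2).2 c hc).1
      simp only [decodeClause, List.length_map, List.length_range]
      omega
    have hvars : ∀ v ∈ (decodeCnf N r m).vars, v + 1 < n + 2 := by
      intro v hv
      obtain ⟨c, hc, i, hi, rfl⟩ := mem_vars_decodeCnf.1 hv
      have := decodeNat_le (A 0) n (clauseStart N r c + 1 + 2 * i)
      rw [← hN] at this
      omega
    refine ⟨gridWord K D R d, t28, ?_, t26, t29.le, ?_⟩
    · rw [gridWord, length_encodeNats_map_range]
      exact hL
    · rw [hsat, t29, gridWord_mem_iff hd, and_iff_right hv]
      exact ⟨fun h => exists_solvesCsp (by omega) hlen hvars (by omega) hs h,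
        fun ⟨val, h⟩ => weightedSat_of_solvesCsp (by omega) hlen h⟩
  · rw [if_neg hv] at t28 t29
    refine ⟨[], t28, by simp, by simp, by omega, ?_⟩
    rw [hsat]
    exact ⟨fun h => absurd h.1 hv, fun h => absurd h (nil_notMem_dimPermPattern _ _)⟩

end RamExpr

/-! ### Bounds -/

theorem placeValue_cspBase_le {Q k n l : ℕ} (hl : l ≤ Q + k) :
    placeValue (cspBase Q k n) l = (k + 1) ^ l := by
  rw [placeValue, Finset.prod_congr rfl (g := fun _ => k + 1), Finset.prod_const, Finset.card_range]
  intro i hi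
  rw [Finset.mem_range] at hi
  exact if_pos (by omega)

theorem cspVars_eq (Q k n : ℕ) : cspVars Q k n = (k + 1) ^ Q + (k + 1) := by
  rw [cspVars, placeValue_cspBase_le (by omega)]

/-- For fixed `Q`, only the factor `(Q * (k + 1)) ^ k` is not polynomial in `k` and `n`: it comes
from the positions and literal choices of the `k` search steps, and is the reason for the
exponential factor in the base of the cap. -/
theorem cspDom_eq (Q k n : ℕ) : cspDom Q k n = (k + 1) ^ Q * n ^ Q * (Q * (k + 1)) ^ k := by
  have h : placeValue (cspBase Q k n) (Q + k) = (k + 1) ^ (Q + k) := placeValue_cspBase_le le_rfl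
  rw [cspDom, show 2 * (Q + k) = (Q + k) + Q + k by ring]
  rw [placeValue] at h ⊢
  rw [Finset.prod_range_add, Finset.prod_range_add, h,
    Finset.prod_congr (s₂ := Finset.range Q) (g := fun _ => n) rfl,
    Finset.prod_congr (s₂ := Finset.range k) (g := fun _ => Q) rfl, Finset.prod_const,
    Finset.prod_const, Finset.card_range, Finset.card_range, mul_pow]
  · ring
  · intro i hi
    rw [Finset.mem_range] at hi
    unfold cspBase
    rw [if_neg (by omega), if_neg (by omega)]
  · intro i hi
    rw [Finset.mem_range] at hi
    unfold cspBase
    rw [if_neg (by omega), if_pos (by omega)]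

namespace RamProg

theorem le_capBase {a b n k : ℕ} (hb : 0 < b) : n + k + a ≤ capBase a b n k :=
  Nat.le_mul_of_pos_right _ (Nat.pow_pos (Nat.mul_pos hb (by omega)))

theorem capBase_mono {a b n n' k k' : ℕ} (hb : 0 < b) (hn : n ≤ n') (hk : k ≤ k') :
    capBase a b n k ≤ capBase a b n' k' := by
  unfold capBase
  refine Nat.mul_le_mul (by omega) ?_
  calc (b * (k + 1)) ^ k ≤ (b * (k' + 1)) ^ k := by gcongr
    _ ≤ _ := Nat.pow_le_pow_right (Nat.mul_pos hb (by omega)) hk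

end RamProg

open RamProg in
/-- A power of the base is a sufficient cap. -/
theorem isLargeCap_capBase (q d n k : ℕ) :
    RamExpr.IsLargeCap q d n k (capBase (q + d + 8) (q + 2) n k ^ (12 * (q + 2) + 15)) := by
  set Q := q + 2 with hQ
  set G := capBase (q + d + 8) Q n k with hG
  set D := cspDom Q k (n + 2) with hD
  set K := cspVars Q k (n + 2) with hK
  -- The summand `q + d + 8` makes the constants below, up to `8` and including `q` and `d`, at most
  -- `G`, so each is absorbed by raising the exponent.
  have hGle : n + k + (q + d + 8) ≤ G := le_capBase (by omega)
  have hpow : (Q * (k + 1)) ^ k ≤ G := Nat.le_mul_of_pos_left _ (by omega)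
  have hDG : D ≤ G ^ (2 * Q + 1) := by
    calc D = (k + 1) ^ Q * (n + 2) ^ Q * (Q * (k + 1)) ^ k := cspDom_eq _ _ _
      _ ≤ G ^ Q * G ^ Q * G := by gcongr <;> omega
      _ = _ := by ring
  have hDpos : 0 < D := RamExpr.cspDom_pos q k n
  have hone : ∀ e, 1 ≤ G ^ e := fun e => Nat.one_le_pow _ _ (by omega)
  have hmul : ∀ e x, x ≤ G → x * G ^ e ≤ G ^ (e + 1) := fun e x hx => by
    rw [pow_succ, mul_comm]; gcongr
  have hKG : K ≤ G ^ (Q + 1) := by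
    have h1 : (k + 1) ^ Q ≤ G ^ Q := by gcongr; omega
    have h2 : k + 1 ≤ G ^ Q := (show k + 1 ≤ G ^ 1 by rw [pow_one]; omega).trans
      (Nat.pow_le_pow_right (by omega) (by omega))
    calc K = (k + 1) ^ Q + (k + 1) := cspVars_eq _ _ _
      _ ≤ 2 * G ^ Q := by omega
      _ ≤ _ := hmul _ _ (by omega)
  set CN := K * (K + 1) * (D * D + 1) with hCN
  have hCN1 : CN ≤ G ^ (6 * Q + 6) := by
    calc CN ≤ G ^ (Q + 1) * (2 * G ^ (Q + 1)) *
          (G ^ (2 * Q + 1) * G ^ (2 * Q + 1) + G ^ (4 * Q + 2)) := by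
          rw [hCN]
          have := hone (Q + 1)
          have := hone (4 * Q + 2)
          gcongr
          omega
      _ = 4 * G ^ (6 * Q + 4) := by ring
      _ ≤ G ^ (6 * Q + 4 + 1) := hmul _ _ (by omega)
      _ ≤ _ := Nat.pow_le_pow_right (by omega) (by omega)
  refine ⟨?_, ?_, ?_⟩
  · calc 3 * n + 2 * k + 2 * q + 8 ≤ 3 * G ^ 1 := by rw [pow_one]; omega
      _ ≤ G ^ (1 + 1) := hmul _ _ (by omega)
      _ ≤ _ := Nat.pow_le_pow_right (by omega) (by omega)
  · calc D * (q + 2 + k) ≤ G ^ (2 * Q + 1) * G := Nat.mul_le_mul hDG (by omega)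
      _ = G ^ (2 * Q + 2) := by ring
      _ ≤ _ := Nat.pow_le_pow_right (by omega) (by omega)
  -- The output size is quadratic in the number of candidates, which is at most `G ^ (6 * Q + 6)`;
  -- the constant `4 * (1 + d)` costs two more factors `G`.
  · have h1 := hone (6 * Q + 6)
    calc (2 + 2 * d * CN) * (CN + 1) ≤
          (2 * G ^ (6 * Q + 6) + 2 * d * G ^ (6 * Q + 6)) * (2 * G ^ (6 * Q + 6)) := by
          have : CN + 1 ≤ 2 * G ^ (6 * Q + 6) := by omega
          gcongr
          omega
      _ = (4 * (1 + d)) * G ^ (12 * Q + 12) := by ring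
      _ ≤ (G * G) * G ^ (12 * Q + 12) := by gcongr <;> omega
      _ = G ^ (12 * Q + 14) := by ring
      _ ≤ _ := Nat.pow_le_pow_right (by omega) (by omega)

/-! ### The reduction from weighted satisfiability -/

theorem List.take_eq_append_replicate {w : List Bool} {j Z : ℕ} (hj : j ≤ w.length) (hZ : Z ≤ j)
    (h : ∀ i < Z, w.getD (j - 1 - i) false = false) :
    w.take j = w.take (j - Z) ++ List.replicate Z false := by
  refine List.ext_getElem (by simp; omega) fun i h1 h2 => ?_
  simp only [List.length_take] at h1
  rcases lt_or_ge i (j - Z) with hi | hi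
  · rw [List.getElem_append_left (by simp; omega)]
    simp
  · rw [List.getElem_append_right (by simp; omega), List.getElem_take, List.getElem_replicate]
    have := h (j - 1 - i) (by omega)
    rwa [show j - 1 - (j - 1 - i) = i by omega, List.getD_eq_getElem _ _ (by omega)] at this

/-- If something was cut off, then the word and its prefix both contain a run of `2 * q + 2` zeros,
so both are no-instances. -/
theorem weightedCnfSat_take_iff {q k j : ℕ} {w : List Bool} (hj : j ≤ w.length)
    (h : j = w.length ∨ 2 * q + 2 ≤ j ∧ ∀ i < 2 * q + 2, w.getD (j - 1 - i) false = false) :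
    (w.take j, k) ∈ WeightedCnfSat q ↔ (w, k) ∈ WeightedCnfSat q := by
  rcases h with rfl | ⟨h1, h2⟩
  · rw [List.take_length]
  · have h3 := List.take_eq_append_replicate hj h1 h2
    have h4 : (w.take j, k) ∉ WeightedCnfSat q := not_long_run (v := []) (by rw [h3, List.append_nil])
    have h5 : (w, k) ∉ WeightedCnfSat q :=
      not_long_run (u := w.take (j - (2 * q + 2))) (v := w.drop j)
        (by rw [← h3, List.take_append_drop])
    exact ⟨fun h => absurd h h4, fun h => absurd h h5⟩

namespace RamProg

/-- The program that turns a formula into two permutations. -/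
def reduction (q d : ℕ) : RamProg :=
  .seq (scan (2 * q + 2)) <| .seq (capProg (q + d + 8) (q + 2) (12 * (q + 2) + 15)) <|
    RamExpr.tabulate (RamExpr.reductionTabs q d) 26 28 29

/-- The running time is polynomial in the base of the cap. -/
theorem reduction_spec (q d : ℕ) (hd : 3 ≤ d) : ∃ C c, ∀ (w : List Bool) (k : ℕ) (s : RamState)
    (U : Finset ℕ) (E : ℕ), s.Shows w k → (∀ i ∉ U, s.arr 0 i = 0) →
    capBase (q + d + 8) (q + 2) ((U.card + 1) * (2 * q + 2)) k ≤ E →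
    (reduction q d).Spec s (C * E ^ c) fun s' => ∃ w' k', s'.Shows w' k' ∧
      k' ≤ gridPatternCard (cspVars (q + 2) k 0) ∧
      ((w, k) ∈ WeightedCnfSat q ↔ (w', k') ∈ DimPermPattern d) := by
  obtain ⟨C, c, hC⟩ := RamExpr.tabulate_spec (RamExpr.reductionTabs q d) 26 28 29 (by omega)
    (by omega) (by omega) fun j hj =>
      (RamExpr.reductionTabs_arrBound q d j hj).trans (by split_ifs <;> omega)
  set c₀ := 12 * (q + 2) + 15 with hc₀
  refine ⟨9 + 8 + ((q + 2) * 3 + ((q + 2) * 6 + 10) + c₀ * 10 + 15) + C * 2 ^ c, c₀ * c + 2,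
    fun w k s U E ⟨hw, hk, hs⟩ hU hE => ?_⟩
  set Z := 2 * q + 2 with hZ
  have hE1 := (le_capBase (a := q + d + 8) (n := (U.card + 1) * Z) (k := k)
    (show 0 < q + 2 by omega)).trans hE
  have p1 : 1 ≤ E ^ (c₀ * c + 2) := Nat.one_le_pow _ _ (by omega)
  have p2 : E ≤ E ^ (c₀ * c + 2) := by
    calc E = E ^ 1 := (pow_one E).symm
      _ ≤ _ := Nat.pow_le_pow_right (by omega) (by omega)
  have p3 : E * E ≤ E ^ (c₀ * c + 2) := by
    calc E * E = E ^ 2 := by ring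
      _ ≤ _ := Nat.pow_le_pow_right (by omega) (by omega)
  have p4 : (E ^ c₀ + 1) ^ c ≤ 2 ^ c * E ^ (c₀ * c + 2) := by
    have : 1 ≤ E ^ c₀ := Nat.one_le_pow _ _ (by omega)
    calc (E ^ c₀ + 1) ^ c ≤ (2 * E ^ c₀) ^ c := by gcongr; omega
      _ = 2 ^ c * E ^ (c₀ * c) := by rw [mul_pow, ← pow_mul]
      _ ≤ _ := by gcongr <;> omega
  refine Spec.mono ((scan_spec Z (by omega) _ k s U hU hw hk).seq (T' := ((q + 2) * 3 +
    k * ((q + 2) * (k + 1) * 3 + 10) + c₀ * (E * 3 + 7) + 15) + C * (E ^ c₀ + 1) ^ c) ?_) ?_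
    fun _ h => h
  · rintro s1 ⟨ha, h1, hle, hle', hor⟩
    set j := s1.reg 0 with hj
    have hcap : capBase (q + d + 8) (q + 2) j k ≤ E :=
      (capBase_mono (by omega) hle' le_rfl).trans hE
    refine ((capProg_spec (q + d + 8) (q + 2) c₀ j k s1 hj.symm h1).seq
      (T' := C * (E ^ c₀ + 1) ^ c) ?_).mono (by gcongr) fun _ h => h
    rintro s2 ⟨ga, g0, g1, g2⟩
    refine (hC j k _ s2 g0 g1 g2).mono (by gcongr) ?_
    rintro s3 ⟨A, hA0, h0, h1, hout, hA⟩
    have hlen : (w.take j).length = j := by simpa using hle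
    have hwA : ∀ i < j, A 0 i = ((w.take j).getD i false).toNat := by
      intro i hi
      rw [hA0, ga, ha, hs i (by omega), List.getD_eq_getElem _ _ (by omega),
        List.getD_eq_getElem _ _ (by omega), List.getElem_take]
    obtain ⟨w', h28, hM, h26, h29, hiff⟩ := RamExpr.reductionTabs_spec hd
      (isLargeCap_capBase q d j k) hA hlen hwA
    refine ⟨w', A 29 0, ⟨h0.trans h28, h1, fun i hi => ?_⟩, ?_, ?_⟩
    · rw [hout i (hi.trans_le hM), h26 i hi]
    -- The number of constraint variables does not depend on the bound for the values, so `0` may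
    -- stand in its place.
    · rwa [cspVars_eq] at h29 ⊢
    · rw [← hiff, weightedCnfSat_take_iff hle]
      refine hor.imp id fun h => ⟨h.1, fun i hi => ?_⟩
      have h2 := h.2 i hi
      rw [hs _ (by omega)] at h2
      revert h2
      cases w.getD (j - 1 - i) false <;> simp
  · have e1 : (U.card + 1) * Z * 9 + 8 ≤ (9 + 8) * E ^ (c₀ * c + 2) := by omega
    have e2 : k * ((q + 2) * (k + 1) * 3 + 10) ≤ ((q + 2) * 6 + 10) * E ^ (c₀ * c + 2) := by
      calc k * ((q + 2) * (k + 1) * 3 + 10) ≤ E * ((q + 2) * (E + E) * 3 + 10 * E) := by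
            gcongr <;> omega
        _ = ((q + 2) * 6 + 10) * (E * E) := by ring
        _ ≤ _ := by gcongr
    have e3 : c₀ * (E * 3 + 7) ≤ c₀ * 10 * E ^ (c₀ * c + 2) := by
      rw [mul_assoc]
      gcongr
      omega
    have e4 : C * (E ^ c₀ + 1) ^ c ≤ C * 2 ^ c * E ^ (c₀ * c + 2) := by
      rw [mul_assoc]
      gcongr
    have e5 : (q + 2) * 3 + 15 ≤ ((q + 2) * 3 + 15) * E ^ (c₀ * c + 2) :=
      Nat.le_mul_of_pos_right _ p1
    calc _ ≤ (9 + 8) * E ^ (c₀ * c + 2) + (((q + 2) * 3 + 15) * E ^ (c₀ * c + 2) +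
          ((q + 2) * 6 + 10) * E ^ (c₀ * c + 2) + c₀ * 10 * E ^ (c₀ * c + 2) +
          C * 2 ^ c * E ^ (c₀ * c + 2)) := by omega
      _ = _ := by ring

end RamProg

/-! ### Hardness -/

theorem Primrec.nat_pow : Primrec₂ fun a b : ℕ => a ^ b :=
  (Primrec.nat_rec (f := fun _ : ℕ => 1) (g := fun (a : ℕ) (p : ℕ × ℕ) => p.2 * a)
    (Primrec.const 1) (Primrec.nat_mul.comp (Primrec.snd.comp Primrec.snd) Primrec.fst)).of_eq
      fun a b => by
        induction b with
        | zero => rfl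
        | succ b ih => rw [pow_succ, ← ih]

theorem Computable.nat_add {f g : ℕ → ℕ} (hf : Computable f) (hg : Computable g) :
    Computable fun x => f x + g x := Primrec.nat_add.to_comp.comp hf hg

theorem Computable.nat_mul {f g : ℕ → ℕ} (hf : Computable f) (hg : Computable g) :
    Computable fun x => f x * g x := Primrec.nat_mul.to_comp.comp hf hg

theorem Computable.nat_pow {f g : ℕ → ℕ} (hf : Computable f) (hg : Computable g) :
    Computable fun x => f x ^ g x := Primrec.nat_pow.to_comp.comp hf hg

theorem gridPatternCard_mono {K K' : ℕ} (h : K ≤ K') : gridPatternCard K ≤ gridPatternCard K' := by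
  rw [gridPatternCard_eq, gridPatternCard_eq]
  gcongr

theorem theoremt (d : ℕ) (hd : 3 ≤ d) : W1Hard (DimPermPattern d) := by
  rintro A ⟨q, -, R, p, f, g, c, hf, hg, hR⟩
  obtain ⟨C, e, hC⟩ := RamProg.reduction_spec q d hd
  set Z := 2 * q + 2 with hZ
  -- This is the base of the cap for `n = (1 + f k) * Z` and the parameter `g k`. Since the base
  -- grows at most linearly in `n`, the power of the input length factors out, leaving a function of
  -- `k`.
  set H : ℕ → ℕ := fun k => ((1 + f k) * Z + g k + (q + d + 8)) * ((q + 2) * (g k + 1)) ^ g k with hH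
  have hHf : ∀ k, 1 + f k ≤ H k := fun k => by
    have h1 : 1 ≤ ((q + 2) * (g k + 1)) ^ g k :=
      Nat.one_le_pow _ _ (Nat.mul_pos (by omega) (by omega))
    calc 1 + f k ≤ (1 + f k) * Z := Nat.le_mul_of_pos_right _ (by omega)
      _ ≤ (1 + f k) * Z + g k + (q + d + 8) := by omega
      _ ≤ _ := Nat.le_mul_of_pos_right _ h1
  have key : ∀ x k, ∃ I : List Bool × ℕ, ((x, k) ∈ A ↔ I ∈ DimPermPattern d) ∧
      I.2 ≤ gridPatternCard (cspVars (q + 2) (g k) 0) ∧ ∃ t s,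
        t ≤ ((C + 1) * H k ^ (e + 1)) * (x.length + 1) ^ ((c + 1) * (e + 1)) ∧
        (RamProg.seq p (RamProg.reduction q d)).Runs (RamState.init x k) t s ∧ s.Shows I.1 I.2 := by
    intro x k
    obtain ⟨hmem, hk', t, s, ht, hrun, hs⟩ := hR x k
    -- The announced length of the intermediate word is not bounded by the running time, but its
    -- number of ones is, by `x.length` plus the number of steps.
    obtain ⟨U, hU, hU0⟩ := hrun.exists_support 0 (Finset.range x.length) (by
      intro i hi
      have hi' : x.length ≤ i := by simpa using hi
      simp [RamState.init, hi'])
    rw [Finset.card_range] at hU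
    set X := x.length + 1 with hX
    set E := H k * X ^ (c + 1) with hE
    have hX1 : 1 ≤ X ^ (c + 1) := Nat.one_le_pow _ _ (by omega)
    have hXc : X ≤ X ^ (c + 1) := Nat.le_self_pow (by omega) _
    have hXc' : X ^ c ≤ X ^ (c + 1) := Nat.pow_le_pow_right (by omega) (by omega)
    have hfX : f k * X ^ c ≤ f k * X ^ (c + 1) := Nat.mul_le_mul_left _ hXc'
    have hUE : U.card + 1 ≤ (1 + f k) * X ^ (c + 1) := by
      rw [add_mul]
      omega
    have htE : t ≤ E := by
      calc t ≤ (1 + f k) * X ^ (c + 1) := by rw [add_mul]; omega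
        _ ≤ E := Nat.mul_le_mul_right _ (hHf k)
    have hcap : RamProg.capBase (q + d + 8) (q + 2) ((U.card + 1) * Z) (R (x, k)).2 ≤ E := by
      refine (RamProg.capBase_mono (by omega) (Nat.mul_le_mul_right Z hUE) hk').trans ?_
      -- Every summand of the linear factor is multiplied by `X ^ (c + 1) ≥ 1`, which can then be
      -- pulled out.
      rw [RamProg.capBase, hE, hH]
      calc _ ≤ ((1 + f k) * X ^ (c + 1) * Z + g k * X ^ (c + 1) + (q + d + 8) * X ^ (c + 1)) *
            ((q + 2) * (g k + 1)) ^ g k := by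
            gcongr <;> exact Nat.le_mul_of_pos_right _ hX1
        _ = _ := by ring
    obtain ⟨t', s', ht', hrun', w', k', hs', hk'', hiff⟩ := hC _ _ s U E hs hU0 hcap
    refine ⟨(w', k'), hmem.trans hiff, hk''.trans (gridPatternCard_mono ?_), t + t', s', ?_,
      hrun.seq hrun', hs'⟩
    · rw [cspVars_eq, cspVars_eq]
      gcongr
    · have hE1 : 1 ≤ E := Nat.mul_pos ((Nat.succ_le_of_lt (by omega)).trans (hHf k)) hX1
      calc t + t' ≤ E ^ (e + 1) + C * E ^ (e + 1) := by
            refine Nat.add_le_add (htE.trans (Nat.le_self_pow (by omega) _)) (ht'.trans ?_)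
            exact Nat.mul_le_mul_left _ (Nat.pow_le_pow_right hE1 (by omega))
        _ = _ := by rw [hE, mul_pow, ← pow_mul]; ring
  choose I h1 h2 h3 using key
  refine ⟨fun i => I i.1 i.2, .seq p (RamProg.reduction q d), fun k => (C + 1) * H k ^ (e + 1),
    fun k => gridPatternCard (cspVars (q + 2) (g k) 0), (c + 1) * (e + 1), ?_, ?_,
    fun x k => ⟨h1 x k, h2 x k, h3 x k⟩⟩
  · have hc : ∀ a : ℕ, Computable fun _ : ℕ => a := fun a => Computable.const a
    exact (hc _).nat_mul <| Computable.nat_pow (((((hc 1).nat_add hf).nat_mul (hc Z)).nat_add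
      hg).nat_add (hc _) |>.nat_mul (((hc _).nat_mul (hg.nat_add (hc 1))).nat_pow hg)) (hc _)
  · have hc : ∀ a : ℕ, Computable fun _ : ℕ => a := fun a => Computable.const a
    have hK : Computable fun k => (g k + 1) ^ (q + 2) + (g k + 1) :=
      ((hg.nat_add (hc 1)).nat_pow (hc _)).nat_add (hg.nat_add (hc 1))
    exact ((hK.nat_mul (hK.nat_add (hc 1))).nat_mul (hc 2)).of_eq fun k => by
      rw [gridPatternCard_eq, cspVars_eq]
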